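/- Let $w(t)=(w_1(t),\dots,w_D(t))$, $t\ge 0$, be a $D$-dimensional Brownian motion with correlation matrix $\Omega$ (so $\Omega$ is positive semidefinite with unit diagonal, and $w(t)-w(s)\sim N(0,(t-s)\Omega)$ for $s\le t$). Let $f:\mathbb{R}^d\to\mathbb{R}^d$ and $g:\mathbb{R}^d\to\mathbb{R}^{d\times D}$ be $C^2$, and put $$h_{ijk}(x)=\tfrac12\sum_{l=1}^d g_{lk}(x)\,\frac{\partial g_{ij}}{\partial x_l}(x).$$ Assume that there is a constant $L$ such that for all $x\in\mathbb{R}^d$ and all indices $$\Big|\frac{\partial f_i}{\partial x_l}(x)\Big|,\ \Big|\frac{\partial g_{ij}}{\partial x_l}(x)\Big|,\ \Big|\frac{\partial h_{ijk}}{\partial x_l}(x)\Big|,\ \Big|\frac{\partial^2 f_i}{\partial x_k\partial x_l}(x)\Big|,\ \Big|\frac{\partial^2 g_{ij}}{\partial x_k\partial x_l}(x)\Big|\ \le L .$$ Fix $T>0$ and $x_0\in\mathbb{R}^d$. For a step size $\delta>0$ and an increment $v\in\mathbb{R}^D$ the truncated Milstein step (without Lévy areas) is $$S_\delta(x,v)_i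 = x_i+f_i(x)\,\delta+\sum_{j=1}^D g_{ij}(x)\,v_j+\sum_{j,k=1}^D h_{ijk}(x)\,(v_jv_k-\Omega_{jk}\,\delta).$$ For an integer $N\ge1$ let $\Delta t=T/N$, $t_n=n\,\Delta t$, $t_{n+1/2}=(n+\tfrac12)\Delta t$, $\Delta w_n=w(t_{n+1})-w(t_n)$, $\delta w_n=w(t_{n+1/2})-w(t_n)$ and $\delta w_{n+1/2}=w(t_{n+1})-w(t_{n+1/2})$. With $X^c_0=X^f_0=X^a_0=x_0$, define - the coarse path by $X^c_{n+1}=S_{\Delta t}(X^c_n,\Delta w_n)$; - the fine path by $X^f_{n+1/2}=S_{\Delta t/2}(X^f_n,\delta w_n)$ and $X^f_{n+1}=S_{\Delta t/2}(X^f_{n+1/2},\delta w_{n+1/2})$; - the antithetic path by $X^a_{n+1/2}=S_{\Delta t/2}(X^a_n,\delta w_{n+1/2})$ and $X^a_{n+1}=S_{\Delta t/2}(X^a_{n+1/2},\delta w_n)$. Let $X^c(t)$ be the piecewise linear interpolant of the coarse path on the grid of step $\Delta t$, let $X^f(t)$ and $X^a(t)$ be those of the fine and antithetic paths on the grid of step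 $\Delta t/2$, and let $\overline X^f(t)=\tfrac12\big(X^f(t)+X^a(t)\big)$. Then for every real $p\ge 2$ there is a constant $K_p$, independent of $N$, such that for all $N\ge 1$ $$\sup_{0\le t\le T}\mathbb{E}\big[\|X^f(t)-X^a(t)\|^p\big]\le K_p\,\Delta t^{p/2},\qquad \sup_{0\le t\le T}\mathbb{E}\big[\|\overline X^f(t)-X^c(t)\|^p\big]\le K_p\,\Delta t^{p}.$$ Moreover, write $X_{ave}=T^{-1}\int_0^T X(t)\,dt$ for each of the three interpolants $X=X^f,X^a,X^c$, and let $P\in C^2(\mathbb{R}^d,\mathbb{R})$ have bounded first and second derivatives. Then there is a constant $K$, independent of $N$, such that for all $N\ge1$ the variable $\tfrac12\big(P(X^f_{ave})+P(X^a_{ave})\big)-P(X^c_{ave})$ is square integrable and $$\mathbb{V}\Big[\tfrac12\big(P(X^f_{ave})+P(X^a_{ave})\big)-P(X^c_{ave})\Big]\le K\,\Delta t^2 .$$ -/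

import Mathlib

open MeasureTheory ProbabilityTheory
open scoped NNReal ENNReal

noncomputable section

namespace AntitheticMilstein

/-- A correlation matrix: positive semidefinite (in particular symmetric) with unit diagonal. -/
structure IsCorrelationMatrix {D : ℕ} (R : Matrix (Fin D) (Fin D) ℝ) : Prop where
  posSemidef : R.PosSemidef
  diag_eq_one : ∀ j, R j j = 1

/-- `w` is a `D`-dimensional Brownian motion with correlation matrix `R` on the probability space
`(Ω, P)`: it starts at `0`, has continuous paths, independent increments, and `w t - w s` is a
centred Gaussian vector with covariance matrix `(t - s) R`. -/
structure IsBrownianMotion {D : ℕ} {Ω : Type*} [MeasurableSpace Ω]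
    (w : ℝ≥0 → Ω → EuclideanSpace ℝ (Fin D)) (R : Matrix (Fin D) (Fin D) ℝ)
    (P : Measure Ω) : Prop where
  zero : ∀ᵐ ω ∂P, w 0 ω = 0
  cont : ∀ᵐ ω ∂P, Continuous fun t => w t ω
  indep : HasIndepIncrements w P
  law : ∀ s t : ℝ≥0, s ≤ t →
    HasLaw (fun ω => w t ω - w s ω) (multivariateGaussian 0 (((t : ℝ) - (s : ℝ)) • R)) P

/-- The partial derivative `∂φ/∂x_l` of a scalar function on `ℝ^d`. -/
def partialDeriv {d : ℕ} (l : Fin d) (φ : EuclideanSpace ℝ (Fin d) → ℝ)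
    (x : EuclideanSpace ℝ (Fin d)) : ℝ :=
  fderiv ℝ φ x (EuclideanSpace.single l 1)

/-- The tensor `h_{ijk}(x) = (1/2) ∑_l g_{lk}(x) ∂g_{ij}/∂x_l (x)`. -/
def hTensor {d D : ℕ} (g : EuclideanSpace ℝ (Fin d) → Matrix (Fin d) (Fin D) ℝ)
    (i : Fin d) (j k : Fin D) (x : EuclideanSpace ℝ (Fin d)) : ℝ :=
  (1 / 2) * ∑ l : Fin d, g x l k * partialDeriv l (fun y => g y i j) x

/-- The standing assumption on the drift `f` and the diffusion matrix `g`: both are `C²`, and the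
first partial derivatives of `f`, `g`, `h` and the second partial derivatives of `f`, `g` are
bounded by `L` in absolute value. -/
structure CoeffAssumption {d D : ℕ} (f : EuclideanSpace ℝ (Fin d) → EuclideanSpace ℝ (Fin d))
    (g : EuclideanSpace ℝ (Fin d) → Matrix (Fin d) (Fin D) ℝ) (L : ℝ) : Prop where
  contDiff_f : ∀ i, ContDiff ℝ 2 fun x => f x i
  contDiff_g : ∀ i j, ContDiff ℝ 2 fun x => g x i j
  deriv_f : ∀ x i l, |partialDeriv l (fun y => f y i) x| ≤ L
  deriv_g : ∀ x i j l, |partialDeriv l (fun y => g y i j) x| ≤ L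
  deriv_h : ∀ x i j k l, |partialDeriv l (hTensor g i j k) x| ≤ L
  deriv2_f : ∀ x i k l, |partialDeriv k (partialDeriv l fun y => f y i) x| ≤ L
  deriv2_g : ∀ x i j k l, |partialDeriv k (partialDeriv l fun y => g y i j) x| ≤ L

/-- One step of the truncated Milstein scheme (Lévy areas dropped) from state `x`, with time step
`δ` and Brownian increment `dw`. -/
def milsteinStep {d D : ℕ} (f : EuclideanSpace ℝ (Fin d) → EuclideanSpace ℝ (Fin d))
    (g : EuclideanSpace ℝ (Fin d) → Matrix (Fin d) (Fin D) ℝ) (R : Matrix (Fin D) (Fin D) ℝ)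
    (δ : ℝ) (x : EuclideanSpace ℝ (Fin d)) (dw : EuclideanSpace ℝ (Fin D)) :
    EuclideanSpace ℝ (Fin d) :=
  WithLp.toLp 2 fun i =>
    x i + f x i * δ + ∑ j : Fin D, g x i j * dw j
      + ∑ j : Fin D, ∑ k : Fin D, hTensor g i j k x * (dw j * dw k - R j k * δ)

/-- The truncated Milstein path started at `x₀` and driven by the increments `dw 0, dw 1, …`. -/
def milsteinPath {d D : ℕ} (f : EuclideanSpace ℝ (Fin d) → EuclideanSpace ℝ (Fin d))
    (g : EuclideanSpace ℝ (Fin d) → Matrix (Fin d) (Fin D) ℝ) (R : Matrix (Fin D) (Fin D) ℝ)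
    (x₀ : EuclideanSpace ℝ (Fin d)) (δ : ℝ) (dw : ℕ → EuclideanSpace ℝ (Fin D)) :
    ℕ → EuclideanSpace ℝ (Fin d)
  | 0 => x₀
  | n + 1 => milsteinStep f g R δ (milsteinPath f g R x₀ δ dw n) (dw n)

/-- The `m`-th increment of `w` on the uniform grid of step size `δ`. -/
def increment {D : ℕ} {Ω : Type*} (w : ℝ≥0 → Ω → EuclideanSpace ℝ (Fin D)) (δ : ℝ≥0)
    (ω : Ω) (m : ℕ) : EuclideanSpace ℝ (Fin D) :=
  w (((m + 1 : ℕ) : ℝ≥0) * δ) ω - w ((m : ℝ≥0) * δ) ω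

/-- The swap `2n ↔ 2n + 1` of the two half-steps inside each coarse step. -/
def swapHalves (m : ℕ) : ℕ := if Even m then m + 1 else m - 1

/-- The piecewise linear interpolant of the values `X 0, X 1, …` at the times `0, δ, 2δ, …`:
on `[kδ, (k+1)δ]` it is `(1 - λ) X_k + λ X_{k+1}` with `λ = (t - kδ) / δ`. -/
def interp {d : ℕ} (δ : ℝ) (X : ℕ → EuclideanSpace ℝ (Fin d)) (t : ℝ) :
    EuclideanSpace ℝ (Fin d) :=
  (1 - (t - ⌊t / δ⌋₊ * δ) / δ) • X ⌊t / δ⌋₊ + ((t - ⌊t / δ⌋₊ * δ) / δ) • X (⌊t / δ⌋₊ + 1)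

section Paths

variable {d D : ℕ} {Ω : Type*} (f : EuclideanSpace ℝ (Fin d) → EuclideanSpace ℝ (Fin d))
  (g : EuclideanSpace ℝ (Fin d) → Matrix (Fin d) (Fin D) ℝ) (R : Matrix (Fin D) (Fin D) ℝ)
  (x₀ : EuclideanSpace ℝ (Fin d)) (w : ℝ≥0 → Ω → EuclideanSpace ℝ (Fin D)) (T : ℝ≥0) (N : ℕ)

/-- The interpolated coarse path `X^c(t)`, with time step `T / N`. -/
def coarsePath (t : ℝ) (ω : Ω) : EuclideanSpace ℝ (Fin d) :=
  interp ((T / N : ℝ≥0) : ℝ)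
    (milsteinPath f g R x₀ ((T / N : ℝ≥0) : ℝ) fun n => increment w (T / N) ω n) t

/-- The interpolated fine path `X^f(t)`, with time step `T / (2N)`; step `m` of the recursion
produces `X^f_{(m+1)/2}` in the numbering by coarse steps. -/
def finePath (t : ℝ) (ω : Ω) : EuclideanSpace ℝ (Fin d) :=
  interp ((T / (2 * N) : ℝ≥0) : ℝ)
    (milsteinPath f g R x₀ ((T / (2 * N) : ℝ≥0) : ℝ)
      fun m => increment w (T / (2 * N)) ω m) t

/-- The interpolated antithetic path `X^a(t)`: as the fine path, but with the two Brownian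
increments inside each coarse step swapped. -/
def antitheticPath (t : ℝ) (ω : Ω) : EuclideanSpace ℝ (Fin d) :=
  interp ((T / (2 * N) : ℝ≥0) : ℝ)
    (milsteinPath f g R x₀ ((T / (2 * N) : ℝ≥0) : ℝ)
      fun m => increment w (T / (2 * N)) ω (swapHalves m)) t

end Paths

/-- The time average `T⁻¹ ∫_0^T X(t) dt` of a path. -/
def timeAverage {d : ℕ} {Ω : Type*} (T : ℝ≥0) (X : ℝ → Ω → EuclideanSpace ℝ (Fin d)) (ω : Ω) :
    EuclideanSpace ℝ (Fin d) :=
  (T : ℝ)⁻¹ • ∫ t in (0 : ℝ)..(T : ℝ), X t ω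

/-- The antithetic multilevel correction
`(1/2) (Φ(X^f_ave) + Φ(X^a_ave)) - Φ(X^c_ave)` of an Asian payoff `Φ`. -/
def asianCorrection {d D : ℕ} {Ω : Type*}
    (f : EuclideanSpace ℝ (Fin d) → EuclideanSpace ℝ (Fin d))
    (g : EuclideanSpace ℝ (Fin d) → Matrix (Fin d) (Fin D) ℝ) (R : Matrix (Fin D) (Fin D) ℝ)
    (x₀ : EuclideanSpace ℝ (Fin d)) (w : ℝ≥0 → Ω → EuclideanSpace ℝ (Fin D)) (T : ℝ≥0) (N : ℕ)
    (Φ : EuclideanSpace ℝ (Fin d) → ℝ) (ω : Ω) : ℝ :=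
  (1 / 2) * (Φ (timeAverage T (finePath f g R x₀ w T N) ω)
      + Φ (timeAverage T (antitheticPath f g R x₀ w T N) ω))
    - Φ (timeAverage T (coarsePath f g R x₀ w T N) ω)

end AntitheticMilstein

end

/-!
All paths are driven by one sequence of independent increments `s • ζ m`, where `s ^ 2 = T / (2 N)`
is the fine step and `ζ m` has law `N(0, R)`, and a step of the scheme depends only on the linear
maps `G x`, the bilinear maps `H x` and the compensator `c x` (`StepData`).

The Itô-Taylor expansion `StepData.step_step` says that two fine steps with noise `v`, `v'` equal
one coarse step with noise `v + v'`, plus `s ^ 2` times the Lévy term `H x v' v - H x v v'`, plus a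
remainder of mean zero and size `s ^ 3`, plus a remainder of size `s ^ 4`. It holds because the
derivative of `G` at `x` along `G x v`, applied to `v'`, is `2 H x v' v`, so that the Milstein
correction matches the first Taylor coefficient of the diffusion exactly. The Lévy term is
antisymmetric in `(v, v')`. It is therefore all that separates the fine path from the antithetic
path at leading order, where it gives strong order `1/2`, and it cancels in their mean, up to a
difference of Lévy terms at two nearby points. What is left of the mean has order `1`.

These expansions become moment bounds by one Lyapunov estimate,
`exists_lintegral_norm_add_pow_le`: if the current error `e` is perturbed by a centred term of
size `s (‖e‖ + η)` and a drift of size `s ^ 2 (‖e‖ + η)`, its `q`-th moment grows by a factor at most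
`1 + K s ^ 2`, plus `K s ^ 2 η ^ q`. Iterated along the chain (`lintegral_chain_le`), it bounds in
turn the paths themselves, the difference `X^f - X^a` with `η ~ s`, and the mean error
`(X^f + X^a) / 2 - X^c` with `η ~ s ^ 2 + ‖X^f - X^a‖ ^ 2`. The last `η` is quadratic in the difference,
because the coefficients have bounded second derivatives. At the midpoints of the coarse steps the
interpolated coarse path takes the average of two neighbouring values, and
`StepData.norm_average_step_sub_le` shows that a single half-step costs only a further `O(s ^ 2)`.

A piecewise linear interpolant, and also its time average, is a convex combination of grid values
(`interp_eq_sum`, `average_interp_eq_sum`), so Jensen's inequality carries the grid bounds over,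
and Lyapunov's inequality replaces the even integer exponents by the real exponent `p`. The payoff
is reduced to the same two quantities by Taylor's formula: its correction is at most a
constant times `‖X^f_ave - X^a_ave‖ ^ 2 + ‖(X^f_ave + X^a_ave) / 2 - X^c_ave‖`.
-/

set_option linter.unusedSectionVars false

noncomputable section

namespace AntitheticMilstein

/-! ### The scheme in coordinate-free form -/

/-- Coefficients of a truncated Milstein scheme in coordinate-free form: the drift `f`, the
diffusion `G x : V → E`, the bilinear correction `H x`, and the compensator `c x`, the mean of
`H x v v` under the law of the normalised noise `v`. The linear maps `f' x` and `G' x` are first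
order Taylor coefficients, and `G'_apply_G` is the identity `2 h = g · ∂g` that makes the scheme a
Milstein scheme. A single constant `C` bounds everything. -/
structure StepData (E V : Type*) [NormedAddCommGroup E] [InnerProductSpace ℝ E]
    [NormedAddCommGroup V] [NormedSpace ℝ V] where
  f : E → E
  f' : E → E →L[ℝ] E
  G : E → V →L[ℝ] E
  G' : E → E →L[ℝ] V →L[ℝ] E
  H : E → V →L[ℝ] V →L[ℝ] E
  c : E → E
  C : ℝ
  one_le_C : 1 ≤ C
  f_growth : ∀ x, ‖f x‖ ≤ C * (1 + ‖x‖)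
  G_growth : ∀ x, ‖G x‖ ≤ C * (1 + ‖x‖)
  H_growth : ∀ x, ‖H x‖ ≤ C * (1 + ‖x‖)
  c_growth : ∀ x, ‖c x‖ ≤ C * (1 + ‖x‖)
  f_lip : ∀ x y, ‖f x - f y‖ ≤ C * ‖x - y‖
  G_lip : ∀ x y, ‖G x - G y‖ ≤ C * ‖x - y‖
  H_lip : ∀ x y, ‖H x - H y‖ ≤ C * ‖x - y‖
  c_lip : ∀ x y, ‖c x - c y‖ ≤ C * ‖x - y‖
  f_taylor : ∀ x y, ‖f y - f x - f' x (y - x)‖ ≤ C * ‖y - x‖ ^ 2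
  G_taylor : ∀ x y, ‖G y - G x - G' x (y - x)‖ ≤ C * ‖y - x‖ ^ 2
  f'_le : ∀ x, ‖f' x‖ ≤ C
  G'_le : ∀ x, ‖G' x‖ ≤ C
  G'_apply_G : ∀ x v v', G' x (G x v) v' = (2 : ℝ) • H x v' v

namespace StepData

variable {E V : Type*} [NormedAddCommGroup E] [InnerProductSpace ℝ E]
    [NormedAddCommGroup V] [NormedSpace ℝ V] (S : StepData E V)

/-- One step of the scheme over a time `s ^ 2`, driven by the increment `s • v`. -/
def step (s : ℝ) (x : E) (v : V) : E :=
  x + s ^ 2 • S.f x + s • S.G x v + s ^ 2 • (S.H x v v - S.c x)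

/-- One step over a time `2 s ^ 2`, driven by the sum `s • (v + v')` of two increments. -/
def coarseStep (s : ℝ) (x : E) (v v' : V) : E :=
  x + (2 * s ^ 2) • S.f x + s • S.G x (v + v')
    + s ^ 2 • (S.H x (v + v') (v + v') - (2 : ℝ) • S.c x)

/-- The truncated Lévy area term: antisymmetric in the two increments. -/
def levyTerm (x : E) (v v' : V) : E := S.H x v' v - S.H x v v'

/-- Martingale part of the difference between two fine steps and a coarse step. -/
def martRem (s : ℝ) (x : E) (v v' : V) : E :=
  s ^ 3 • S.f' x (S.G x v)
    + s • (S.G (S.step s x v) - S.G x - S.G' x (s • S.G x v)) v'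
    + s ^ 2 • ((S.H (S.step s x v) - S.H x) v' v' - (S.c (S.step s x v) - S.c x))

/-- Drift part of the difference between two fine steps and a coarse step. -/
def driftRem (s : ℝ) (x : E) (v : V) : E :=
  s ^ 2 • (S.f (S.step s x v) - S.f x - S.f' x (s • S.G x v))

/-- Two fine steps, expanded around the coarse step with the same total increment. -/
lemma step_step (s : ℝ) (x : E) (v v' : V) :
    S.step s (S.step s x v) v' = S.coarseStep s x v v' + s ^ 2 • S.levyTerm x v v'
      + S.martRem s x v v' + S.driftRem s x v := by
  have h : S.step s (S.step s x v) v' = S.step s x v + s ^ 2 • S.f (S.step s x v)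
    + s • S.G (S.step s x v) v'
    + s ^ 2 • (S.H (S.step s x v) v' v' - S.c (S.step s x v)) := rfl
  rw [h, martRem, driftRem, coarseStep, levyTerm]
  simp only [map_smul, map_add, add_apply, sub_apply,
    smul_apply, S.G'_apply_G]
  generalize S.f (S.step s x v) = a
  generalize S.G (S.step s x v) = b
  generalize S.H (S.step s x v) = b'
  generalize S.c (S.step s x v) = b''
  rw [step]
  module

variable {S}

lemma C_pos : 0 < S.C := lt_of_lt_of_le one_pos S.one_le_C

section Bounds

variable {s r : ℝ} (hs : 0 ≤ s) (hsC : s ≤ S.C) (hr : 1 ≤ r) {v v' : V} (hv : ‖v‖ ≤ r)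
  (hv' : ‖v'‖ ≤ r) (x : E)

include hv in
lemma norm_G_apply_le : ‖S.G x v‖ ≤ S.C * (1 + ‖x‖) * r :=
  (S.G x).le_of_opNorm_le_of_le (S.G_growth x) hv

include hv hv' in
lemma norm_H_apply_le : ‖S.H x v v'‖ ≤ S.C * (1 + ‖x‖) * r * r :=
  (S.H x v).le_of_opNorm_le_of_le ((S.H x).le_of_opNorm_le_of_le (S.H_growth x) hv) hv'

include hr hv in
/-- The increment of one step, up to its leading term `s • G x v`. -/
lemma norm_step_sub_sub_le :
    ‖S.step s x v - x - s • S.G x v‖ ≤ 3 * S.C * s ^ 2 * (1 + ‖x‖) * r ^ 2 := by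
  have e : S.step s x v - x - s • S.G x v = s ^ 2 • (S.f x + S.H x v v - S.c x) := by
    rw [step]; module
  have h0 := S.C_pos
  have h1 : ‖S.f x + S.H x v v - S.c x‖ ≤ 3 * S.C * (1 + ‖x‖) * r ^ 2 := by
    have hX : 0 ≤ S.C * (1 + ‖x‖) := by positivity
    have hr2 : 1 ≤ r ^ 2 := one_le_pow₀ hr
    calc ‖S.f x + S.H x v v - S.c x‖ ≤ ‖S.f x‖ + ‖S.H x v v‖ + ‖S.c x‖ :=
          (norm_sub_le _ _).trans (by gcongr; exact norm_add_le _ _)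
      _ ≤ S.C * (1 + ‖x‖) + S.C * (1 + ‖x‖) * r * r + S.C * (1 + ‖x‖) := by
          gcongr
          · exact S.f_growth x
          · exact norm_H_apply_le hv hv x
          · exact S.c_growth x
      _ ≤ _ := by nlinarith
  rw [e, norm_smul, Real.norm_of_nonneg (by positivity)]
  calc s ^ 2 * ‖_‖ ≤ s ^ 2 * (3 * S.C * (1 + ‖x‖) * r ^ 2) := by gcongr
    _ = _ := by ring

include hs hsC hr hv in
lemma norm_step_sub_le : ‖S.step s x v - x‖ ≤ 4 * S.C ^ 2 * s * (1 + ‖x‖) * r ^ 2 := by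
  have h0 := S.one_le_C
  have e : S.step s x v - x = (S.step s x v - x - s • S.G x v) + s • S.G x v := by abel
  rw [e]
  calc _ ≤ ‖S.step s x v - x - s • S.G x v‖ + ‖s • S.G x v‖ := norm_add_le _ _
    _ ≤ 3 * S.C * s ^ 2 * (1 + ‖x‖) * r ^ 2 + s * (S.C * (1 + ‖x‖) * r) := by
        rw [norm_smul, Real.norm_of_nonneg hs]
        gcongr
        · exact norm_step_sub_sub_le hr hv x
        · exact norm_G_apply_le hv x
    _ = 3 * S.C * s * s * (1 + ‖x‖) * r ^ 2 + s * (S.C * 1 * (1 + ‖x‖) * (r * 1)) := by ring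
    _ ≤ 3 * S.C * S.C * s * (1 + ‖x‖) * r ^ 2 + s * (S.C * S.C * (1 + ‖x‖) * (r * r)) := by
        gcongr
    _ = _ := by ring

/-- The shared estimate behind both remainders: the first order Taylor remainder of a map `Φ`
along one step, when the argument of the derivative is only the leading term `s • G x v`. -/
lemma norm_taylor_step_le {F : Type*} [NormedAddCommGroup F] [NormedSpace ℝ F] {Φ : E → F}
    {Φ' : E →L[ℝ] F} (hs : 0 ≤ s) (hsC : s ≤ S.C) (hr : 1 ≤ r) (hv : ‖v‖ ≤ r) (x : E)
    (hΦ : ∀ y, ‖Φ y - Φ x - Φ' (y - x)‖ ≤ S.C * ‖y - x‖ ^ 2)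
    (hΦ' : ‖Φ'‖ ≤ S.C) :
    ‖Φ (S.step s x v) - Φ x - Φ' (s • S.G x v)‖
      ≤ 19 * S.C ^ 5 * s ^ 2 * (1 + ‖x‖) ^ 2 * r ^ 4 := by
  have h0 := S.one_le_C
  have hX : 1 ≤ 1 + ‖x‖ := by linarith [norm_nonneg x]
  set y := S.step s x v with hy
  have e : Φ y - Φ x - Φ' (s • S.G x v)
      = (Φ y - Φ x - Φ' (y - x)) + Φ' (y - x - s • S.G x v) := by
    rw [map_sub Φ' (y - x)]; abel
  rw [e]
  calc _ ≤ ‖Φ y - Φ x - Φ' (y - x)‖ + ‖Φ' (y - x - s • S.G x v)‖ := norm_add_le _ _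
    _ ≤ S.C * (4 * S.C ^ 2 * s * (1 + ‖x‖) * r ^ 2) ^ 2
        + S.C * (3 * S.C * s ^ 2 * (1 + ‖x‖) * r ^ 2) := by
        gcongr
        · refine (hΦ y).trans ?_
          gcongr
          exact norm_step_sub_le hs hsC hr hv x
        · exact Φ'.le_of_opNorm_le_of_le hΦ' (norm_step_sub_sub_le hr hv x)
    _ = 16 * S.C ^ 5 * s ^ 2 * (1 + ‖x‖) ^ 2 * r ^ 4
        + 3 * S.C ^ 2 * s ^ 2 * (1 + ‖x‖) ^ 1 * r ^ 2 := by ring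
    _ ≤ 16 * S.C ^ 5 * s ^ 2 * (1 + ‖x‖) ^ 2 * r ^ 4
        + 3 * S.C ^ 5 * s ^ 2 * (1 + ‖x‖) ^ 2 * r ^ 4 := by
        gcongr <;> first | assumption | norm_num
    _ = _ := by ring

include hs hsC hr hv in
lemma norm_driftRem_le :
    ‖S.driftRem s x v‖ ≤ 19 * S.C ^ 5 * s ^ 4 * (1 + ‖x‖) ^ 2 * r ^ 4 := by
  rw [driftRem, norm_smul, Real.norm_of_nonneg (by positivity)]
  calc _ ≤ s ^ 2 * (19 * S.C ^ 5 * s ^ 2 * (1 + ‖x‖) ^ 2 * r ^ 4) := by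
        gcongr
        exact norm_taylor_step_le hs hsC hr hv x (S.f_taylor x) (S.f'_le x)
    _ = _ := by ring

include hs hsC hr hv hv' in
lemma norm_martRem_le :
    ‖S.martRem s x v v'‖ ≤ 28 * S.C ^ 5 * s ^ 3 * (1 + ‖x‖) ^ 2 * r ^ 5 := by
  have h0 := S.one_le_C
  have hX : 1 ≤ 1 + ‖x‖ := by linarith [norm_nonneg x]
  have hr2 : 1 ≤ r ^ 2 := one_le_pow₀ hr
  have hd := norm_step_sub_le hs hsC hr hv x
  have h1 : ‖S.f' x (S.G x v)‖ ≤ S.C * (S.C * (1 + ‖x‖) * r) :=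
    (S.f' x).le_of_opNorm_le_of_le (S.f'_le x) (norm_G_apply_le hv x)
  have h2 : ‖(S.G (S.step s x v) - S.G x - S.G' x (s • S.G x v)) v'‖
      ≤ (19 * S.C ^ 5 * s ^ 2 * (1 + ‖x‖) ^ 2 * r ^ 4) * r :=
    ContinuousLinearMap.le_of_opNorm_le_of_le _
      (norm_taylor_step_le hs hsC hr hv x (S.G_taylor x) (S.G'_le x)) hv'
  have h3 : ‖(S.H (S.step s x v) - S.H x) v' v'‖
      ≤ S.C * (4 * S.C ^ 2 * s * (1 + ‖x‖) * r ^ 2) * r * r :=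
    ContinuousLinearMap.le_of_opNorm_le_of_le _ (ContinuousLinearMap.le_of_opNorm_le_of_le _
      ((S.H_lip _ _).trans (by gcongr)) hv') hv'
  have h4 : ‖S.c (S.step s x v) - S.c x‖ ≤ S.C * (4 * S.C ^ 2 * s * (1 + ‖x‖) * r ^ 2) :=
    (S.c_lip _ _).trans (by gcongr)
  have h5 : ‖(S.H (S.step s x v) - S.H x) v' v' - (S.c (S.step s x v) - S.c x)‖
      ≤ 8 * S.C ^ 3 * s * (1 + ‖x‖) * r ^ 4 := by
    calc _ ≤ _ := norm_sub_le _ _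
      _ ≤ S.C * (4 * S.C ^ 2 * s * (1 + ‖x‖) * r ^ 2) * r * r
          + S.C * (4 * S.C ^ 2 * s * (1 + ‖x‖) * r ^ 2) * 1 * 1 := by
          rw [mul_one, mul_one]; gcongr
      _ ≤ S.C * (4 * S.C ^ 2 * s * (1 + ‖x‖) * r ^ 2) * r * r
          + S.C * (4 * S.C ^ 2 * s * (1 + ‖x‖) * r ^ 2) * r * r := by
          gcongr
      _ = _ := by ring
  rw [martRem]
  refine (norm_add₃_le ..).trans ?_
  rw [norm_smul, norm_smul, norm_smul, Real.norm_of_nonneg hs, Real.norm_of_nonneg (by positivity),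
    Real.norm_of_nonneg (by positivity)]
  calc _ ≤ s ^ 3 * (S.C * (S.C * (1 + ‖x‖) * r))
        + s * ((19 * S.C ^ 5 * s ^ 2 * (1 + ‖x‖) ^ 2 * r ^ 4) * r)
        + s ^ 2 * (8 * S.C ^ 3 * s * (1 + ‖x‖) * r ^ 4) := by gcongr
    _ = s ^ 3 * S.C ^ 2 * (1 + ‖x‖) ^ 1 * r ^ 1 + 19 * S.C ^ 5 * s ^ 3 * (1 + ‖x‖) ^ 2 * r ^ 5
        + 8 * S.C ^ 3 * s ^ 3 * (1 + ‖x‖) ^ 1 * r ^ 4 := by ring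
    _ ≤ s ^ 3 * S.C ^ 5 * (1 + ‖x‖) ^ 2 * r ^ 5 + 19 * S.C ^ 5 * s ^ 3 * (1 + ‖x‖) ^ 2 * r ^ 5
        + 8 * S.C ^ 5 * s ^ 3 * (1 + ‖x‖) ^ 2 * r ^ 5 := by
        gcongr <;> first | assumption | norm_num
    _ = _ := by ring

end Bounds

/-- A map with quadratic Taylor remainder is affine at midpoints up to a quadratic error. -/
lemma norm_midpoint_sub_le {F : Type*} [NormedAddCommGroup F] [NormedSpace ℝ F] {Φ : E → F}
    {Φ' : E → E →L[ℝ] F} {C : ℝ} (hΦ : ∀ x y, ‖Φ y - Φ x - Φ' x (y - x)‖ ≤ C * ‖y - x‖ ^ 2)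
    (x y : E) :
    ‖(1 / 2 : ℝ) • (Φ x + Φ y) - Φ ((1 / 2 : ℝ) • (x + y))‖ ≤ C * ‖x - y‖ ^ 2 := by
  set m := (1 / 2 : ℝ) • (x + y) with hm
  have hx : x - m = (1 / 2 : ℝ) • (x - y) := by rw [hm]; module
  have hy : y - m = -((1 / 2 : ℝ) • (x - y)) := by rw [hm]; module
  have e : (1 / 2 : ℝ) • (Φ x + Φ y) - Φ m = (1 / 2 : ℝ) •
      ((Φ x - Φ m - Φ' m (x - m)) + (Φ y - Φ m - Φ' m (y - m))) := by
    rw [hx, hy, map_neg]; module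
  have nx : ‖x - m‖ = 1 / 2 * ‖x - y‖ := by
    rw [hx, norm_smul]; norm_num
  have ny : ‖y - m‖ = 1 / 2 * ‖x - y‖ := by
    rw [hy, norm_neg, norm_smul]; norm_num
  have hC : 0 ≤ C * ‖x - y‖ ^ 2 := by
    have := (norm_nonneg _).trans (hΦ y x); simpa using this
  rw [e, norm_smul, Real.norm_of_nonneg (by norm_num)]
  have h1 := hΦ m x
  have h2 := hΦ m y
  rw [nx] at h1; rw [ny] at h2
  have := norm_add_le (Φ x - Φ m - Φ' m (x - m)) (Φ y - Φ m - Φ' m (y - m))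
  nlinarith

end StepData

/-! ### Stability of random recursions in even moments -/

section Stability

variable {E : Type*} [NormedAddCommGroup E] [InnerProductSpace ℝ E]

/-- Second order expansion of an even power of the norm, with the first order term kept exact. -/
lemma exists_norm_add_pow_le (m : ℕ) : ∃ C : ℝ, 0 ≤ C ∧ ∀ e u : E,
    ‖e + u‖ ^ (2 * m + 2) ≤ ‖e‖ ^ (2 * m + 2) + (2 * m + 2) * ‖e‖ ^ (2 * m) * inner ℝ e u
      + C * (‖e‖ + ‖u‖) ^ (2 * m) * ‖u‖ ^ 2 := by
  induction m with
  | zero =>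
    refine ⟨1, zero_le_one, fun e u => ?_⟩
    have := norm_add_sq_real e u
    simp only [Nat.cast_zero, mul_zero, zero_add, pow_zero, mul_one, one_mul]
    linarith
  | succ m ih =>
    obtain ⟨C, hC, h⟩ := ih
    refine ⟨C + (1 + 4 * (m + 1)), by positivity, fun e u => ?_⟩
    have hsq := norm_add_sq_real e u
    set i := inner ℝ e u with hi
    set b := ‖e‖ + ‖u‖ with hb
    have hi' : |i| ≤ ‖e‖ * ‖u‖ := abs_real_inner_le_norm e u
    have heb : ‖e‖ ≤ b := by simp [hb]
    have hub : ‖u‖ ≤ b := by simp [hb]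
    have hb0 : 0 ≤ b := by positivity
    have h1 : ‖e‖ ^ (2 * m + 2) * ‖u‖ ^ 2 ≤ b ^ (2 * m + 2) * ‖u‖ ^ 2 := by gcongr
    have h2 : ‖e‖ ^ (2 * m) * (i * (2 * i + ‖u‖ ^ 2)) ≤ 2 * (b ^ (2 * m + 2) * ‖u‖ ^ 2) := by
      have h3 : i * (2 * i + ‖u‖ ^ 2) ≤ (b * ‖u‖) * (2 * b * ‖u‖) := by
        refine (le_abs_self _).trans ?_
        rw [abs_mul]
        gcongr
        · exact hi'.trans (by gcongr)
        · calc |2 * i + ‖u‖ ^ 2| ≤ 2 * |i| + ‖u‖ ^ 2 := by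
                refine (abs_add_le _ _).trans (le_of_eq ?_)
                rw [abs_mul, abs_of_nonneg (sq_nonneg ‖u‖), abs_two]
            _ ≤ 2 * (‖e‖ * ‖u‖) + 2 * (‖u‖ * ‖u‖) := by nlinarith [norm_nonneg u]
            _ = _ := by rw [hb]; ring
      calc _ ≤ b ^ (2 * m) * ((b * ‖u‖) * (2 * b * ‖u‖)) := by
            by_cases hn : 0 ≤ i * (2 * i + ‖u‖ ^ 2)
            · gcongr
            · exact (mul_nonpos_of_nonneg_of_nonpos (by positivity) (not_le.1 hn).le).trans
                (by positivity)
        _ = _ := by ring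
    have h4 : ‖e + u‖ ^ 2 * (C * b ^ (2 * m) * ‖u‖ ^ 2) ≤ C * b ^ (2 * m + 2) * ‖u‖ ^ 2 := by
      calc _ ≤ b ^ 2 * (C * b ^ (2 * m) * ‖u‖ ^ 2) := by gcongr; exact norm_add_le e u
        _ = _ := by ring
    have h5 := mul_le_mul_of_nonneg_left (h e u) (sq_nonneg ‖e + u‖)
    have e1 : ‖e + u‖ ^ 2 * (‖e‖ ^ (2 * m + 2) + (2 * m + 2) * ‖e‖ ^ (2 * m) * i)
        = ‖e‖ ^ (2 * (m + 1) + 2) + (2 * ((m + 1 : ℕ) : ℝ) + 2) * ‖e‖ ^ (2 * (m + 1)) * i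
        + ‖e‖ ^ (2 * m + 2) * ‖u‖ ^ 2
        + (2 * m + 2) * (‖e‖ ^ (2 * m) * (i * (2 * i + ‖u‖ ^ 2))) := by
      rw [hsq]; push_cast; ring
    have e2 : ‖e + u‖ ^ (2 * (m + 1) + 2) = ‖e + u‖ ^ 2 * ‖e + u‖ ^ (2 * m + 2) := by ring
    have h6 := mul_le_mul_of_nonneg_left h2 (show (0 : ℝ) ≤ 2 * m + 2 by positivity)
    have e3 : 2 * (m + 1) = 2 * m + 2 := by ring
    rw [e2]
    rw [e3] at e1 ⊢
    nlinarith

variable [CompleteSpace E] {W : Type*} [MeasurableSpace W] {μ : Measure W} [IsProbabilityMeasure μ]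

/-- One step of a random recursion `e ↦ e + uM + uN` whose martingale increment `uM` is centred
of relative size `s` and whose drift increment `uN` has relative size `s ^ 2` multiplies an even
moment by at most `1 + K s ^ 2`, up to a source term `K s ^ 2 η ^ q`. -/
lemma exists_lintegral_norm_add_pow_le (m : ℕ) {ρ : W → ℝ} (hρ1 : ∀ w, 1 ≤ ρ w)
    (hρ : Integrable (fun w => ρ w ^ (5 * (2 * m + 2))) μ) {C : ℝ} (hC : 1 ≤ C) :
    ∃ K : ℝ, 0 ≤ K ∧ ∀ (s : ℝ), 0 ≤ s → s ≤ C → ∀ (e : E) (η : ℝ), 0 ≤ η → ∀ (uM uN : W → E),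
      Integrable uM μ → ∫ w, uM w ∂μ = 0 →
      (∀ w, ‖uM w‖ ≤ C * s * (‖e‖ + η) * ρ w ^ 5) →
      (∀ w, ‖uN w‖ ≤ C * s ^ 2 * (‖e‖ + η) * ρ w ^ 5) →
      ∫⁻ w, ENNReal.ofReal (‖e + (uM w + uN w)‖ ^ (2 * m + 2)) ∂μ
        ≤ ENNReal.ofReal ((1 + K * s ^ 2) * ‖e‖ ^ (2 * m + 2)
          + K * s ^ 2 * η ^ (2 * m + 2)) := by
  obtain ⟨A, hA, hexp⟩ := exists_norm_add_pow_le (E := E) m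
  set q := 2 * m + 2 with hq
  set B := ∫ w, ρ w ^ (5 * q) ∂μ with hB
  have hB0 : 0 ≤ B := integral_nonneg fun w => by have := hρ1 w; positivity
  set C₁ := C * (1 + C) with hC₁
  set C₂ := 1 + C₁ * C with hC₂
  have hC₁0 : 0 ≤ C₁ := by positivity
  set K₀ := (2 * m + 2) * C + A * (C₂ ^ (2 * m) * C₁ ^ 2) with hK₀
  have hK₀0 : 0 ≤ K₀ := by positivity
  refine ⟨K₀ * B * 2 ^ (q - 1), by positivity, fun s hs hsC e η hη uM uN hint hmean hM hN => ?_⟩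
  set a := ‖e‖ + η with ha
  have ha0 : 0 ≤ a := by positivity
  have hea : ‖e‖ ≤ a := by simp [ha, hη]
  -- The only term of first order in `s` is the inner product with `uM`, which integrates to zero.
  -- The drift is already of order `s ^ 2`, and so is the quadratic term.
  have key : ∀ w, ‖e + (uM w + uN w)‖ ^ q ≤ ‖e‖ ^ q
      + (2 * m + 2) * ‖e‖ ^ (2 * m) * inner ℝ e (uM w) + K₀ * s ^ 2 * a ^ q * ρ w ^ (5 * q) := by
    intro w
    have hr1 := hρ1 w
    set r := ρ w
    have hr5 : 1 ≤ r ^ 5 := one_le_pow₀ hr1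
    have hu : ‖uM w + uN w‖ ≤ C₁ * s * (a * r ^ 5) := by
      calc _ ≤ C * s * a * r ^ 5 + C * s ^ 2 * a * r ^ 5 :=
            (norm_add_le _ _).trans (add_le_add (hM w) (hN w))
        _ = C * s * a * r ^ 5 + C * (s * s) * a * r ^ 5 := by ring
        _ ≤ C * s * a * r ^ 5 + C * (C * s) * a * r ^ 5 := by gcongr
        _ = _ := by rw [hC₁]; ring
    have hear : ‖e‖ ≤ a * r ^ 5 := hea.trans (le_mul_of_one_le_right ha0 hr5)
    have hb : ‖e‖ + ‖uM w + uN w‖ ≤ C₂ * (a * r ^ 5) := by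
      calc _ ≤ a * r ^ 5 + C₁ * C * (a * r ^ 5) := by
            gcongr; exact hu.trans (by gcongr)
        _ = _ := by rw [hC₂]; ring
    have h1 : A * (‖e‖ + ‖uM w + uN w‖) ^ (2 * m) * ‖uM w + uN w‖ ^ 2
        ≤ A * (C₂ ^ (2 * m) * C₁ ^ 2) * s ^ 2 * a ^ q * r ^ (5 * q) := by
      calc _ ≤ A * (C₂ * (a * r ^ 5)) ^ (2 * m) * (C₁ * s * (a * r ^ 5)) ^ 2 := by gcongr
        _ = _ := by rw [hq]; ring_nf
    have h2 : (2 * m + 2) * ‖e‖ ^ (2 * m) * inner ℝ e (uN w)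
        ≤ (2 * m + 2) * C * s ^ 2 * a ^ q * r ^ (5 * q) := by
      have : inner ℝ e (uN w) ≤ (a * r ^ 5) * (C * s ^ 2 * a * r ^ 5) :=
        (real_inner_le_norm e _).trans (by gcongr; exact hN w)
      calc _ ≤ (2 * m + 2) * ‖e‖ ^ (2 * m) * ((a * r ^ 5) * (C * s ^ 2 * a * r ^ 5)) := by
            gcongr
        _ ≤ (2 * m + 2) * (a * r ^ 5) ^ (2 * m) * ((a * r ^ 5) * (C * s ^ 2 * a * r ^ 5)) := by
            gcongr
        _ = _ := by rw [hq]; ring_nf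
    have h3 := hexp e (uM w + uN w)
    rw [inner_add_right] at h3
    calc _ ≤ _ := h3
      _ ≤ _ := by rw [hK₀]; nlinarith
  set g : W → ℝ := fun w => ‖e‖ ^ q
      + (2 * m + 2) * ‖e‖ ^ (2 * m) * inner ℝ e (uM w) + K₀ * s ^ 2 * a ^ q * ρ w ^ (5 * q)
    with hg
  have i1 : Integrable (fun _ : W => ‖e‖ ^ q) μ := integrable_const _
  have i2 : Integrable (fun w => (2 * m + 2) * ‖e‖ ^ (2 * m) * inner ℝ e (uM w)) μ :=
    (hint.const_inner e).const_mul _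
  have i3 : Integrable (fun w => K₀ * s ^ 2 * a ^ q * ρ w ^ (5 * q)) μ := hρ.const_mul _
  have hgint : Integrable g μ := (i1.add i2).add i3
  have hgval : ∫ w, g w ∂μ = ‖e‖ ^ q + K₀ * s ^ 2 * a ^ q * B := by
    have : ∫ w, g w ∂μ = ∫ w, ‖e‖ ^ q ∂μ
      + ∫ w, (2 * m + 2) * ‖e‖ ^ (2 * m) * inner ℝ e (uM w) ∂μ
      + ∫ w, K₀ * s ^ 2 * a ^ q * ρ w ^ (5 * q) ∂μ := by
      rw [← integral_add i1 i2]
      exact integral_add (i1.add i2) i3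
    rw [this, integral_const_mul, integral_const_mul, integral_inner hint, hmean]
    simp [hB]
  calc _ ≤ ∫⁻ w, ENNReal.ofReal (g w) ∂μ :=
        lintegral_mono fun w => ENNReal.ofReal_le_ofReal (key w)
    _ = ENNReal.ofReal (∫ w, g w ∂μ) := by
        rw [ofReal_integral_eq_lintegral_ofReal hgint]
        exact Filter.Eventually.of_forall fun w => (by positivity : (0 : ℝ) ≤ _).trans (key w)
    _ ≤ _ := by
        refine ENNReal.ofReal_le_ofReal ?_
        rw [hgval]
        have := add_pow_le (norm_nonneg e) hη q
        calc _ ≤ ‖e‖ ^ q + K₀ * s ^ 2 * (2 ^ (q - 1) * (‖e‖ ^ q + η ^ q)) * B := by gcongr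
          _ = _ := by ring

end Stability

section Chain

variable {Ω : Type*} [MeasurableSpace Ω] {P : Measure Ω} [IsProbabilityMeasure P]
  {S W : Type*} [MeasurableSpace S] [MeasurableSpace W]

/-- Integrating out an independent variable first. -/
lemma lintegral_comp_of_indepFun {Z : Ω → S} {η : Ω → W} (hZ : Measurable Z)
    (hη : Measurable η) (hind : IndepFun Z η P) {Ψ : S → W → ℝ≥0∞}
    (hΨ : Measurable (Function.uncurry Ψ)) :
    ∫⁻ ω, Ψ (Z ω) (η ω) ∂P = ∫⁻ ω, ∫⁻ w, Ψ (Z ω) w ∂(P.map η) ∂P := by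
  have : IsProbabilityMeasure (P.map η) := Measure.isProbabilityMeasure_map hη.aemeasurable
  have : IsProbabilityMeasure (P.map Z) := Measure.isProbabilityMeasure_map hZ.aemeasurable
  have h1 := (indepFun_iff_map_prod_eq_prod_map_map hZ.aemeasurable hη.aemeasurable).1 hind
  calc ∫⁻ ω, Ψ (Z ω) (η ω) ∂P = ∫⁻ x, Function.uncurry Ψ x ∂(P.map fun ω => (Z ω, η ω)) := by
        rw [lintegral_map hΨ (hZ.prodMk hη)]; rfl
    _ = ∫⁻ z, ∫⁻ w, Ψ z w ∂(P.map η) ∂(P.map Z) := by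
        rw [h1, lintegral_prod _ hΨ.aemeasurable]; rfl
    _ = _ := by
        rw [lintegral_map _ hZ]
        exact hΨ.lintegral_prod_right'

/-- A one-step Lyapunov estimate propagates along a Markov chain (discrete Grönwall lemma). -/
lemma lintegral_chain_le {μ : Measure W} {Z : ℕ → Ω → S} {η : ℕ → Ω → W}
    (hZ : ∀ n, Measurable (Z n)) (hη : ∀ n, Measurable (η n))
    (hind : ∀ n, IndepFun (Z n) (η n) P) (hlaw : ∀ n, P.map (η n) = μ)
    {F : S → W → S} (hF : Measurable (Function.uncurry F))
    (hrec : ∀ n ω, Z (n + 1) ω = F (Z n ω) (η n ω))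
    {φ ψ : S → ℝ} (hφ : Measurable φ) (hψ : Measurable ψ)
    {κ a b B : ℝ} (hκ : 0 ≤ κ) (ha : 0 ≤ a) (hb : 0 ≤ b) {N : ℕ}
    (hB : N * κ ≤ B)
    (hstep : ∀ z, ∫⁻ w, ENNReal.ofReal (φ (F z w)) ∂μ
      ≤ ENNReal.ofReal ((1 + κ) * φ z + κ * ψ z))
    (h0 : ∫⁻ ω, ENNReal.ofReal (φ (Z 0 ω)) ∂P ≤ ENNReal.ofReal a)
    (hψb : ∀ n < N, ∫⁻ ω, ENNReal.ofReal (ψ (Z n ω)) ∂P ≤ ENNReal.ofReal b) :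
    ∀ n ≤ N, ∫⁻ ω, ENNReal.ofReal (φ (Z n ω)) ∂P ≤ ENNReal.ofReal (Real.exp B * (a + B * b)) := by
  have main : ∀ n ≤ N, ∫⁻ ω, ENNReal.ofReal (φ (Z n ω)) ∂P
      ≤ ENNReal.ofReal ((1 + κ) ^ n * (a + n * κ * b)) := by
    intro n
    induction n with
    | zero => intro _; simpa using h0
    | succ n ih =>
      intro hn
      have hn' : n < N := hn
      have m1 : Measurable fun ω => ENNReal.ofReal ((1 + κ) * φ (Z n ω)) :=
        ((hφ.comp (hZ n)).const_mul _).ennreal_ofReal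
      calc ∫⁻ ω, ENNReal.ofReal (φ (Z (n + 1) ω)) ∂P
          = ∫⁻ ω, ENNReal.ofReal (φ (F (Z n ω) (η n ω))) ∂P := by simp_rw [hrec]
        _ = ∫⁻ ω, ∫⁻ w, ENNReal.ofReal (φ (F (Z n ω) w)) ∂μ ∂P := by
            rw [← hlaw n]
            exact lintegral_comp_of_indepFun (hZ n) (hη n) (hind n)
              (Ψ := fun z w => ENNReal.ofReal (φ (F z w))) (hφ.comp hF).ennreal_ofReal
        _ ≤ ∫⁻ ω, (ENNReal.ofReal ((1 + κ) * φ (Z n ω)) + ENNReal.ofReal (κ * ψ (Z n ω))) ∂P := by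
            refine lintegral_mono fun ω => (hstep _).trans ?_
            exact ENNReal.ofReal_add_le
        _ = ENNReal.ofReal (1 + κ) * ∫⁻ ω, ENNReal.ofReal (φ (Z n ω)) ∂P
            + ENNReal.ofReal κ * ∫⁻ ω, ENNReal.ofReal (ψ (Z n ω)) ∂P := by
            rw [lintegral_add_left m1, ← lintegral_const_mul, ← lintegral_const_mul]
            · congr 2
              · funext ω; rw [ENNReal.ofReal_mul (by positivity)]
              · funext ω; rw [ENNReal.ofReal_mul (by positivity)]
            · exact (hψ.comp (hZ n)).ennreal_ofReal
            · exact (hφ.comp (hZ n)).ennreal_ofReal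
        _ ≤ ENNReal.ofReal (1 + κ) * ENNReal.ofReal ((1 + κ) ^ n * (a + n * κ * b))
            + ENNReal.ofReal κ * ENNReal.ofReal b := by
            gcongr
            · exact ih hn'.le
            · exact hψb n hn'
        _ = ENNReal.ofReal ((1 + κ) * ((1 + κ) ^ n * (a + n * κ * b)) + κ * b) := by
            rw [← ENNReal.ofReal_mul (by positivity), ← ENNReal.ofReal_mul (by positivity),
              ← ENNReal.ofReal_add (by positivity) (by positivity)]
        _ ≤ _ := by
            refine ENNReal.ofReal_le_ofReal ?_
            have h1 : 1 ≤ (1 + κ) ^ (n + 1) := one_le_pow₀ (by linarith)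
            have h2 : 0 ≤ κ * b := by positivity
            have h3 := mul_le_mul_of_nonneg_right h1 h2
            have e1 : (1 + κ) ^ (n + 1) * (a + ((n + 1 : ℕ) : ℝ) * κ * b)
              = (1 + κ) * ((1 + κ) ^ n * (a + n * κ * b)) + (1 + κ) ^ (n + 1) * (κ * b) := by
              push_cast; ring
            rw [e1]
            linarith
  intro n hn
  refine (main n hn).trans (ENNReal.ofReal_le_ofReal ?_)
  have hnB : n * κ ≤ B := (mul_le_mul_of_nonneg_right (by exact_mod_cast hn) hκ).trans hB
  have h1 : (1 + κ) ^ n ≤ Real.exp B := by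
    calc (1 + κ) ^ n ≤ Real.exp κ ^ n := by
          gcongr
          linarith [Real.add_one_le_exp κ]
      _ = Real.exp (n * κ) := by rw [← Real.exp_nat_mul]
      _ ≤ _ := Real.exp_le_exp.2 hnB
  gcongr

end Chain

/-! ### Centred functions of two independent noise vectors -/

namespace StepData

variable {E V : Type*} [NormedAddCommGroup E] [InnerProductSpace ℝ E]
    [NormedAddCommGroup V] [NormedSpace ℝ V] (S : StepData E V)

/-- The law `γ` of the normalised noise fits the coefficients: it has moments of all orders, mean
zero, and `c x` is the mean of `H x v v`. -/
structure IsNoise [MeasurableSpace V] (γ : Measure V) : Prop where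
  memLp : ∀ n : ℕ, MemLp id n γ
  mean : ∫ v, v ∂γ = 0
  second : ∀ x, ∫ v, S.H x v v ∂γ = S.c x

variable {S}

lemma continuous_of_lip {E F : Type*} [NormedAddCommGroup E] [NormedAddCommGroup F] {Φ : E → F} {C : ℝ}
    (h : ∀ x y, ‖Φ x - Φ y‖ ≤ C * ‖x - y‖) : Continuous Φ :=
  (LipschitzWith.of_dist_le_mul (K := C.toNNReal) fun x y => by
    rw [dist_eq_norm, dist_eq_norm]
    exact (h x y).trans (by gcongr; exact Real.le_coe_toNNReal C)).continuous

lemma continuous_f : Continuous S.f := continuous_of_lip S.f_lip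
lemma continuous_G : Continuous S.G := continuous_of_lip S.G_lip
lemma continuous_H : Continuous S.H := continuous_of_lip (F := V →L[ℝ] V →L[ℝ] E) S.H_lip
lemma continuous_c : Continuous S.c := continuous_of_lip S.c_lip

lemma continuous_step (s : ℝ) : Continuous fun p : E × V => S.step s p.1 p.2 := by
  have h1 := S.continuous_f
  have h2 := S.continuous_G
  have h3 := S.continuous_H
  have h4 := S.continuous_c
  unfold step
  fun_prop

lemma continuous_coarseStep (s : ℝ) :
    Continuous fun p : E × V × V => S.coarseStep s p.1 p.2.1 p.2.2 := by
  have h1 := S.continuous_f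
  have h2 := S.continuous_G
  have h3 := S.continuous_H
  have h4 := S.continuous_c
  unfold coarseStep
  fun_prop

variable [MeasurableSpace V] [BorelSpace V] [SecondCountableTopology V] [CompleteSpace V]
  [CompleteSpace E] {γ : Measure V} [IsProbabilityMeasure γ]

section Moments

variable (hγ : S.IsNoise γ)
include hγ

lemma IsNoise.integrable_id : Integrable (fun v : V => v) γ :=
  memLp_one_iff_integrable.1 (by have := hγ.memLp 1; rwa [Nat.cast_one] at this)

lemma IsNoise.integrable_clm {F : Type*} [NormedAddCommGroup F] [NormedSpace ℝ F]
    (L : V →L[ℝ] F) : Integrable (fun v => L v) γ :=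
  L.integrable_comp hγ.integrable_id

lemma IsNoise.integral_clm {F : Type*} [NormedAddCommGroup F] [NormedSpace ℝ F] [CompleteSpace F]
    (L : V →L[ℝ] F) : ∫ v, L v ∂γ = 0 := by
  rw [L.integral_comp_comm hγ.integrable_id, hγ.mean, map_zero]

lemma IsNoise.integrable_quadratic (B : V →L[ℝ] V →L[ℝ] E) :
    Integrable (fun v => B v v) γ := by
  have h2 : Integrable (fun v : V => ‖v‖ ^ 2) γ := by
    have := (hγ.memLp 2).integrable_norm_pow (by norm_num)
    simpa using this
  refine (h2.const_mul ‖B‖).mono' (by fun_prop : Continuous fun v => B v v).aestronglyMeasurable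
    (Filter.Eventually.of_forall fun v => ?_)
  calc ‖B v v‖ ≤ ‖B‖ * ‖v‖ * ‖v‖ := B.le_opNorm₂ v v
    _ = _ := by ring

omit hγ in
lemma integral_add_add {f g h : V → E} (hf : Integrable f γ) (hg : Integrable g γ)
    (hh : Integrable h γ) :
    ∫ v, (f v + g v + h v) ∂γ = ∫ v, f v ∂γ + ∫ v, g v ∂γ + ∫ v, h v ∂γ := by
  rw [← integral_add hf hg]
  exact integral_add (hf.add hg) hh

lemma IsNoise.integral_H_sub (x y : E) :
    ∫ v, (S.H y - S.H x) v v ∂γ = S.c y - S.c x := by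
  rw [← hγ.second, ← hγ.second, ← integral_sub (hγ.integrable_quadratic _)
    (hγ.integrable_quadratic _)]
  rfl

lemma IsNoise.integrable_rho (n : ℕ) :
    Integrable (fun w : V × V => (1 + ‖w.1‖ + ‖w.2‖) ^ n) (γ.prod γ) := by
  have h1 : MemLp (fun w : V × V => ‖w.1‖) n (γ.prod γ) :=
    ((hγ.memLp n).comp_measurePreserving measurePreserving_fst).norm
  have h2 : MemLp (fun w : V × V => ‖w.2‖) n (γ.prod γ) :=
    ((hγ.memLp n).comp_measurePreserving measurePreserving_snd).norm
  have h3 : MemLp (fun w : V × V => 1 + ‖w.1‖ + ‖w.2‖) n (γ.prod γ) :=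
    ((memLp_const (1 : ℝ)).add h1).add h2
  have h4 := h3.integrable_norm_pow'
  refine h4.congr (Filter.Eventually.of_forall fun w => ?_)
  have : 0 ≤ 1 + ‖w.1‖ + ‖w.2‖ := by positivity
  simp only [Real.norm_of_nonneg this]

lemma IsNoise.integrable_rho_single (n : ℕ) :
    Integrable (fun v : V => (1 + ‖v‖) ^ n) γ := by
  have h3 : MemLp (fun v : V => 1 + ‖v‖) n γ := (memLp_const (1 : ℝ)).add (hγ.memLp n).norm
  refine h3.integrable_norm_pow'.congr (Filter.Eventually.of_forall fun w => ?_)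
  have : 0 ≤ 1 + ‖w‖ := by positivity
  simp only [Real.norm_of_nonneg this]

end Moments

/-- An integrable function of two independent noise vectors with mean zero. -/
def IsCentered (γ : Measure V) (F : V × V → E) : Prop :=
  Integrable F (γ.prod γ) ∧ ∫ w, F w ∂(γ.prod γ) = 0

namespace IsCentered

variable {F F' : V × V → E}

lemma add (h : IsCentered γ F) (h' : IsCentered γ F') :
    IsCentered γ fun w => F w + F' w :=
  ⟨h.1.add h'.1, by rw [integral_add h.1 h'.1, h.2, h'.2, add_zero]⟩

lemma sub (h : IsCentered γ F) (h' : IsCentered γ F') :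
    IsCentered γ fun w => F w - F' w :=
  ⟨h.1.sub h'.1, by rw [integral_sub h.1 h'.1, h.2, h'.2, sub_zero]⟩

lemma smul (a : ℝ) (h : IsCentered γ F) : IsCentered γ fun w => a • F w :=
  ⟨h.1.smul a, by rw [integral_smul, h.2, smul_zero]⟩

lemma swap [SFinite γ] (h : IsCentered γ F) : IsCentered γ fun w => F w.swap :=
  ⟨h.1.swap, by rw [integral_prod_swap F]; exact h.2⟩

end IsCentered

section Centered

variable (hγ : S.IsNoise γ)
include hγ

/-- A polynomially bounded continuous function is centred as soon as integrating out the second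
noise vector and then the first gives zero. -/
lemma IsNoise.isCentered_of {F : V × V → E} (hF : Continuous F) (A : ℝ) (n : ℕ)
    (hb : ∀ w, ‖F w‖ ≤ A * (1 + ‖w.1‖ + ‖w.2‖) ^ n) (g : V → E)
    (hg : ∀ v, ∫ v', F (v, v') ∂γ = g v) (hg0 : ∫ v, g v ∂γ = 0) : IsCentered γ F := by
  have hi : Integrable F (γ.prod γ) :=
    ((hγ.integrable_rho n).const_mul A).mono' hF.aestronglyMeasurable (Filter.Eventually.of_forall hb)
  refine ⟨hi, ?_⟩
  rw [integral_prod _ hi]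
  simp_rw [hg, hg0]

lemma IsNoise.isCentered_add_clm (L : V →L[ℝ] E) : IsCentered γ fun w => L (w.1 + w.2) := by
  refine hγ.isCentered_of (by fun_prop) ‖L‖ 1 (fun w => ?_) (fun v => L v) (fun v => ?_)
    (hγ.integral_clm L)
  · refine L.le_opNorm_of_le ?_
    have := norm_add_le w.1 w.2
    linarith
  · simp only [map_add]
    rw [integral_add (integrable_const _) (hγ.integrable_clm L), hγ.integral_clm L]
    simp

lemma IsNoise.isCentered_levyTerm (x : E) : IsCentered γ fun w => S.levyTerm x w.1 w.2 := by
  unfold levyTerm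
  refine hγ.isCentered_of (by fun_prop) (2 * ‖S.H x‖) 2 (fun w => ?_) (fun v => 0) (fun v => ?_)
    (by simp)
  · have h1 := (S.H x).le_opNorm₂ w.1 w.2
    have h2 := (S.H x).le_opNorm₂ w.2 w.1
    have h3 := norm_nonneg (S.H x)
    have h4 : ‖w.1‖ * ‖w.2‖ ≤ (1 + ‖w.1‖ + ‖w.2‖) ^ 2 := by
      nlinarith [norm_nonneg w.1, norm_nonneg w.2, mul_nonneg (norm_nonneg w.1) (norm_nonneg w.2)]
    calc _ ≤ _ := norm_sub_le _ _
      _ ≤ 2 * ‖S.H x‖ * (‖w.1‖ * ‖w.2‖) := by linarith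
      _ ≤ _ := by gcongr
  · have h := hγ.integral_clm ((S.H x).flip v - S.H x v)
    simpa using h

lemma IsNoise.isCentered_quad (x : E) :
    IsCentered γ fun w => S.H x (w.1 + w.2) (w.1 + w.2) - (2 : ℝ) • S.c x := by
  refine hγ.isCentered_of (by fun_prop) (‖S.H x‖ + 2 * ‖S.c x‖) 2 (fun w => ?_)
    (fun v => S.H x v v - S.c x) (fun v => ?_) ?_
  · have h1 := (S.H x).le_opNorm₂ (w.1 + w.2) (w.1 + w.2)
    have h2 : ‖w.1 + w.2‖ ≤ 1 + ‖w.1‖ + ‖w.2‖ := by linarith [norm_add_le w.1 w.2]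
    have h5 : (1 : ℝ) ≤ (1 + ‖w.1‖ + ‖w.2‖) ^ 2 :=
      one_le_pow₀ (by linarith [norm_nonneg w.1, norm_nonneg w.2])
    calc _ ≤ _ := norm_sub_le _ _
      _ ≤ ‖S.H x‖ * ‖w.1 + w.2‖ * ‖w.1 + w.2‖ + 2 * ‖S.c x‖ * 1 := by
        rw [norm_smul, Real.norm_ofNat, mul_one]; exact add_le_add_left h1 _
      _ ≤ ‖S.H x‖ * (1 + ‖w.1‖ + ‖w.2‖) * (1 + ‖w.1‖ + ‖w.2‖)
          + 2 * ‖S.c x‖ * (1 + ‖w.1‖ + ‖w.2‖) ^ 2 := by gcongr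
      _ = _ := by ring
  · have e : ∀ v', S.H x (v + v') (v + v') - (2 : ℝ) • S.c x
        = ((S.H x v v - (2 : ℝ) • S.c x) + ((S.H x).flip v + S.H x v) v') + S.H x v' v' := by
      intro v'
      simp only [map_add, add_apply, ContinuousLinearMap.flip_apply]
      abel
    have i1 := hγ.integrable_clm ((S.H x).flip v + S.H x v)
    have i2 : Integrable (fun _ : V => S.H x v v - (2 : ℝ) • S.c x) γ := integrable_const _
    simp_rw [e]
    rw [integral_add_add i2 i1 (hγ.integrable_quadratic _),
      hγ.integral_clm, hγ.second]
    simp only [integral_const, probReal_univ, one_smul]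
    module
  · rw [integral_sub (hγ.integrable_quadratic _) (integrable_const _), hγ.second]
    simp

lemma IsNoise.isCentered_martRem {s : ℝ} (hs : 0 ≤ s) (hsC : s ≤ S.C) (x : E) :
    IsCentered γ fun w => S.martRem s x w.1 w.2 := by
  refine hγ.isCentered_of ?_ (28 * S.C ^ 5 * s ^ 3 * (1 + ‖x‖) ^ 2) 5 (fun w => ?_)
    (fun v => s ^ 3 • S.f' x (S.G x v)) (fun v => ?_) ?_
  · have h1 : Continuous fun w : V × V => S.step s x w.1 :=
      (S.continuous_step s).comp (continuous_const.prodMk continuous_fst)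
    have h2 := S.continuous_G.comp h1
    have h3 := S.continuous_H.comp h1
    have h4 := S.continuous_c.comp h1
    simp only [Function.comp_def] at h2 h3 h4
    unfold martRem
    fun_prop
  · have hn1 := norm_nonneg w.1
    have hn2 := norm_nonneg w.2
    exact norm_martRem_le hs hsC (by linarith) (by linarith) (by linarith) x
  · unfold martRem
    set L := S.G (S.step s x v) - S.G x - S.G' x (s • S.G x v)
    have i1 : Integrable (fun _ : V => s ^ 3 • S.f' x (S.G x v)) γ := integrable_const _
    have i2 : Integrable (fun v' : V => s • L v') γ := (hγ.integrable_clm L).smul s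
    have i3 := hγ.integrable_quadratic (S.H (S.step s x v) - S.H x)
    have i4 : Integrable (fun _ : V => S.c (S.step s x v) - S.c x) γ := integrable_const _
    refine (integral_add_add i1 i2 ((i3.sub i4).smul (s ^ 2))).trans ?_
    simp only [Pi.smul_apply, Pi.sub_apply]
    rw [integral_smul, integral_smul, integral_smul, integral_sub i3 i4, hγ.integral_H_sub, hγ.integral_clm L]
    simp
  · rw [integral_smul]
    have := hγ.integral_clm ((S.f' x).comp (S.G x))
    simp only [ContinuousLinearMap.comp_apply] at this
    rw [this, smul_zero]

end Centered

end StepData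

/-! ### One-step moment estimates -/

namespace StepData

variable {E V : Type*} [NormedAddCommGroup E] [InnerProductSpace ℝ E]
    [NormedAddCommGroup V] [NormedSpace ℝ V] (S : StepData E V)

/-- Two fine steps driven by the increments `v`, `v'` in this order. -/
def fineStep (s : ℝ) (x : E) (v v' : V) : E := S.step s (S.step s x v) v'

variable {S}

section Bounds

variable {s r : ℝ} (hs : 0 ≤ s) (hsC : s ≤ S.C) (hr : 1 ≤ r) {v v' : V} (hv : ‖v‖ ≤ r)
  (hv' : ‖v'‖ ≤ r) (hvv : ‖v + v'‖ ≤ r)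

include hr hvv in
/-- Bound for the compensated quadratic term with averaged coefficients. -/
lemma norm_quad_sub_le {B : V →L[ℝ] V →L[ℝ] E} {b : E} {A : ℝ} (hB : ‖B‖ ≤ A) (hb : ‖b‖ ≤ A) :
    ‖B (v + v') (v + v') - (2 : ℝ) • b‖ ≤ 3 * A * r ^ 2 := by
  have hA : 0 ≤ A := (norm_nonneg b).trans hb
  have h1 : ‖B (v + v') (v + v')‖ ≤ A * r * r :=
    ContinuousLinearMap.le_of_opNorm_le_of_le _ (B.le_of_opNorm_le_of_le hB hvv) hvv
  have hr2 : 1 ≤ r ^ 2 := one_le_pow₀ hr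
  calc _ ≤ _ := norm_sub_le _ _
    _ ≤ A * r * r + 2 * (A * 1) := by
        rw [norm_smul, Real.norm_ofNat, mul_one]; gcongr
    _ ≤ A * r * r + 2 * (A * r ^ 2) := by gcongr
    _ = _ := by ring

include hv hv' in
lemma norm_levyTerm_le (x : E) : ‖S.levyTerm x v v'‖ ≤ 2 * S.C * (1 + ‖x‖) * r ^ 2 := by
  have h1 := norm_H_apply_le (S := S) hv hv' x
  have h2 := norm_H_apply_le (S := S) hv' hv x
  calc _ ≤ _ := norm_sub_le _ _
    _ ≤ _ := by linarith

include hv hv' in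
lemma norm_levyTerm_sub_le (x y : E) :
    ‖S.levyTerm x v v' - S.levyTerm y v v'‖ ≤ 2 * S.C * ‖x - y‖ * r ^ 2 := by
  have h1 : ‖(S.H x - S.H y) v v'‖ ≤ S.C * ‖x - y‖ * r * r :=
    ContinuousLinearMap.le_of_opNorm_le_of_le _
      (ContinuousLinearMap.le_of_opNorm_le_of_le _ (S.H_lip x y) hv) hv'
  have h2 : ‖(S.H x - S.H y) v' v‖ ≤ S.C * ‖x - y‖ * r * r :=
    ContinuousLinearMap.le_of_opNorm_le_of_le _
      (ContinuousLinearMap.le_of_opNorm_le_of_le _ (S.H_lip x y) hv') hv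
  have e : S.levyTerm x v v' - S.levyTerm y v v' = (S.H x - S.H y) v' v - (S.H x - S.H y) v v' := by
    simp only [levyTerm, sub_apply]; abel
  rw [e]
  calc _ ≤ _ := norm_sub_le _ _
    _ ≤ _ := by linarith

lemma levyTerm_swap (x : E) (v v' : V) : S.levyTerm x v' v = -S.levyTerm x v v' := by
  simp [levyTerm]

variable (S) in
/-- Martingale increment of the difference between the fine and the antithetic path. -/
def diffMart (s : ℝ) (x y : E) (v v' : V) : E :=
  s • (S.G x - S.G y) (v + v')
    + s ^ 2 • ((S.H x - S.H y) (v + v') (v + v') - (2 : ℝ) • (S.c x - S.c y))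
    + s ^ 2 • (S.levyTerm x v v' - S.levyTerm y v' v)
    + (S.martRem s x v v' - S.martRem s y v' v)

variable (S) in
/-- Drift increment of the difference between the fine and the antithetic path. -/
def diffDrift (s : ℝ) (x y : E) (v v' : V) : E :=
  (2 * s ^ 2) • (S.f x - S.f y) + (S.driftRem s x v - S.driftRem s y v')

lemma fineStep_sub_fineStep (s : ℝ) (x y : E) (v v' : V) :
    S.fineStep s x v v' - S.fineStep s y v' v
      = (x - y) + (S.diffMart s x y v v' + S.diffDrift s x y v v') := by
  rw [fineStep, fineStep, step_step, step_step, coarseStep, coarseStep, diffMart, diffDrift,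
    add_comm v' v]
  simp only [sub_apply]
  module

include hs hsC hr hv hv' hvv in
lemma norm_diffMart_le (x y : E) :
    ‖S.diffMart s x y v v'‖
      ≤ 60 * S.C ^ 6 * s * (‖x - y‖ + s * (1 + ‖x‖ + ‖y‖) ^ 2) * r ^ 5 := by
  have h0 := S.one_le_C
  have hnx := norm_nonneg x
  have hny := norm_nonneg y
  set X := 1 + ‖x‖ + ‖y‖ with hX
  have hX1 : 1 ≤ X := by linarith
  have hxX : 1 + ‖x‖ ≤ X := by linarith
  have hyX : 1 + ‖y‖ ≤ X := by linarith
  have h1 : ‖(S.G x - S.G y) (v + v')‖ ≤ S.C * ‖x - y‖ * r :=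
    ContinuousLinearMap.le_of_opNorm_le_of_le _ (S.G_lip x y) hvv
  have h2 := norm_quad_sub_le hr hvv (S.H_lip x y) (S.c_lip x y)
  have h3 : ‖S.levyTerm x v v' - S.levyTerm y v' v‖ ≤ 4 * S.C * X * r ^ 2 := by
    calc _ ≤ _ := norm_sub_le _ _
      _ ≤ 2 * S.C * (1 + ‖x‖) * r ^ 2 + 2 * S.C * (1 + ‖y‖) * r ^ 2 :=
        add_le_add (norm_levyTerm_le hv hv' x) (norm_levyTerm_le hv' hv y)
      _ ≤ 2 * S.C * X * r ^ 2 + 2 * S.C * X * r ^ 2 := by gcongr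
      _ = _ := by ring
  have h4 : ‖S.martRem s x v v' - S.martRem s y v' v‖ ≤ 56 * S.C ^ 5 * s ^ 3 * X ^ 2 * r ^ 5 := by
    calc _ ≤ _ := norm_sub_le _ _
      _ ≤ 28 * S.C ^ 5 * s ^ 3 * (1 + ‖x‖) ^ 2 * r ^ 5
          + 28 * S.C ^ 5 * s ^ 3 * (1 + ‖y‖) ^ 2 * r ^ 5 :=
        add_le_add (norm_martRem_le hs hsC hr hv hv' x) (norm_martRem_le hs hsC hr hv' hv y)
      _ ≤ 28 * S.C ^ 5 * s ^ 3 * X ^ 2 * r ^ 5 + 28 * S.C ^ 5 * s ^ 3 * X ^ 2 * r ^ 5 := by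
        gcongr
      _ = _ := by ring
  rw [diffMart]
  refine (norm_add_le _ _).trans ((add_le_add_left (norm_add₃_le ..) _).trans ?_)
  rw [norm_smul, norm_smul, norm_smul, Real.norm_of_nonneg hs, Real.norm_of_nonneg (by positivity)]
  set D := ‖x - y‖ with hD
  have hD0 : 0 ≤ D := norm_nonneg _
  calc _ ≤ s * (S.C * D * r) + s ^ 2 * (3 * (S.C * D) * r ^ 2) + s ^ 2 * (4 * S.C * X * r ^ 2)
        + 56 * S.C ^ 5 * s ^ 3 * X ^ 2 * r ^ 5 := by gcongr
    _ = S.C ^ 1 * s * D * r ^ 1 + 3 * S.C ^ 1 * s * s * D * r ^ 2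
        + 4 * S.C ^ 1 * s ^ 2 * X ^ 1 * r ^ 2 + 56 * S.C ^ 5 * s ^ 2 * s * X ^ 2 * r ^ 5 := by ring
    _ ≤ S.C ^ 6 * s * D * r ^ 5 + 3 * S.C ^ 5 * s * S.C * D * r ^ 5
        + 4 * S.C ^ 6 * s ^ 2 * X ^ 2 * r ^ 5 + 56 * S.C ^ 5 * s ^ 2 * S.C * X ^ 2 * r ^ 5 := by
        gcongr <;> first | assumption | norm_num
    _ = 4 * (S.C ^ 6 * s * D * r ^ 5) + 60 * S.C ^ 6 * s * (s * X ^ 2) * r ^ 5 := by ring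
    _ ≤ 60 * (S.C ^ 6 * s * D * r ^ 5) + 60 * S.C ^ 6 * s * (s * X ^ 2) * r ^ 5 := by
        gcongr; norm_num
    _ = _ := by ring

include hs hsC hr hv hv' in
lemma norm_diffDrift_le (x y : E) :
    ‖S.diffDrift s x y v v'‖
      ≤ 60 * S.C ^ 6 * s ^ 2 * (‖x - y‖ + s * (1 + ‖x‖ + ‖y‖) ^ 2) * r ^ 5 := by
  have h0 := S.one_le_C
  have hnx := norm_nonneg x
  have hny := norm_nonneg y
  set X := 1 + ‖x‖ + ‖y‖ with hX
  have hxX : 1 + ‖x‖ ≤ X := by linarith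
  have hyX : 1 + ‖y‖ ≤ X := by linarith
  have h4 : ‖S.driftRem s x v - S.driftRem s y v'‖ ≤ 38 * S.C ^ 5 * s ^ 4 * X ^ 2 * r ^ 4 := by
    calc _ ≤ _ := norm_sub_le _ _
      _ ≤ 19 * S.C ^ 5 * s ^ 4 * (1 + ‖x‖) ^ 2 * r ^ 4
          + 19 * S.C ^ 5 * s ^ 4 * (1 + ‖y‖) ^ 2 * r ^ 4 :=
        add_le_add (norm_driftRem_le hs hsC hr hv x) (norm_driftRem_le hs hsC hr hv' y)
      _ ≤ 19 * S.C ^ 5 * s ^ 4 * X ^ 2 * r ^ 4 + 19 * S.C ^ 5 * s ^ 4 * X ^ 2 * r ^ 4 := by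
        gcongr
      _ = _ := by ring
  rw [diffDrift]
  refine (norm_add_le _ _).trans ?_
  rw [norm_smul, Real.norm_of_nonneg (by positivity)]
  have h1 := S.f_lip x y
  set D := ‖x - y‖ with hD
  have hD0 : 0 ≤ D := norm_nonneg _
  calc _ ≤ (2 * s ^ 2) * (S.C * D) + 38 * S.C ^ 5 * s ^ 4 * X ^ 2 * r ^ 4 := by gcongr
    _ = 2 * S.C ^ 1 * s ^ 2 * D * 1 + 38 * S.C ^ 5 * s * s ^ 3 * X ^ 2 * r ^ 4 := by ring
    _ ≤ 2 * S.C ^ 6 * s ^ 2 * D * r ^ 5 + 38 * S.C ^ 5 * S.C * s ^ 3 * X ^ 2 * r ^ 5 := by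
        gcongr <;> first | assumption | exact one_le_pow₀ hr | norm_num
    _ ≤ 60 * S.C ^ 6 * s ^ 2 * D * r ^ 5 + 60 * S.C ^ 5 * S.C * s ^ 3 * X ^ 2 * r ^ 5 := by
        gcongr <;> norm_num
    _ = _ := by ring

variable (S) in
/-- Martingale increment of the difference between the average of the fine and the antithetic path
and the coarse path. -/
def avgMart (s : ℝ) (x y z : E) (v v' : V) : E :=
  s • ((1 / 2 : ℝ) • (S.G x + S.G y) - S.G z) (v + v')
    + s ^ 2 • (((1 / 2 : ℝ) • (S.H x + S.H y) - S.H z) (v + v') (v + v')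
        - (2 : ℝ) • ((1 / 2 : ℝ) • (S.c x + S.c y) - S.c z))
    + (1 / 2 * s ^ 2) • (S.levyTerm x v v' + S.levyTerm y v' v)
    + (1 / 2 : ℝ) • (S.martRem s x v v' + S.martRem s y v' v)

variable (S) in
/-- Drift increment of the difference between the average of the fine and the antithetic path
and the coarse path. -/
def avgDrift (s : ℝ) (x y z : E) (v v' : V) : E :=
  (2 * s ^ 2) • ((1 / 2 : ℝ) • (S.f x + S.f y) - S.f z)
    + (1 / 2 : ℝ) • (S.driftRem s x v + S.driftRem s y v')

lemma average_fineStep_sub_coarseStep (s : ℝ) (x y z : E) (v v' : V) :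
    (1 / 2 : ℝ) • (S.fineStep s x v v' + S.fineStep s y v' v) - S.coarseStep s z v v'
      = ((1 / 2 : ℝ) • (x + y) - z) + (S.avgMart s x y z v v' + S.avgDrift s x y z v v') := by
  rw [fineStep, fineStep, step_step, step_step, coarseStep, coarseStep, coarseStep, avgMart,
    avgDrift, add_comm v' v]
  simp only [sub_apply, add_apply, smul_apply]
  module

/-- For a Lipschitz map, averaging the values commutes with averaging the arguments up to first
order. -/
lemma norm_average_sub_le_of_lip {F : Type*} [NormedAddCommGroup F] [NormedSpace ℝ F] {Φ : E → F}
    {C : ℝ} (h : ∀ x y, ‖Φ x - Φ y‖ ≤ C * ‖x - y‖) (x y z : E) :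
    ‖(1 / 2 : ℝ) • (Φ x + Φ y) - Φ z‖
      ≤ C * (1 / 2 * ‖x - y‖ + ‖(1 / 2 : ℝ) • (x + y) - z‖) := by
  set m := (1 / 2 : ℝ) • (x + y) with hm
  have hx : ‖x - m‖ = 1 / 2 * ‖x - y‖ := by
    rw [hm, show x - (1 / 2 : ℝ) • (x + y) = (1 / 2 : ℝ) • (x - y) by module, norm_smul]; norm_num
  have hy : ‖y - m‖ = 1 / 2 * ‖x - y‖ := by
    rw [hm, show y - (1 / 2 : ℝ) • (x + y) = (-1 / 2 : ℝ) • (x - y) by module, norm_smul]; norm_num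
  have e : (1 / 2 : ℝ) • (Φ x + Φ y) - Φ z
      = (1 / 2 : ℝ) • (Φ x - Φ m) + (1 / 2 : ℝ) • (Φ y - Φ m) + (Φ m - Φ z) := by module
  have h1 := h x m
  have h2 := h y m
  have h3 := h m z
  rw [hx] at h1
  rw [hy] at h2
  rw [e]
  refine (norm_add₃_le ..).trans ?_
  rw [norm_smul, norm_smul, Real.norm_of_nonneg (by norm_num)]
  linarith

/-- For a Lipschitz map with quadratic Taylor remainder, averaging the values commutes with
averaging the arguments up to second order. -/
lemma norm_average_sub_le_of_taylor {F : Type*} [NormedAddCommGroup F] [NormedSpace ℝ F]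
    {Φ : E → F} {Φ' : E → E →L[ℝ] F} {C : ℝ} (h : ∀ x y, ‖Φ x - Φ y‖ ≤ C * ‖x - y‖)
    (hΦ : ∀ x y, ‖Φ y - Φ x - Φ' x (y - x)‖ ≤ C * ‖y - x‖ ^ 2) (x y z : E) :
    ‖(1 / 2 : ℝ) • (Φ x + Φ y) - Φ z‖
      ≤ C * (‖x - y‖ ^ 2 + ‖(1 / 2 : ℝ) • (x + y) - z‖) := by
  have h1 := norm_midpoint_sub_le hΦ x y
  have h2 := h ((1 / 2 : ℝ) • (x + y)) z
  calc _ = ‖((1 / 2 : ℝ) • (Φ x + Φ y) - Φ ((1 / 2 : ℝ) • (x + y)))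
        + (Φ ((1 / 2 : ℝ) • (x + y)) - Φ z)‖ := by congr 1; abel
    _ ≤ _ := norm_add_le _ _
    _ ≤ _ := by linarith

include hs hsC hr hv hv' hvv in
lemma norm_avgMart_le (x y z : E) :
    ‖S.avgMart s x y z v v'‖
      ≤ 60 * S.C ^ 6 * s * (‖(1 / 2 : ℝ) • (x + y) - z‖
        + (‖x - y‖ ^ 2 + s ^ 2 * (1 + ‖x‖ + ‖y‖) ^ 2)) * r ^ 5 := by
  have h0 := S.one_le_C
  have hnx := norm_nonneg x
  have hny := norm_nonneg y
  have h1 : ‖((1 / 2 : ℝ) • (S.G x + S.G y) - S.G z) (v + v')‖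
      ≤ S.C * (‖x - y‖ ^ 2 + ‖(1 / 2 : ℝ) • (x + y) - z‖) * r :=
    ContinuousLinearMap.le_of_opNorm_le_of_le _
      (norm_average_sub_le_of_taylor S.G_lip S.G_taylor x y z) hvv
  have h2 := norm_quad_sub_le hr hvv
    (norm_average_sub_le_of_lip (F := V →L[ℝ] V →L[ℝ] E) S.H_lip x y z)
    (norm_average_sub_le_of_lip S.c_lip x y z)
  have h3 := norm_levyTerm_sub_le (S := S) hv hv' x y
  rw [sub_eq_add_neg, ← levyTerm_swap] at h3
  set X := 1 + ‖x‖ + ‖y‖ with hX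
  have hX1 : 1 ≤ X := by linarith
  have hxX : 1 + ‖x‖ ≤ X := by linarith
  have hyX : 1 + ‖y‖ ≤ X := by linarith
  have h4 : ‖S.martRem s x v v' + S.martRem s y v' v‖ ≤ 56 * S.C ^ 5 * s ^ 3 * X ^ 2 * r ^ 5 := by
    calc _ ≤ _ := norm_add_le _ _
      _ ≤ 28 * S.C ^ 5 * s ^ 3 * (1 + ‖x‖) ^ 2 * r ^ 5
          + 28 * S.C ^ 5 * s ^ 3 * (1 + ‖y‖) ^ 2 * r ^ 5 :=
        add_le_add (norm_martRem_le hs hsC hr hv hv' x) (norm_martRem_le hs hsC hr hv' hv y)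
      _ ≤ 28 * S.C ^ 5 * s ^ 3 * X ^ 2 * r ^ 5 + 28 * S.C ^ 5 * s ^ 3 * X ^ 2 * r ^ 5 := by
        gcongr
      _ = _ := by ring
  rw [avgMart]
  refine (norm_add_le _ _).trans ((add_le_add_left (norm_add₃_le ..) _).trans ?_)
  rw [norm_smul, norm_smul, norm_smul, norm_smul, Real.norm_of_nonneg hs,
    Real.norm_of_nonneg (by positivity), Real.norm_of_nonneg (by positivity),
    Real.norm_of_nonneg (by positivity)]
  set D := ‖x - y‖ with hD
  set e := ‖(1 / 2 : ℝ) • (x + y) - z‖ with he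
  have hD0 : 0 ≤ D := norm_nonneg _
  have he0 : 0 ≤ e := norm_nonneg _
  set η := D ^ 2 + s ^ 2 * X ^ 2 with hη
  have hη0 : 0 ≤ η := by positivity
  have hDη : D ^ 2 ≤ η := by simp only [hη]; nlinarith [sq_nonneg (s * X)]
  have hXη : s ^ 2 * X ^ 2 ≤ η := by simp only [hη]; nlinarith
  have hsD : s * D ≤ η := by
    have h5 : s ^ 2 ≤ s ^ 2 * X ^ 2 := le_mul_of_one_le_right (by positivity) (one_le_pow₀ hX1)
    simp only [hη]; nlinarith [sq_nonneg (s - D)]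
  calc _ ≤ s * (S.C * (D ^ 2 + e) * r) + s ^ 2 * (3 * (S.C * (1 / 2 * D + e)) * r ^ 2)
          + (1 / 2 * s ^ 2) * (2 * S.C * D * r ^ 2)
          + 1 / 2 * (56 * S.C ^ 5 * s ^ 3 * X ^ 2 * r ^ 5) := by gcongr
    _ = S.C ^ 1 * s * (D ^ 2 + e) * r ^ 1
        + 3 * S.C ^ 1 * s * (1 / 2 * (s * D) + s * e) * r ^ 2
        + S.C ^ 1 * s * (s * D) * r ^ 2 + 28 * S.C ^ 5 * s * (s ^ 2 * X ^ 2) * r ^ 5 := by ring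
    _ ≤ S.C ^ 6 * s * (η + e) * r ^ 5
        + 3 * S.C ^ 5 * s * (1 / 2 * η + S.C * e) * r ^ 5
        + S.C ^ 6 * s * η * r ^ 5 + 28 * S.C ^ 6 * s * η * r ^ 5 := by
        gcongr <;> first | assumption | norm_num
    _ ≤ S.C ^ 6 * s * (η + e) * r ^ 5
        + 3 * S.C ^ 5 * s * (S.C * η + S.C * e) * r ^ 5
        + S.C ^ 6 * s * η * r ^ 5 + 28 * S.C ^ 6 * s * η * r ^ 5 := by
        gcongr
        linarith
    _ = 33 * (S.C ^ 6 * s * η * r ^ 5) + 4 * (S.C ^ 6 * s * e * r ^ 5) := by ring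
    _ ≤ 60 * (S.C ^ 6 * s * η * r ^ 5) + 60 * (S.C ^ 6 * s * e * r ^ 5) := by
        gcongr <;> norm_num
    _ = _ := by ring

include hs hsC hr hv hv' in
lemma norm_avgDrift_le (x y z : E) :
    ‖S.avgDrift s x y z v v'‖
      ≤ 60 * S.C ^ 6 * s ^ 2 * (‖(1 / 2 : ℝ) • (x + y) - z‖
        + (‖x - y‖ ^ 2 + s ^ 2 * (1 + ‖x‖ + ‖y‖) ^ 2)) * r ^ 5 := by
  have h0 := S.one_le_C
  have hnx := norm_nonneg x
  have hny := norm_nonneg y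
  have h1 := norm_average_sub_le_of_taylor S.f_lip S.f_taylor x y z
  set X := 1 + ‖x‖ + ‖y‖ with hX
  have hxX : 1 + ‖x‖ ≤ X := by linarith
  have hyX : 1 + ‖y‖ ≤ X := by linarith
  have h4 : ‖S.driftRem s x v + S.driftRem s y v'‖ ≤ 38 * S.C ^ 5 * s ^ 4 * X ^ 2 * r ^ 4 := by
    calc _ ≤ _ := norm_add_le _ _
      _ ≤ 19 * S.C ^ 5 * s ^ 4 * (1 + ‖x‖) ^ 2 * r ^ 4
          + 19 * S.C ^ 5 * s ^ 4 * (1 + ‖y‖) ^ 2 * r ^ 4 :=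
        add_le_add (norm_driftRem_le hs hsC hr hv x) (norm_driftRem_le hs hsC hr hv' y)
      _ ≤ 19 * S.C ^ 5 * s ^ 4 * X ^ 2 * r ^ 4 + 19 * S.C ^ 5 * s ^ 4 * X ^ 2 * r ^ 4 := by
        gcongr
      _ = _ := by ring
  rw [avgDrift]
  refine (norm_add_le _ _).trans ?_
  rw [norm_smul, norm_smul, Real.norm_of_nonneg (by positivity),
    Real.norm_of_nonneg (by positivity)]
  set D := ‖x - y‖ with hD
  set e := ‖(1 / 2 : ℝ) • (x + y) - z‖ with he
  have hD0 : 0 ≤ D := norm_nonneg _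
  have he0 : 0 ≤ e := norm_nonneg _
  calc _ ≤ (2 * s ^ 2) * (S.C * (D ^ 2 + e)) + 1 / 2 * (38 * S.C ^ 5 * s ^ 4 * X ^ 2 * r ^ 4) := by
        gcongr
    _ = 2 * S.C ^ 1 * s ^ 2 * (e + D ^ 2) * 1 + 19 * S.C ^ 5 * s ^ 4 * X ^ 2 * r ^ 4 := by ring
    _ ≤ 2 * S.C ^ 6 * s ^ 2 * (e + D ^ 2) * r ^ 5 + 19 * S.C ^ 6 * s ^ 4 * X ^ 2 * r ^ 5 := by
        gcongr <;> first | assumption | exact one_le_pow₀ hr | norm_num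
    _ ≤ 60 * S.C ^ 6 * s ^ 2 * (e + D ^ 2) * r ^ 5 + 60 * S.C ^ 6 * s ^ 4 * X ^ 2 * r ^ 5 := by
        gcongr <;> norm_num
    _ = _ := by ring

end Bounds

section Lyapunov

variable [MeasurableSpace V] [BorelSpace V] [SecondCountableTopology V] [CompleteSpace V]
  [CompleteSpace E] {γ : Measure V} [IsProbabilityMeasure γ] (hγ : S.IsNoise γ)
include hγ

/-- Growth of an even moment of the state in one step. -/
lemma IsNoise.exists_lintegral_step_le (m : ℕ) : ∃ K : ℝ, 0 ≤ K ∧ ∀ s, 0 ≤ s → s ≤ S.C → ∀ x : E,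
    ∫⁻ v, ENNReal.ofReal (‖S.step s x v‖ ^ (2 * m + 2)) ∂γ
      ≤ ENNReal.ofReal ((1 + K * s ^ 2) * ‖x‖ ^ (2 * m + 2) + K * s ^ 2 * 1) := by
  have h0 := S.one_le_C
  have hC3 : S.C ≤ 3 * S.C ^ 2 := by nlinarith
  obtain ⟨K, hK, h⟩ := exists_lintegral_norm_add_pow_le (E := E) m (ρ := fun v : V => 1 + ‖v‖)
    (μ := γ) (fun v => by linarith [norm_nonneg v]) (hγ.integrable_rho_single _)
    (C := 3 * S.C ^ 2) (h0.trans hC3)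
  refine ⟨K, hK, fun s hs hsC x => ?_⟩
  have hx := norm_nonneg x
  have i1 := (hγ.integrable_clm (S.G x)).smul s
  have i2 := ((hγ.integrable_quadratic (S.H x)).sub (integrable_const (S.c x))).smul (s ^ 2)
  have key := h s hs (hsC.trans hC3) x 1 zero_le_one
    (fun v => s • S.G x v + s ^ 2 • (S.H x v v - S.c x)) (fun _ => s ^ 2 • S.f x) (i1.add i2) ?_ ?_ ?_
  · simp only [one_pow] at key
    refine le_of_eq_of_le (lintegral_congr fun v => ?_) key
    congr 3
    rw [step]; abel
  · have := integral_add i1 i2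
    simp only [Pi.smul_apply, Pi.sub_apply] at this
    rw [this, integral_smul, integral_smul,
      integral_sub (hγ.integrable_quadratic _) (integrable_const _), hγ.second, hγ.integral_clm]
    simp
  · intro v
    have hv := norm_nonneg v
    set r := 1 + ‖v‖ with hr
    have hr1 : 1 ≤ r := by linarith
    have hvr : ‖v‖ ≤ r := by linarith
    have h1 := norm_G_apply_le (S := S) hvr x
    have h2 := norm_H_apply_le (S := S) hvr hvr x
    have h3 := S.c_growth x
    calc _ ≤ _ := norm_add_le _ _
      _ = s * ‖S.G x v‖ + s ^ 2 * ‖S.H x v v - S.c x‖ := by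
          rw [norm_smul, norm_smul, Real.norm_of_nonneg hs, Real.norm_of_nonneg (by positivity)]
      _ ≤ s * (S.C * (1 + ‖x‖) * r)
          + s ^ 2 * (S.C * (1 + ‖x‖) * r * r + S.C * (1 + ‖x‖)) := by
          gcongr; exact (norm_sub_le _ _).trans (add_le_add h2 h3)
      _ = s * (S.C ^ 1 * (1 + ‖x‖) * r ^ 1)
          + s * s * (S.C * (1 + ‖x‖) * r ^ 2 + S.C * (1 + ‖x‖) * 1) := by ring
      _ ≤ s * (S.C ^ 2 * (1 + ‖x‖) * r ^ 5)
          + s * S.C * (S.C * (1 + ‖x‖) * r ^ 5 + S.C * (1 + ‖x‖) * r ^ 5) := by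
          gcongr <;> first | assumption | exact one_le_pow₀ hr1 | norm_num
      _ = _ := by ring
  · intro v
    have hr1 : 1 ≤ 1 + ‖v‖ := by linarith [norm_nonneg v]
    rw [norm_smul, Real.norm_of_nonneg (by positivity)]
    calc _ ≤ s ^ 2 * (S.C * (1 + ‖x‖)) := by gcongr; exact S.f_growth x
      _ = S.C * s ^ 2 * (‖x‖ + 1) * 1 := by ring
      _ ≤ _ := by gcongr; exact one_le_pow₀ hr1

/-- Growth of an even moment of the difference between the fine and the antithetic path over one
coarse step. -/
lemma IsNoise.exists_lintegral_diff_le (m : ℕ) : ∃ K : ℝ, 0 ≤ K ∧ ∀ s, 0 ≤ s → s ≤ S.C →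
    ∀ x y : E,
    ∫⁻ w, ENNReal.ofReal (‖S.fineStep s x w.1 w.2 - S.fineStep s y w.2 w.1‖ ^ (2 * m + 2))
      ∂(γ.prod γ)
      ≤ ENNReal.ofReal ((1 + K * s ^ 2) * ‖x - y‖ ^ (2 * m + 2)
        + K * s ^ 2 * (s * (1 + ‖x‖ + ‖y‖) ^ 2) ^ (2 * m + 2)) := by
  have h0 := S.one_le_C
  have hC6 : S.C ≤ 60 * S.C ^ 6 := by
    have : S.C ^ 1 ≤ S.C ^ 6 := pow_le_pow_right₀ h0 (by norm_num)
    have : 0 ≤ S.C ^ 6 := by positivity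
    linarith
  obtain ⟨K, hK, h⟩ := exists_lintegral_norm_add_pow_le (E := E) m
    (ρ := fun w : V × V => 1 + ‖w.1‖ + ‖w.2‖)
    (μ := γ.prod γ) (fun w => by linarith [norm_nonneg w.1, norm_nonneg w.2])
    (hγ.integrable_rho _) (C := 60 * S.C ^ 6) (h0.trans hC6)
  refine ⟨K, hK, fun s hs hsC x y => ?_⟩
  have hc : IsCentered γ fun w => S.diffMart s x y w.1 w.2 := by
    unfold diffMart
    refine IsCentered.add (IsCentered.add (IsCentered.add ?_ ?_) ?_) ?_
    · exact (hγ.isCentered_add_clm _).smul s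
    · have := ((hγ.isCentered_quad x).sub (hγ.isCentered_quad y)).smul (s ^ 2)
      refine cast (congrArg (IsCentered γ) (funext fun w => ?_)) this
      simp only [sub_apply]; module
    -- The Lévy terms of the two paths have opposite signs and add up here: `‖x - y‖` does not
    -- control them, whence the source term of order `s`.
    · exact ((hγ.isCentered_levyTerm x).sub (hγ.isCentered_levyTerm y).swap).smul _
    · exact (hγ.isCentered_martRem hs hsC x).sub (hγ.isCentered_martRem hs hsC y).swap
  refine le_of_eq_of_le (lintegral_congr fun w => ?_)
    (h s hs (hsC.trans hC6) (x - y) (s * (1 + ‖x‖ + ‖y‖) ^ 2) (by positivity)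
    (fun w => S.diffMart s x y w.1 w.2) (fun w => S.diffDrift s x y w.1 w.2) hc.1 hc.2
    (fun w => ?_) (fun w => ?_))
  · rw [fineStep_sub_fineStep]
  all_goals
    have h1 := norm_nonneg w.1
    have h2 := norm_nonneg w.2
    have h3 := norm_add_le w.1 w.2
  · exact norm_diffMart_le hs hsC (by linarith) (by linarith) (by linarith) (by linarith) x y
  · exact norm_diffDrift_le hs hsC (by linarith) (by linarith) (by linarith) x y

/-- Growth of an even moment of the difference between the averaged fine paths and the coarse path
over one coarse step. -/
lemma IsNoise.exists_lintegral_avg_le (m : ℕ) : ∃ K : ℝ, 0 ≤ K ∧ ∀ s, 0 ≤ s → s ≤ S.C →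
    ∀ x y z : E,
    ∫⁻ w, ENNReal.ofReal (‖(1 / 2 : ℝ) • (S.fineStep s x w.1 w.2 + S.fineStep s y w.2 w.1)
        - S.coarseStep s z w.1 w.2‖ ^ (2 * m + 2)) ∂(γ.prod γ)
      ≤ ENNReal.ofReal ((1 + K * s ^ 2) * ‖(1 / 2 : ℝ) • (x + y) - z‖ ^ (2 * m + 2)
        + K * s ^ 2 * (‖x - y‖ ^ 2 + s ^ 2 * (1 + ‖x‖ + ‖y‖) ^ 2) ^ (2 * m + 2)) := by
  have h0 := S.one_le_C
  have hC6 : S.C ≤ 60 * S.C ^ 6 := by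
    have : S.C ^ 1 ≤ S.C ^ 6 := pow_le_pow_right₀ h0 (by norm_num)
    have : 0 ≤ S.C ^ 6 := by positivity
    linarith
  obtain ⟨K, hK, h⟩ := exists_lintegral_norm_add_pow_le (E := E) m
    (ρ := fun w : V × V => 1 + ‖w.1‖ + ‖w.2‖)
    (μ := γ.prod γ) (fun w => by linarith [norm_nonneg w.1, norm_nonneg w.2])
    (hγ.integrable_rho _) (C := 60 * S.C ^ 6) (h0.trans hC6)
  refine ⟨K, hK, fun s hs hsC x y z => ?_⟩
  have hc : IsCentered γ fun w => S.avgMart s x y z w.1 w.2 := by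
    unfold avgMart
    refine IsCentered.add (IsCentered.add (IsCentered.add ?_ ?_) ?_) ?_
    · exact (hγ.isCentered_add_clm _).smul s
    · have := ((((hγ.isCentered_quad x).add (hγ.isCentered_quad y)).smul (1 / 2)).sub
        (hγ.isCentered_quad z)).smul (s ^ 2)
      refine cast (congrArg (IsCentered γ) (funext fun w => ?_)) this
      simp only [sub_apply, add_apply, smul_apply]; module
    -- The swap of the increments turns the sum of the Lévy terms into a difference of values at
    -- `x` and `y`.
    · exact ((hγ.isCentered_levyTerm x).add (hγ.isCentered_levyTerm y).swap).smul _
    · exact ((hγ.isCentered_martRem hs hsC x).add (hγ.isCentered_martRem hs hsC y).swap).smul _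
  refine le_of_eq_of_le (lintegral_congr fun w => ?_)
    (h s hs (hsC.trans hC6) ((1 / 2 : ℝ) • (x + y) - z)
    (‖x - y‖ ^ 2 + s ^ 2 * (1 + ‖x‖ + ‖y‖) ^ 2) (by positivity)
    (fun w => S.avgMart s x y z w.1 w.2) (fun w => S.avgDrift s x y z w.1 w.2) hc.1 hc.2
    (fun w => ?_) (fun w => ?_))
  · rw [average_fineStep_sub_coarseStep]
  all_goals
    have h1 := norm_nonneg w.1
    have h2 := norm_nonneg w.2
    have h3 := norm_add_le w.1 w.2
  · exact norm_avgMart_le hs hsC (by linarith) (by linarith) (by linarith) (by linarith) x y z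
  · exact norm_avgDrift_le hs hsC (by linarith) (by linarith) (by linarith) x y z

end Lyapunov

end StepData

/-! ### Bounds on expectations -/

section ExpLE

variable {Ω : Type*} [MeasurableSpace Ω] {P : Measure Ω} {u v : Ω → ℝ} {a b c : ℝ}

/-- The expectation of the nonnegative variable `u` is at most `a`. The Lebesgue integral makes
the bound carry integrability. -/
def ExpLE (P : Measure Ω) (u : Ω → ℝ) (a : ℝ) : Prop :=
  ∫⁻ ω, ENNReal.ofReal (u ω) ∂P ≤ ENNReal.ofReal a

lemma ExpLE.mono (h : ExpLE P v a) (huv : ∀ ω, u ω ≤ v ω) : ExpLE P u a :=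
  (lintegral_mono fun ω => ENNReal.ofReal_le_ofReal (huv ω)).trans h

lemma ExpLE.mono_right (h : ExpLE P u a) (hab : a ≤ b) : ExpLE P u b :=
  h.trans (ENNReal.ofReal_le_ofReal hab)

lemma ExpLE.add (h : ExpLE P u a) (h' : ExpLE P v b) (hu : Measurable u) (ha : 0 ≤ a)
    (hb : 0 ≤ b) : ExpLE P (fun ω => u ω + v ω) (a + b) := by
  unfold ExpLE at *
  calc _ ≤ ∫⁻ ω, (ENNReal.ofReal (u ω) + ENNReal.ofReal (v ω)) ∂P :=
        lintegral_mono fun ω => ENNReal.ofReal_add_le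
    _ = ∫⁻ ω, ENNReal.ofReal (u ω) ∂P + ∫⁻ ω, ENNReal.ofReal (v ω) ∂P :=
        lintegral_add_left hu.ennreal_ofReal _
    _ ≤ ENNReal.ofReal a + ENNReal.ofReal b := add_le_add h h'
    _ = _ := (ENNReal.ofReal_add ha hb).symm

lemma ExpLE.const_mul (h : ExpLE P u a) (hc : 0 ≤ c) : ExpLE P (fun ω => c * u ω) (c * a) := by
  unfold ExpLE at *
  simp_rw [ENNReal.ofReal_mul hc]
  rw [lintegral_const_mul' _ _ ENNReal.ofReal_ne_top]
  gcongr

lemma expLE_const [IsProbabilityMeasure P] (c : ℝ) : ExpLE P (fun _ => c) c := by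
  simp [ExpLE]

end ExpLE

lemma add_three_pow_le {a b c : ℝ} (ha : 0 ≤ a) (hb : 0 ≤ b) (hc : 0 ≤ c) (n : ℕ) :
    (a + b + c) ^ n ≤ 4 ^ n * (a ^ n + b ^ n + c ^ n) := by
  have h1 := add_pow_le (add_nonneg ha hb) hc n
  have h2 := add_pow_le ha hb n
  have h3 : (2 : ℝ) ^ (n - 1) ≤ 2 ^ n := pow_le_pow_right₀ (by norm_num) (by omega)
  have h4 : (1 : ℝ) ≤ 2 ^ n := one_le_pow₀ (by norm_num)
  calc _ ≤ 2 ^ (n - 1) * ((a + b) ^ n + c ^ n) := h1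
    _ ≤ 2 ^ n * (2 ^ n * (a ^ n + b ^ n) + 1 * c ^ n) := by
        rw [one_mul]
        gcongr
        exact h2.trans (by gcongr)
    _ ≤ 2 ^ n * (2 ^ n * (a ^ n + b ^ n) + 2 ^ n * c ^ n) := by gcongr
    _ = (2 * 2) ^ n * (a ^ n + b ^ n + c ^ n) := by rw [mul_pow]; ring
    _ = _ := by norm_num

lemma swapHalves_two_mul (n : ℕ) : swapHalves (2 * n) = 2 * n + 1 := by simp [swapHalves]

lemma swapHalves_two_mul_add_one (n : ℕ) : swapHalves (2 * n + 1) = 2 * n := by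
  simp [swapHalves, Nat.not_even_bit1]

lemma swapHalves_injective : Function.Injective swapHalves := by
  have h : Function.LeftInverse swapHalves swapHalves := fun m => by
    obtain ⟨n, rfl | rfl⟩ := Nat.even_or_odd' m
    · rw [swapHalves_two_mul, swapHalves_two_mul_add_one]
    · rw [swapHalves_two_mul_add_one, swapHalves_two_mul]
  exact h.injective

/-! ### Moments of the three paths on the grid -/

/-- A measurable independent and identically distributed sequence with law `γ`. -/
structure IsIID {Ω V : Type*} [MeasurableSpace Ω] [MeasurableSpace V] (ζ : ℕ → Ω → V)
    (γ : Measure V) (P : Measure Ω) : Prop where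
  measurable : ∀ m, Measurable (ζ m)
  indep : iIndepFun ζ P
  law : ∀ m, P.map (ζ m) = γ

namespace IsIID

variable {Ω V : Type*} [MeasurableSpace Ω] [MeasurableSpace V] {ζ : ℕ → Ω → V}
  {γ : Measure V} {P : Measure Ω}

lemma precomp (h : IsIID ζ γ P) {g : ℕ → ℕ} (hg : g.Injective) :
    IsIID (fun m => ζ (g m)) γ P :=
  ⟨fun _ => h.measurable _, h.indep.precomp hg, fun _ => h.law _⟩

/-- Variables built from disjoint parts of the sequence are independent. -/
lemma indepFun (h : IsIID ζ γ P) {A B : Set ℕ} (hAB : Disjoint A B) {S W : Type*}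
    [MeasurableSpace S] [MeasurableSpace W] {Z : Ω → S} {Y : Ω → W}
    (hZ : ∀ mΩ : MeasurableSpace Ω, (∀ i ∈ A, Measurable[mΩ] (ζ i)) → Measurable[mΩ] Z)
    (hY : ∀ mΩ : MeasurableSpace Ω, (∀ i ∈ B, Measurable[mΩ] (ζ i)) → Measurable[mΩ] Y) :
    IndepFun Z Y P := by
  have h1 := indep_iSup_of_disjoint (fun i => (h.measurable i).comap_le)
    ((iIndepFun_iff_iIndep ..).1 h.indep) hAB
  have key : ∀ C : Set ℕ, ∀ i ∈ C,
      Measurable[⨆ j ∈ C, MeasurableSpace.comap (ζ j) inferInstance] (ζ i) := by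
    intro C i hi
    refine Measurable.mono (comap_measurable (ζ i)) ?_ le_rfl
    exact le_iSup₂ (f := fun j (_ : j ∈ C) => MeasurableSpace.comap (ζ j) inferInstance) i hi
  rw [IndepFun_iff_Indep]
  refine indep_of_indep_of_le_left (indep_of_indep_of_le_right h1 ?_) ?_
  · exact (hY _ (key B)).comap_le
  · exact (hZ _ (key A)).comap_le

lemma map_pair [IsProbabilityMeasure P] (h : IsIID ζ γ P) {i j : ℕ} (hij : i ≠ j) :
    P.map (fun ω => (ζ i ω, ζ j ω)) = γ.prod γ := by
  have := (indepFun_iff_map_prod_eq_prod_map_map (h.measurable i).aemeasurable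
    (h.measurable j).aemeasurable).1 (h.indep.indepFun hij)
  rw [this, h.law, h.law]

lemma expLE_comp (h : IsIID ζ γ P) (m : ℕ) {u : V → ℝ} (hu : Measurable u) (hu0 : ∀ v, 0 ≤ u v)
    (hi : Integrable u γ) : ExpLE P (fun ω => u (ζ m ω)) (∫ v, u v ∂γ) := by
  unfold ExpLE
  rw [ofReal_integral_eq_lintegral_ofReal hi (Filter.Eventually.of_forall hu0), ← h.law m,
    lintegral_map hu.ennreal_ofReal (h.measurable m)]

end IsIID

namespace StepData

variable {E V : Type*} [NormedAddCommGroup E] [InnerProductSpace ℝ E]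
    [NormedAddCommGroup V] [NormedSpace ℝ V] (S : StepData E V)

/-- The path of the scheme driven by the normalised increments `ξ 0, ξ 1, …`. -/
def path (s : ℝ) (x₀ : E) (ξ : ℕ → V) : ℕ → E
  | 0 => x₀
  | n + 1 => S.step s (path s x₀ ξ n) (ξ n)

/-- The coarse path, whose `n`-th step uses the increments `ξ (2 n)` and `ξ (2 n + 1)`. -/
def coarse (s : ℝ) (x₀ : E) (ξ : ℕ → V) : ℕ → E
  | 0 => x₀
  | n + 1 => S.coarseStep s (coarse s x₀ ξ n) (ξ (2 * n)) (ξ (2 * n + 1))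

/-- The antithetic path. -/
def antiPath (s : ℝ) (x₀ : E) (ξ : ℕ → V) : ℕ → E := S.path s x₀ fun m => ξ (swapHalves m)

/-- The coarse path on the fine grid, interpolated linearly at the midpoints. -/
def coarseMid (s : ℝ) (x₀ : E) (ξ : ℕ → V) (k : ℕ) : E :=
  if Even k then S.coarse s x₀ ξ (k / 2)
  else (1 / 2 : ℝ) • (S.coarse s x₀ ξ (k / 2) + S.coarse s x₀ ξ (k / 2 + 1))

variable {S}

lemma path_two_mul_succ (s : ℝ) (x₀ : E) (ξ : ℕ → V) (n : ℕ) :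
    S.path s x₀ ξ (2 * (n + 1)) = S.fineStep s (S.path s x₀ ξ (2 * n)) (ξ (2 * n)) (ξ (2 * n + 1)) :=
  rfl

lemma antiPath_two_mul_add_one (s : ℝ) (x₀ : E) (ξ : ℕ → V) (n : ℕ) :
    S.antiPath s x₀ ξ (2 * n + 1)
      = S.step s (S.antiPath s x₀ ξ (2 * n)) (ξ (2 * n + 1)) := by
  have h : S.antiPath s x₀ ξ (2 * n + 1)
      = S.step s (S.antiPath s x₀ ξ (2 * n)) (ξ (swapHalves (2 * n))) := rfl
  rw [h, swapHalves_two_mul]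

lemma antiPath_two_mul_succ (s : ℝ) (x₀ : E) (ξ : ℕ → V) (n : ℕ) :
    S.antiPath s x₀ ξ (2 * (n + 1))
      = S.fineStep s (S.antiPath s x₀ ξ (2 * n)) (ξ (2 * n + 1)) (ξ (2 * n)) := by
  have h : S.antiPath s x₀ ξ (2 * (n + 1))
      = S.step s (S.antiPath s x₀ ξ (2 * n + 1)) (ξ (swapHalves (2 * n + 1))) := rfl
  rw [h, swapHalves_two_mul_add_one, antiPath_two_mul_add_one, fineStep]

variable [MeasurableSpace E] [BorelSpace E] [SecondCountableTopology E] [CompleteSpace E]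
  [MeasurableSpace V] [BorelSpace V] [SecondCountableTopology V] [CompleteSpace V]

lemma measurable_path {Ω : Type*} {mΩ : MeasurableSpace Ω} (s : ℝ) (x₀ : E) {ζ : ℕ → Ω → V}
    (n : ℕ) (h : ∀ i < n, Measurable (ζ i)) :
    Measurable fun ω => S.path s x₀ (fun m => ζ m ω) n := by
  induction n with
  | zero => exact measurable_const
  | succ n ih =>
    exact (S.continuous_step s).measurable.comp
      ((ih fun i hi => h i (by omega)).prodMk (h n (by omega)))

lemma measurable_antiPath {Ω : Type*} {mΩ : MeasurableSpace Ω} (s : ℝ) (x₀ : E) {ζ : ℕ → Ω → V}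
    (n : ℕ) (h : ∀ i < 2 * n, Measurable (ζ i)) :
    Measurable fun ω => S.antiPath s x₀ (fun m => ζ m ω) (2 * n) := by
  refine measurable_path (S := S) s x₀ (ζ := fun m => ζ (swapHalves m)) (2 * n) fun i hi => h _ ?_
  obtain ⟨k, rfl | rfl⟩ := Nat.even_or_odd' i
  · rw [swapHalves_two_mul]; omega
  · rw [swapHalves_two_mul_add_one]; omega

lemma measurable_coarse {Ω : Type*} {mΩ : MeasurableSpace Ω} (s : ℝ) (x₀ : E) {ζ : ℕ → Ω → V}
    (n : ℕ) (h : ∀ i < 2 * n, Measurable (ζ i)) :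
    Measurable fun ω => S.coarse s x₀ (fun m => ζ m ω) n := by
  induction n with
  | zero => exact measurable_const
  | succ n ih =>
    exact (S.continuous_coarseStep s).measurable.comp ((ih fun i hi => h i (by omega)).prodMk
      ((h (2 * n) (by omega)).prodMk (h (2 * n + 1) (by omega))))

variable {γ : Measure V} [IsProbabilityMeasure γ] (hγ : S.IsNoise γ)
  {Ω : Type*} [MeasurableSpace Ω] (P : Measure Ω) [IsProbabilityMeasure P]
include hγ

/-- Even moments of the path are bounded over a fixed time horizon. -/
lemma IsNoise.exists_expLE_path (m : ℕ) {T : ℝ} (hT : 0 ≤ T) (x₀ : E) :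
    ∃ K : ℝ, 0 ≤ K ∧ ∀ s, 0 ≤ s → s ≤ S.C → ∀ M : ℕ, M * s ^ 2 ≤ T → ∀ ζ : ℕ → Ω → V,
      IsIID ζ γ P → ∀ n ≤ M,
      ExpLE P (fun ω => ‖S.path s x₀ (fun m => ζ m ω) n‖ ^ (2 * m + 2)) K := by
  obtain ⟨K, hK, h⟩ := hγ.exists_lintegral_step_le m
  refine ⟨Real.exp (K * T) * (‖x₀‖ ^ (2 * m + 2) + K * T * 1), by positivity,
    fun s hs hsC M hM ζ hζ => ?_⟩
  refine lintegral_chain_le (μ := γ) (η := ζ) (Z := fun n ω => S.path s x₀ (fun m => ζ m ω) n)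
    (F := S.step s) (φ := fun x => ‖x‖ ^ (2 * m + 2)) (ψ := fun _ => 1) (κ := K * s ^ 2)
    (fun n => S.measurable_path s x₀ n fun i _ => hζ.measurable i) hζ.measurable (fun n => ?_)
    hζ.law (S.continuous_step s).measurable (fun n ω => rfl) (by fun_prop) (by fun_prop)
    (by positivity) (by positivity) zero_le_one ?_ (h s hs hsC) ?_ ?_
  · exact hζ.indepFun (A := {i | i < n}) (B := {n}) (by simp)
      (fun _ hm => measurable_path s x₀ n hm) (fun _ hm => hm n rfl)
  · calc M * (K * s ^ 2) = K * (M * s ^ 2) := by ring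
      _ ≤ _ := by gcongr
  · simp [path]
  · simp

/-- Even moments of the growth factor in the one-step estimates. -/
lemma IsNoise.exists_expLE_growth (m : ℕ) {T : ℝ} (hT : 0 ≤ T) (x₀ : E) :
    ∃ K : ℝ, 0 ≤ K ∧ ∀ s, 0 ≤ s → s ≤ S.C → ∀ N : ℕ, 2 * N * s ^ 2 ≤ T → ∀ ζ : ℕ → Ω → V,
      IsIID ζ γ P → ∀ n ≤ N,
      ExpLE P (fun ω => (1 + ‖S.path s x₀ (fun m => ζ m ω) (2 * n)‖
        + ‖S.antiPath s x₀ (fun m => ζ m ω) (2 * n)‖) ^ (2 * m + 2)) K := by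
  obtain ⟨K, hK, h⟩ := hγ.exists_expLE_path P m hT x₀
  refine ⟨4 ^ (2 * m + 2) * (1 + K + K), by positivity, fun s hs hsC N hN ζ hζ n hn => ?_⟩
  have hN' : ((2 * N : ℕ) : ℝ) * s ^ 2 ≤ T := by push_cast; exact hN
  have h1 := h s hs hsC (2 * N) hN' ζ hζ (2 * n) (by omega)
  have h2 := h s hs hsC (2 * N) hN' _ (hζ.precomp swapHalves_injective) (2 * n) (by omega)
  have m1 := S.measurable_path s x₀ (2 * n) fun i _ => hζ.measurable i
  refine ((((expLE_const 1).add h1 measurable_const zero_le_one hK).add h2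
    (by fun_prop) (by positivity) hK).const_mul (by positivity)).mono fun ω => ?_
  have := add_three_pow_le zero_le_one (norm_nonneg (S.path s x₀ (fun m => ζ m ω) (2 * n)))
    (norm_nonneg (S.antiPath s x₀ (fun m => ζ m ω) (2 * n))) (2 * m + 2)
  rwa [one_pow] at this

/-- The joint chain of the fine, antithetic and coarse paths, one coarse step at a time: a
one-step Lyapunov estimate propagates. -/
lemma IsNoise.expLE_chain {s : ℝ} (x₀ : E) {ζ : ℕ → Ω → V} (hζ : IsIID ζ γ P)
    {φ ψ : E × E × E → ℝ} (hφ : Measurable φ) (hψ : Measurable ψ) {κ b B : ℝ} (hκ : 0 ≤ κ)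
    (hb : 0 ≤ b) {N : ℕ} (hB : N * κ ≤ B)
    (hstep : ∀ x y z, ∫⁻ w, ENNReal.ofReal (φ (S.fineStep s x w.1 w.2, S.fineStep s y w.2 w.1,
      S.coarseStep s z w.1 w.2)) ∂(γ.prod γ)
      ≤ ENNReal.ofReal ((1 + κ) * φ (x, y, z) + κ * ψ (x, y, z)))
    (h0 : φ (x₀, x₀, x₀) = 0)
    (hψb : ∀ n < N, ExpLE P (fun ω => ψ (S.path s x₀ (fun m => ζ m ω) (2 * n),
      S.antiPath s x₀ (fun m => ζ m ω) (2 * n), S.coarse s x₀ (fun m => ζ m ω) n)) b) :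
    ∀ n ≤ N, ExpLE P (fun ω => φ (S.path s x₀ (fun m => ζ m ω) (2 * n),
      S.antiPath s x₀ (fun m => ζ m ω) (2 * n), S.coarse s x₀ (fun m => ζ m ω) n))
      (Real.exp B * (0 + B * b)) := by
  have hF : Continuous fun p : (E × E × E) × (V × V) =>
      (S.fineStep s p.1.1 p.2.1 p.2.2, S.fineStep s p.1.2.1 p.2.2 p.2.1,
        S.coarseStep s p.1.2.2 p.2.1 p.2.2) := by
    have c1 : ∀ {X : Type _} [TopologicalSpace X] {a : X → E} {b : X → V}, Continuous a →
        Continuous b → Continuous fun t => S.step s (a t) (b t) :=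
      fun ha hb => (S.continuous_step s).comp (ha.prodMk hb)
    refine (c1 (c1 ?_ ?_) ?_).prodMk ((c1 (c1 ?_ ?_) ?_).prodMk
      ((S.continuous_coarseStep s).comp (Continuous.prodMk ?_ (Continuous.prodMk ?_ ?_)))) <;>
      fun_prop
  refine lintegral_chain_le (μ := γ.prod γ) (η := fun n ω => (ζ (2 * n) ω, ζ (2 * n + 1) ω))
    (Z := fun n ω => (S.path s x₀ (fun m => ζ m ω) (2 * n),
      S.antiPath s x₀ (fun m => ζ m ω) (2 * n), S.coarse s x₀ (fun m => ζ m ω) n))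
    (F := fun p w => (S.fineStep s p.1 w.1 w.2, S.fineStep s p.2.1 w.2 w.1,
        S.coarseStep s p.2.2 w.1 w.2)) (κ := κ)
    (fun n => ?_) (fun n => (hζ.measurable _).prodMk (hζ.measurable _)) (fun n => ?_)
    (fun n => hζ.map_pair (by omega)) hF.measurable (fun n ω => ?_) hφ hψ hκ le_rfl hb hB
    (fun z => hstep z.1 z.2.1 z.2.2) ?_ hψb
  · exact (measurable_path s x₀ _ fun i _ => hζ.measurable i).prodMk
      ((measurable_antiPath s x₀ _ fun i _ => hζ.measurable i).prodMk
        (measurable_coarse s x₀ _ fun i _ => hζ.measurable i))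
  -- After `n` coarse steps the three paths are functions of the first `2 n` increments only, since
  -- the swap stays inside each coarse step.
  · refine hζ.indepFun (A := {i | i < 2 * n}) (B := {2 * n, 2 * n + 1}) ?_ (fun _ hm => ?_)
      (fun _ hm => (hm _ (by simp)).prodMk (hm _ (by simp)))
    · rw [Set.disjoint_left]
      rintro i hi (rfl | rfl) <;> simp at hi
    · exact (measurable_path s x₀ _ hm).prodMk
        ((measurable_antiPath s x₀ _ hm).prodMk (measurable_coarse s x₀ _ hm))
  · rw [path_two_mul_succ, antiPath_two_mul_succ, coarse]
  · simp [path, antiPath, coarse, h0]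

/-- On the coarse grid the fine and the antithetic path differ by `O(s)` in every even moment. -/
lemma IsNoise.exists_expLE_diff (m : ℕ) {T : ℝ} (hT : 0 ≤ T) (x₀ : E) :
    ∃ K : ℝ, 0 ≤ K ∧ ∀ s, 0 ≤ s → s ≤ S.C → ∀ N : ℕ, 2 * N * s ^ 2 ≤ T → ∀ ζ : ℕ → Ω → V,
      IsIID ζ γ P → ∀ n ≤ N,
      ExpLE P (fun ω => ‖S.path s x₀ (fun m => ζ m ω) (2 * n)
        - S.antiPath s x₀ (fun m => ζ m ω) (2 * n)‖ ^ (2 * m + 2)) (K * s ^ (2 * m + 2)) := by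
  obtain ⟨K, hK, h⟩ := hγ.exists_lintegral_diff_le m
  obtain ⟨K', hK', h'⟩ := hγ.exists_expLE_growth P (2 * m + 1) hT x₀
  refine ⟨Real.exp (K * T) * (K * T * K'), by positivity, fun s hs hsC N hN ζ hζ n hn => ?_⟩
  have key := hγ.expLE_chain P x₀ hζ (s := s) (φ := fun z => ‖z.1 - z.2.1‖ ^ (2 * m + 2))
    (ψ := fun z => (s * (1 + ‖z.1‖ + ‖z.2.1‖) ^ 2) ^ (2 * m + 2)) (by fun_prop) (by fun_prop)
    (κ := K * s ^ 2) (b := s ^ (2 * m + 2) * K') (B := K * T) (by positivity) (by positivity)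
    (N := N) ?_ (fun x y z => h s hs hsC x y) (by simp) (fun k hk => ?_) n hn
  · exact key.mono_right (le_of_eq (by ring))
  · have : (N : ℝ) * s ^ 2 ≤ T := by nlinarith [sq_nonneg s, (Nat.cast_nonneg N : (0 : ℝ) ≤ N)]
    calc N * (K * s ^ 2) = K * (N * s ^ 2) := by ring
      _ ≤ _ := by gcongr
  · refine ((h' s hs hsC N hN ζ hζ k hk.le).const_mul (by positivity : 0 ≤ s ^ (2 * m + 2))).mono
      fun ω => le_of_eq ?_
    rw [mul_pow, ← pow_mul]
    rfl

/-- On the coarse grid the average of the fine and the antithetic path differs from the coarse path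
by `O(s ^ 2)` in every even moment. -/
lemma IsNoise.exists_expLE_avg (m : ℕ) {T : ℝ} (hT : 0 ≤ T) (x₀ : E) :
    ∃ K : ℝ, 0 ≤ K ∧ ∀ s, 0 ≤ s → s ≤ S.C → ∀ N : ℕ, 2 * N * s ^ 2 ≤ T → ∀ ζ : ℕ → Ω → V,
      IsIID ζ γ P → ∀ n ≤ N,
      ExpLE P (fun ω => ‖(1 / 2 : ℝ) • (S.path s x₀ (fun m => ζ m ω) (2 * n)
        + S.antiPath s x₀ (fun m => ζ m ω) (2 * n)) - S.coarse s x₀ (fun m => ζ m ω) n‖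
          ^ (2 * m + 2)) (K * (s ^ 2) ^ (2 * m + 2)) := by
  obtain ⟨K, hK, h⟩ := hγ.exists_lintegral_avg_le m
  obtain ⟨K', hK', h'⟩ := hγ.exists_expLE_growth P (2 * m + 1) hT x₀
  obtain ⟨K'', hK'', h''⟩ := hγ.exists_expLE_diff P (2 * m + 1) hT x₀
  have hq : 2 * (2 * m + 1) + 2 = 2 * (2 * m + 2) := by ring
  rw [hq] at h' h''
  refine ⟨Real.exp (K * T) * (K * T * (2 ^ (2 * m + 1) * (K'' + K'))), by positivity,
    fun s hs hsC N hN ζ hζ n hn => ?_⟩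
  have key := hγ.expLE_chain P x₀ hζ (s := s)
    (φ := fun z => ‖(1 / 2 : ℝ) • (z.1 + z.2.1) - z.2.2‖ ^ (2 * m + 2))
    (ψ := fun z => (‖z.1 - z.2.1‖ ^ 2 + s ^ 2 * (1 + ‖z.1‖ + ‖z.2.1‖) ^ 2) ^ (2 * m + 2))
    (by fun_prop) (by fun_prop)
    (κ := K * s ^ 2) (b := 2 ^ (2 * m + 1) * (K'' * s ^ (2 * (2 * m + 2))
      + (s ^ 2) ^ (2 * m + 2) * K')) (B := K * T) (by positivity) (by positivity)
    (N := N) ?_ (fun x y z => h s hs hsC x y z) ?_ (fun k hk => ?_) n hn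
  · exact key.mono_right (le_of_eq (by rw [pow_mul]; ring))
  · have : (N : ℝ) * s ^ 2 ≤ T := by nlinarith [sq_nonneg s, (Nat.cast_nonneg N : (0 : ℝ) ≤ N)]
    calc N * (K * s ^ 2) = K * (N * s ^ 2) := by ring
      _ ≤ _ := by gcongr
  · have : (1 / 2 : ℝ) • (x₀ + x₀) - x₀ = 0 := by module
    simp only [this]
    simp
  · have m1 := S.measurable_path s x₀ (2 * k) fun i _ => hζ.measurable i
    have m2 := S.measurable_antiPath s x₀ k fun i _ => hζ.measurable i
    refine (((h'' s hs hsC N hN ζ hζ k hk.le).add ((h' s hs hsC N hN ζ hζ k hk.le).const_mul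
      (by positivity : 0 ≤ (s ^ 2) ^ (2 * m + 2))) (by fun_prop) (by positivity)
      (by positivity)).const_mul (by positivity)).mono fun ω => ?_
    refine (add_pow_le (by positivity) (by positivity) _).trans (le_of_eq ?_)
    simp only [mul_pow, ← pow_mul]
    rfl

end StepData

/-! ### The midpoints of the coarse steps -/

lemma add_four_pow_le {a b c d : ℝ} (ha : 0 ≤ a) (hb : 0 ≤ b) (hc : 0 ≤ c) (hd : 0 ≤ d) (n : ℕ) :
    (a + b + c + d) ^ n ≤ 8 ^ n * (a ^ n + b ^ n + c ^ n + d ^ n) := by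
  have h1 := add_pow_le (add_nonneg (add_nonneg ha hb) hc) hd n
  have h2 := add_three_pow_le ha hb hc n
  have h3 : (2 : ℝ) ^ (n - 1) ≤ 2 ^ n := pow_le_pow_right₀ (by norm_num) (by omega)
  have h4 : (1 : ℝ) ≤ 4 ^ n := one_le_pow₀ (by norm_num)
  calc _ ≤ 2 ^ (n - 1) * ((a + b + c) ^ n + d ^ n) := h1
    _ ≤ 2 ^ n * (4 ^ n * (a ^ n + b ^ n + c ^ n) + 1 * d ^ n) := by
        rw [one_mul]
        gcongr
    _ ≤ 2 ^ n * (4 ^ n * (a ^ n + b ^ n + c ^ n) + 4 ^ n * d ^ n) := by gcongr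
    _ = (2 * 4) ^ n * (a ^ n + b ^ n + c ^ n + d ^ n) := by rw [mul_pow]; ring
    _ = _ := by norm_num

namespace StepData

variable {E V : Type*} [NormedAddCommGroup E] [InnerProductSpace ℝ E]
    [NormedAddCommGroup V] [NormedSpace ℝ V] {S : StepData E V}

section Bounds

variable {s r : ℝ} (hs : 0 ≤ s) (hsC : s ≤ S.C) (hr : 1 ≤ r) {v v' : V} (hv : ‖v‖ ≤ r)
  (hv' : ‖v'‖ ≤ r) (hvv : ‖v + v'‖ ≤ r)

include hs hsC hr hv hv' in
lemma norm_step_sub_step_le (x y : E) :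
    ‖S.step s x v - S.step s y v'‖
      ≤ ‖x - y‖ + 8 * S.C ^ 2 * s * ((1 + ‖x‖ + ‖y‖) ^ 2 + r ^ 4) := by
  have h0 := S.one_le_C
  have h1 := norm_step_sub_le hs hsC hr hv x
  have h2 := norm_step_sub_le hs hsC hr hv' y
  have hnx := norm_nonneg x
  have hny := norm_nonneg y
  have e : S.step s x v - S.step s y v' = (x - y) + (S.step s x v - x) - (S.step s y v' - y) := by
    abel
  set X := 1 + ‖x‖ + ‖y‖ with hX
  have hxX : 1 + ‖x‖ ≤ X := by linarith
  have hyX : 1 + ‖y‖ ≤ X := by linarith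
  rw [e]
  calc _ ≤ ‖x - y‖ + ‖S.step s x v - x‖ + ‖S.step s y v' - y‖ :=
        (norm_sub_le _ _).trans (by gcongr; exact norm_add_le _ _)
    _ ≤ ‖x - y‖ + 4 * S.C ^ 2 * s * X * r ^ 2 + 4 * S.C ^ 2 * s * X * r ^ 2 := by
        gcongr
        · exact h1.trans (by gcongr)
        · exact h2.trans (by gcongr)
    _ = ‖x - y‖ + 8 * S.C ^ 2 * s * (X * r ^ 2) := by ring
    _ ≤ _ := by
        gcongr
        nlinarith [sq_nonneg (X - r ^ 2), sq_nonneg X, sq_nonneg (r ^ 2)]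

include hs hr hvv in
lemma norm_coarseStep_sub_sub_le (z : E) :
    ‖S.coarseStep s z v v' - z - s • S.G z (v + v')‖ ≤ 5 * S.C * s ^ 2 * (1 + ‖z‖) * r ^ 2 := by
  have h0 := S.C_pos
  have e : S.coarseStep s z v v' - z - s • S.G z (v + v')
      = (2 * s ^ 2) • S.f z + s ^ 2 • (S.H z (v + v') (v + v') - (2 : ℝ) • S.c z) := by
    rw [coarseStep]; abel
  have h1 := norm_quad_sub_le hr hvv (S.H_growth z) (S.c_growth z)
  rw [e]
  calc _ ≤ _ := norm_add_le _ _
    _ ≤ (2 * s ^ 2) * (S.C * (1 + ‖z‖) * 1) + s ^ 2 * (3 * (S.C * (1 + ‖z‖)) * r ^ 2) := by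
        rw [norm_smul, norm_smul, Real.norm_of_nonneg (by positivity),
          Real.norm_of_nonneg (by positivity), mul_one]
        gcongr
        exact S.f_growth z
    _ ≤ (2 * s ^ 2) * (S.C * (1 + ‖z‖) * r ^ 2) + s ^ 2 * (3 * (S.C * (1 + ‖z‖)) * r ^ 2) := by
        gcongr
        exact one_le_pow₀ hr
    _ = _ := by ring

include hs hsC hr hv hv' hvv in
/-- At a midpoint, the leading terms `s • G x v` and `s • G y v'` of the two half steps add up to
the leading term of the coarse step: this is what the antithetic swap buys between grid points. -/
lemma norm_average_step_sub_le (x y z : E) :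
    ‖(1 / 2 : ℝ) • (S.step s x v + S.step s y v')
        - (1 / 2 : ℝ) • (z + S.coarseStep s z v v')‖
      ≤ 6 * S.C ^ 3 * r ^ 2 * (‖(1 / 2 : ℝ) • (x + y) - z‖ + s * ‖x - y‖
        + s ^ 2 * (1 + ‖x‖ + ‖y‖)) := by
  have h0 := S.one_le_C
  have h1 := norm_step_sub_sub_le (S := S) (s := s) hr hv x
  have h2 := norm_step_sub_sub_le (S := S) (s := s) hr hv' y
  have h3 := norm_coarseStep_sub_sub_le (S := S) hs hr hvv z
  have hnx := norm_nonneg x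
  have hny := norm_nonneg y
  have hnz := norm_nonneg z
  set X := 1 + ‖x‖ + ‖y‖ with hX
  set m := (1 / 2 : ℝ) • (x + y) with hm
  set e := ‖m - z‖ with he
  set D := ‖x - y‖ with hD
  have hD0 : 0 ≤ D := norm_nonneg _
  have he0 : 0 ≤ e := norm_nonneg _
  have hX1 : 1 ≤ X := by linarith
  have hxX : 1 + ‖x‖ ≤ X := by linarith
  have hyX : 1 + ‖y‖ ≤ X := by linarith
  have hxz : ‖x - z‖ ≤ D + e := by
    have : x - z = (1 / 2 : ℝ) • (x - y) + (m - z) := by rw [hm]; module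
    rw [this]
    refine (norm_add_le _ _).trans ?_
    rw [norm_smul, Real.norm_of_nonneg (by norm_num)]
    linarith
  have hyz : ‖y - z‖ ≤ D + e := by
    have : y - z = (-1 / 2 : ℝ) • (x - y) + (m - z) := by rw [hm]; module
    rw [this]
    refine (norm_add_le _ _).trans ?_
    rw [norm_smul, show ‖(-1 / 2 : ℝ)‖ = 1 / 2 by norm_num]
    linarith
  have hz : 1 + ‖z‖ ≤ X + e := by
    have h5 : ‖m‖ ≤ 1 / 2 * (‖x‖ + ‖y‖) := by
      rw [hm, norm_smul, Real.norm_of_nonneg (by norm_num)]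
      gcongr
      exact norm_add_le _ _
    have h6 : ‖z‖ ≤ ‖m‖ + e := by
      have : z = m - (m - z) := by abel
      calc ‖z‖ = ‖m - (m - z)‖ := by rw [← this]
        _ ≤ _ := norm_sub_le _ _
    linarith
  have h7 : ‖(S.G x - S.G z) v‖ ≤ S.C * (D + e) * r :=
    ContinuousLinearMap.le_of_opNorm_le_of_le _ ((S.G_lip x z).trans (by gcongr)) hv
  have h8 : ‖(S.G y - S.G z) v'‖ ≤ S.C * (D + e) * r :=
    ContinuousLinearMap.le_of_opNorm_le_of_le _ ((S.G_lip y z).trans (by gcongr)) hv'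
  have key : (1 / 2 : ℝ) • (S.step s x v + S.step s y v')
        - (1 / 2 : ℝ) • (z + S.coarseStep s z v v')
      = (m - z) + (1 / 2 : ℝ) • ((S.step s x v - x - s • S.G x v)
        + (S.step s y v' - y - s • S.G y v') - (S.coarseStep s z v v' - z - s • S.G z (v + v'))
        + s • (S.G x - S.G z) v + s • (S.G y - S.G z) v') := by
    rw [hm]
    simp only [sub_apply, map_add]
    module
  rw [key]
  refine (norm_add_le _ _).trans ?_
  rw [norm_smul, Real.norm_of_nonneg (by norm_num)]
  have h9 : ‖(S.step s x v - x - s • S.G x v)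
        + (S.step s y v' - y - s • S.G y v') - (S.coarseStep s z v v' - z - s • S.G z (v + v'))
        + s • (S.G x - S.G z) v + s • (S.G y - S.G z) v'‖
      ≤ 3 * S.C * s ^ 2 * X * r ^ 2 + 3 * S.C * s ^ 2 * X * r ^ 2
        + 5 * S.C * s ^ 2 * (X + e) * r ^ 2 + s * (S.C * (D + e) * r) + s * (S.C * (D + e) * r) := by
    refine (norm_add_le _ _).trans (add_le_add ((norm_add_le _ _).trans (add_le_add
      ((norm_sub_le _ _).trans (add_le_add ((norm_add_le _ _).trans (add_le_add ?_ ?_)) ?_)) ?_)) ?_)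
    · exact h1.trans (by gcongr)
    · exact h2.trans (by gcongr)
    · exact h3.trans (by gcongr)
    · rw [norm_smul, Real.norm_of_nonneg hs]; gcongr
    · rw [norm_smul, Real.norm_of_nonneg hs]; gcongr
  calc _ ≤ e + 1 / 2 * (3 * S.C * s ^ 2 * X * r ^ 2 + 3 * S.C * s ^ 2 * X * r ^ 2
        + 5 * S.C * s ^ 2 * (X + e) * r ^ 2 + s * (S.C * (D + e) * r)
        + s * (S.C * (D + e) * r)) := by gcongr
    _ = 1 * e * 1 + 11 / 2 * S.C ^ 1 * r ^ 2 * (s ^ 2 * X) + 5 / 2 * S.C ^ 1 * s ^ 2 * e * r ^ 2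
        + S.C ^ 1 * r ^ 1 * (s * D) + S.C * s * e * r ^ 1 := by ring
    _ ≤ S.C ^ 3 * e * r ^ 2 + 11 / 2 * S.C ^ 3 * r ^ 2 * (s ^ 2 * X)
        + 5 / 2 * S.C ^ 1 * S.C ^ 2 * e * r ^ 2
        + S.C ^ 3 * r ^ 2 * (s * D) + S.C * S.C * e * r ^ 2 := by
        gcongr <;> first | assumption | exact one_le_pow₀ hr | exact one_le_pow₀ h0 | norm_num
    _ = (S.C ^ 3 * (7 / 2) + S.C ^ 2) * (r ^ 2 * e) + 11 / 2 * S.C ^ 3 * (r ^ 2 * (s ^ 2 * X))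
        + S.C ^ 3 * (r ^ 2 * (s * D)) := by ring
    _ ≤ (S.C ^ 3 * (7 / 2) + S.C ^ 3) * (r ^ 2 * e) + 11 / 2 * S.C ^ 3 * (r ^ 2 * (s ^ 2 * X))
        + S.C ^ 3 * (r ^ 2 * (s * D)) := by
        gcongr; norm_num
    _ ≤ _ := by
        have a1 : 0 ≤ S.C ^ 3 * (r ^ 2 * e) := by positivity
        have a2 : 0 ≤ S.C ^ 3 * (r ^ 2 * (s ^ 2 * X)) := by positivity
        have a3 : 0 ≤ S.C ^ 3 * (r ^ 2 * (s * D)) := by positivity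
        linarith

/-- Young's inequality, weighted so that every term has the order `s ^ 2`. -/
lemma young_midpoint_le {s r e D X : ℝ} (hs : 0 < s) :
    r ^ 2 * (e + s * D + s ^ 2 * X)
      ≤ 3 * (s ^ 2 * r ^ 4) + (s ^ 2)⁻¹ * e ^ 2 + D ^ 2 + s ^ 2 * X ^ 2 := by
  have h1 : r ^ 2 * e ≤ s ^ 2 * r ^ 4 + (s ^ 2)⁻¹ * e ^ 2 := by
    have e1 : r ^ 2 * e = (s * r ^ 2) * (s⁻¹ * e) := by field_simp
    have e2 : (s ^ 2)⁻¹ * e ^ 2 = (s⁻¹ * e) ^ 2 := by rw [mul_pow, inv_pow]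
    rw [e1, e2]
    nlinarith [sq_nonneg (s * r ^ 2 - s⁻¹ * e), sq_nonneg (s * r ^ 2), sq_nonneg (s⁻¹ * e)]
  have h2 : r ^ 2 * (s * D) ≤ s ^ 2 * r ^ 4 + D ^ 2 := by
    nlinarith [sq_nonneg (s * r ^ 2 - D), sq_nonneg (s * r ^ 2), sq_nonneg D]
  have h3 : r ^ 2 * (s ^ 2 * X) ≤ s ^ 2 * r ^ 4 + s ^ 2 * X ^ 2 := by
    nlinarith [sq_nonneg (s * r ^ 2 - s * X), sq_nonneg (s * r ^ 2), sq_nonneg (s * X)]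
  linarith

end Bounds

variable [MeasurableSpace E] [BorelSpace E] [SecondCountableTopology E] [CompleteSpace E]
  [MeasurableSpace V] [BorelSpace V] [SecondCountableTopology V] [CompleteSpace V]
  {γ : Measure V} [IsProbabilityMeasure γ] (hγ : S.IsNoise γ)
  {Ω : Type*} [MeasurableSpace Ω] (P : Measure Ω) [IsProbabilityMeasure P]
include hγ

lemma IsNoise.exists_expLE_noise (k : ℕ) : ∃ K : ℝ, 0 ≤ K ∧ ∀ ζ : ℕ → Ω → V, IsIID ζ γ P →
    ∀ i j, ExpLE P (fun ω => (1 + ‖ζ i ω‖ + ‖ζ j ω‖) ^ k) K := by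
  have hi : Integrable (fun v : V => ‖v‖ ^ k) γ := (hγ.memLp k).integrable_norm_pow'
  have h0 : 0 ≤ ∫ v, ‖v‖ ^ k ∂γ := integral_nonneg fun v => by positivity
  refine ⟨4 ^ k * (1 + ∫ v, ‖v‖ ^ k ∂γ + ∫ v, ‖v‖ ^ k ∂γ), by positivity, fun ζ hζ i j => ?_⟩
  have h1 := fun i => hζ.expLE_comp i (u := fun v => ‖v‖ ^ k) (by fun_prop)
    (fun v => by positivity) hi
  have hm := hζ.measurable i
  refine ((((expLE_const 1).add (h1 i) measurable_const zero_le_one h0).add (h1 j)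
    (by fun_prop) (by positivity) h0).const_mul (by positivity)).mono fun ω => ?_
  have := add_three_pow_le zero_le_one (norm_nonneg (ζ i ω)) (norm_nonneg (ζ j ω)) k
  rwa [one_pow] at this

/-- On the fine grid, the fine and the antithetic path differ by `O(s)` in every even moment. -/
lemma IsNoise.exists_expLE_diff_fine (m : ℕ) {T : ℝ} (hT : 0 ≤ T) (x₀ : E) :
    ∃ K : ℝ, 0 ≤ K ∧ ∀ s, 0 ≤ s → s ≤ S.C → ∀ N : ℕ, 2 * N * s ^ 2 ≤ T → ∀ ζ : ℕ → Ω → V,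
      IsIID ζ γ P → ∀ k ≤ 2 * N + 1,
      ExpLE P (fun ω => ‖S.path s x₀ (fun m => ζ m ω) k
        - S.antiPath s x₀ (fun m => ζ m ω) k‖ ^ (2 * m + 2)) (K * s ^ (2 * m + 2)) := by
  obtain ⟨K₁, hK₁, h₁⟩ := hγ.exists_expLE_diff P m hT x₀
  obtain ⟨K₂, hK₂, h₂⟩ := hγ.exists_expLE_growth P (2 * m + 1) hT x₀
  obtain ⟨K₃, hK₃, h₃⟩ := hγ.exists_expLE_noise P (4 * (2 * m + 2))
  have hq : 2 * (2 * m + 1) + 2 = 2 * (2 * m + 2) := by ring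
  rw [hq] at h₂
  have h0 := S.one_le_C
  set q := 2 * m + 2 with hqdef
  refine ⟨K₁ + 4 ^ q * (K₁ + (8 * S.C ^ 2) ^ q * K₂ + (8 * S.C ^ 2) ^ q * K₃), by positivity,
    fun s hs hsC N hN ζ hζ k hk => ?_⟩
  obtain ⟨n, rfl | rfl⟩ := Nat.even_or_odd' k
  · refine (h₁ s hs hsC N hN ζ hζ n (by omega)).mono_right ?_
    gcongr
    have : 0 ≤ 4 ^ q * (K₁ + (8 * S.C ^ 2) ^ q * K₂ + (8 * S.C ^ 2) ^ q * K₃) := by positivity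
    linarith
  · have hn : n ≤ N := by omega
    have m1 := S.measurable_path s x₀ (2 * n) fun i _ => hζ.measurable i
    have m2 := S.measurable_antiPath s x₀ n fun i _ => hζ.measurable i
    have hA : 0 ≤ (8 * S.C ^ 2 * s) ^ q := by positivity
    have key := (((h₁ s hs hsC N hN ζ hζ n hn).add
      ((h₂ s hs hsC N hN ζ hζ n hn).const_mul hA) (by fun_prop) (by positivity)
      (by positivity)).add ((h₃ ζ hζ (2 * n) (2 * n + 1)).const_mul hA) (by fun_prop)
      (by positivity) (by positivity)).const_mul (by positivity : (0 : ℝ) ≤ 4 ^ q)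
    refine (key.mono fun ω => ?_).mono_right ?_
    · rw [antiPath_two_mul_add_one]
      have hn1 := norm_nonneg (ζ (2 * n) ω)
      have hn2 := norm_nonneg (ζ (2 * n + 1) ω)
      have hb := norm_step_sub_step_le (S := S) (v := ζ (2 * n) ω) (v' := ζ (2 * n + 1) ω)
        (r := 1 + ‖ζ (2 * n) ω‖ + ‖ζ (2 * n + 1) ω‖) hs hsC (by linarith) (by linarith)
        (by linarith) (S.path s x₀ (fun m => ζ m ω) (2 * n))
        (S.antiPath s x₀ (fun m => ζ m ω) (2 * n))
      refine (pow_le_pow_left₀ (norm_nonneg _) hb q).trans ?_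
      rw [mul_add, ← add_assoc]
      refine (add_three_pow_le (by positivity) (by positivity) (by positivity) q).trans
        (le_of_eq ?_)
      simp only [mul_pow, ← pow_mul]
    · have : 0 ≤ K₁ * s ^ q := by positivity
      calc _ = (4 ^ q * (K₁ + (8 * S.C ^ 2) ^ q * K₂ + (8 * S.C ^ 2) ^ q * K₃)) * s ^ q := by
            simp only [mul_pow]; ring
        _ ≤ _ := by rw [add_mul]; linarith

/-- On the fine grid, the average of the fine and the antithetic path differs from the linearly
interpolated coarse path by `O(s ^ 2)` in every even moment. -/
lemma IsNoise.exists_expLE_avg_fine (m : ℕ) {T : ℝ} (hT : 0 ≤ T) (x₀ : E) :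
    ∃ K : ℝ, 0 ≤ K ∧ ∀ s, 0 < s → s ≤ S.C → ∀ N : ℕ, 2 * N * s ^ 2 ≤ T → ∀ ζ : ℕ → Ω → V,
      IsIID ζ γ P → ∀ k ≤ 2 * N + 1,
      ExpLE P (fun ω => ‖(1 / 2 : ℝ) • (S.path s x₀ (fun m => ζ m ω) k
        + S.antiPath s x₀ (fun m => ζ m ω) k) - S.coarseMid s x₀ (fun m => ζ m ω) k‖
          ^ (2 * m + 2)) (K * (s ^ 2) ^ (2 * m + 2)) := by
  obtain ⟨K₁, hK₁, h₁⟩ := hγ.exists_expLE_avg P m hT x₀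
  obtain ⟨K₂, hK₂, h₂⟩ := hγ.exists_expLE_growth P (2 * m + 1) hT x₀
  obtain ⟨K₃, hK₃, h₃⟩ := hγ.exists_expLE_noise P (4 * (2 * m + 2))
  -- At a midpoint the one-step bound is quadratic after Young's inequality, so the grid estimates
  -- are needed with the doubled exponent `2 * (2 * m + 2)`.
  obtain ⟨K₄, hK₄, h₄⟩ := hγ.exists_expLE_avg P (2 * m + 1) hT x₀
  obtain ⟨K₅, hK₅, h₅⟩ := hγ.exists_expLE_diff P (2 * m + 1) hT x₀
  have hq : 2 * (2 * m + 1) + 2 = 2 * (2 * m + 2) := by ring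
  rw [hq] at h₂ h₄ h₅
  have h0 := S.one_le_C
  set q := 2 * m + 2 with hqdef
  set A := 6 * S.C ^ 3 with hA
  have hA0 : 0 ≤ A := by positivity
  set B := A ^ q * 8 ^ q * (3 ^ q * K₃ + K₄ + K₅ + K₂) with hB
  have hB0 : 0 ≤ B := by positivity
  refine ⟨K₁ + B, by positivity, fun s hs hsC N hN ζ hζ k hk => ?_⟩
  obtain ⟨n, rfl | rfl⟩ := Nat.even_or_odd' k
  · have e : ∀ ξ : ℕ → V, S.coarseMid s x₀ ξ (2 * n) = S.coarse s x₀ ξ n := fun ξ => by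
      simp [coarseMid]
    simp_rw [e]
    refine (h₁ s hs.le hsC N hN ζ hζ n (by omega)).mono_right ?_
    gcongr
    linarith
  · have hn : n ≤ N := by omega
    have e : ∀ ξ : ℕ → V, S.coarseMid s x₀ ξ (2 * n + 1) = (1 / 2 : ℝ) • (S.coarse s x₀ ξ n
        + S.coarseStep s (S.coarse s x₀ ξ n) (ξ (2 * n)) (ξ (2 * n + 1))) := fun ξ => by
      have h1 : (2 * n + 1) / 2 = n := by omega
      rw [coarseMid, if_neg (Nat.not_even_bit1 n), h1]
      rfl
    have m1 := S.measurable_path s x₀ (2 * n) fun i _ => hζ.measurable i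
    have m2 := S.measurable_antiPath s x₀ n fun i _ => hζ.measurable i
    have m3 := S.measurable_coarse s x₀ n fun i _ => hζ.measurable i
    have m4 := hζ.measurable (2 * n)
    have m5 := hζ.measurable (2 * n + 1)
    have c1 : 0 ≤ (3 * s ^ 2) ^ q := by positivity
    have c2 : 0 ≤ ((s ^ 2)⁻¹) ^ q := by positivity
    have c3 : 0 ≤ (s ^ 2) ^ q := by positivity
    have key := (((((h₃ ζ hζ (2 * n) (2 * n + 1)).const_mul c1).add
      ((h₄ s hs.le hsC N hN ζ hζ n hn).const_mul c2) (by fun_prop) (by positivity)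
      (by positivity)).add (h₅ s hs.le hsC N hN ζ hζ n hn) (by fun_prop)
      (by positivity) (by positivity)).add ((h₂ s hs.le hsC N hN ζ hζ n hn).const_mul c3)
      (by fun_prop) (by positivity) (by positivity)).const_mul
      (by positivity : (0 : ℝ) ≤ A ^ q * 8 ^ q)
    refine (key.mono fun ω => ?_).mono_right ?_
    · rw [antiPath_two_mul_add_one, e]
      have hn1 := norm_nonneg (ζ (2 * n) ω)
      have hn2 := norm_nonneg (ζ (2 * n + 1) ω)
      have hn3 := norm_add_le (ζ (2 * n) ω) (ζ (2 * n + 1) ω)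
      have hb := norm_average_step_sub_le (S := S) (v := ζ (2 * n) ω) (v' := ζ (2 * n + 1) ω)
        (r := 1 + ‖ζ (2 * n) ω‖ + ‖ζ (2 * n + 1) ω‖) hs.le hsC (by linarith) (by linarith)
        (by linarith) (by linarith) (S.path s x₀ (fun m => ζ m ω) (2 * n))
        (S.antiPath s x₀ (fun m => ζ m ω) (2 * n)) (S.coarse s x₀ (fun m => ζ m ω) n)
      rw [mul_assoc] at hb
      refine (pow_le_pow_left₀ (norm_nonneg _)
        (hb.trans (mul_le_mul_of_nonneg_left (young_midpoint_le hs) hA0)) q).trans ?_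
      rw [mul_pow, mul_assoc (A ^ q)]
      refine mul_le_mul_of_nonneg_left ?_ (by positivity)
      refine (add_four_pow_le (by positivity) (by positivity) (by positivity) (by positivity)
        q).trans (le_of_eq ?_)
      simp only [mul_pow, ← pow_mul, mul_assoc]
    · have h6 : ((s ^ 2)⁻¹) ^ q * (K₄ * (s ^ 2) ^ (2 * q)) = K₄ * (s ^ 2) ^ q := by
        have hne : (s ^ 2) ^ q ≠ 0 := by positivity
        have h2 : (s ^ 2) ^ (2 * q) = (s ^ 2) ^ q * (s ^ 2) ^ q := by
          rw [two_mul]; exact pow_add _ q q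
        rw [h2, inv_pow]
        generalize (s ^ 2) ^ q = t at hne
        field_simp
      have h7 : K₅ * s ^ (2 * q) = K₅ * (s ^ 2) ^ q := by rw [pow_mul]
      have : 0 ≤ K₁ * (s ^ 2) ^ q := by positivity
      rw [h6, h7, mul_pow 3]
      calc _ = B * (s ^ 2) ^ q := by rw [hB]; ring
        _ ≤ _ := by rw [add_mul]; linarith

end StepData

/-! ### The coordinate-free data of a system of coefficients -/

section PartialDerivatives

variable {d : ℕ} {φ : EuclideanSpace ℝ (Fin d) → ℝ}

lemma fderiv_apply_eq_sum (φ : EuclideanSpace ℝ (Fin d) → ℝ) (x u : EuclideanSpace ℝ (Fin d)) :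
    fderiv ℝ φ x u = ∑ l, u l * partialDeriv l φ x := by
  have hu : u = ∑ l, u l • EuclideanSpace.single l (1 : ℝ) := by
    ext i
    simp [Finset.sum_apply, Pi.single_apply]
  conv_lhs => rw [hu]
  simp [map_sum, partialDeriv]

/-- A continuous linear functional is bounded by its values on the standard basis. -/
lemma norm_clm_le_of_single {ℓ : EuclideanSpace ℝ (Fin d) →L[ℝ] ℝ} {A : ℝ} (hA : 0 ≤ A)
    (h : ∀ l, |ℓ (EuclideanSpace.single l 1)| ≤ A) : ‖ℓ‖ ≤ d * A := by
  refine ℓ.opNorm_le_bound (by positivity) fun u => ?_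
  have hu : u = ∑ l, u l • EuclideanSpace.single l (1 : ℝ) := by
    ext i
    simp [Finset.sum_apply, Pi.single_apply]
  have h1 : ℓ u = ∑ l, u l * ℓ (EuclideanSpace.single l 1) := by
    conv_lhs => rw [hu]
    simp [map_sum]
  rw [h1]
  calc ‖∑ l, u l * ℓ (EuclideanSpace.single l 1)‖
      ≤ ∑ l, ‖u l * ℓ (EuclideanSpace.single l 1)‖ := norm_sum_le _ _
    _ ≤ ∑ _l : Fin d, ‖u‖ * A := by
        refine Finset.sum_le_sum fun l _ => ?_
        rw [norm_mul]
        exact mul_le_mul (PiLp.norm_apply_le u l) (h l) (norm_nonneg _) (norm_nonneg _)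
    _ = _ := by simp; ring

lemma norm_fderiv_le_of_partialDeriv {L : ℝ} (h : ∀ x l, |partialDeriv l φ x| ≤ L)
    (x : EuclideanSpace ℝ (Fin d)) : ‖fderiv ℝ φ x‖ ≤ d * |L| :=
  norm_clm_le_of_single (abs_nonneg L) fun l => (h x l).trans (le_abs_self L)

lemma abs_sub_le_of_partialDeriv (hφ : Differentiable ℝ φ) {L : ℝ}
    (h : ∀ x l, |partialDeriv l φ x| ≤ L) (x y : EuclideanSpace ℝ (Fin d)) :
    |φ x - φ y| ≤ d * |L| * ‖x - y‖ :=
  convex_univ.norm_image_sub_le_of_norm_fderiv_le (fun z _ => hφ z)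
    (fun z _ => norm_fderiv_le_of_partialDeriv h z) (Set.mem_univ y) (Set.mem_univ x)

/-- Quadratic Taylor remainder of a function with Lipschitz derivative. -/
lemma norm_taylor_le_of_fderiv_lip {E F : Type*} [NormedAddCommGroup E] [NormedSpace ℝ E]
    [NormedAddCommGroup F] [NormedSpace ℝ F] {φ : E → F} (hφ : Differentiable ℝ φ) {K : ℝ}
    (hK : 0 ≤ K) (h : ∀ x y, ‖fderiv ℝ φ x - fderiv ℝ φ y‖ ≤ K * ‖x - y‖) (x y : E) :
    ‖φ y - φ x - fderiv ℝ φ x (y - x)‖ ≤ K * ‖y - x‖ ^ 2 := by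
  have := (convex_closedBall x ‖y - x‖).norm_image_sub_le_of_norm_fderiv_le'
    (𝕜 := ℝ) (f := φ) (φ := fderiv ℝ φ x) (C := K * ‖y - x‖) (x := x) (y := y)
    (fun z _ => hφ z) (fun z hz => (h z x).trans (by
      gcongr; rwa [mem_closedBall_iff_norm] at hz)) (by simp) (by simp [dist_eq_norm])
  calc _ ≤ _ := this
    _ = _ := by ring

lemma contDiff_partialDeriv (hφ : ContDiff ℝ 2 φ) (l : Fin d) : ContDiff ℝ 1 (partialDeriv l φ) :=
  (hφ.fderiv_right (m := 1) (by norm_num)).clm_apply contDiff_const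

lemma abs_taylor_le_of_partialDeriv (hφ : ContDiff ℝ 2 φ) {L : ℝ}
    (h : ∀ x k l, |partialDeriv k (partialDeriv l φ) x| ≤ L) (x y : EuclideanSpace ℝ (Fin d)) :
    |φ y - φ x - fderiv ℝ φ x (y - x)| ≤ d * (d * |L|) * ‖y - x‖ ^ 2 := by
  refine norm_taylor_le_of_fderiv_lip (hφ.differentiable (by norm_num)) (by positivity)
    (fun x y => ?_) x y
  calc _ ≤ d * (d * |L| * ‖x - y‖) := by
        refine norm_clm_le_of_single (by positivity) fun l => ?_
        exact abs_sub_le_of_partialDeriv ((contDiff_partialDeriv hφ l).differentiable (by norm_num))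
          (fun x k => h x k l) x y
    _ = _ := by ring

end PartialDerivatives

section FiniteSums

variable {ι E F : Type*} [Fintype ι] [NormedAddCommGroup E] [NormedSpace ℝ E]
  [NormedAddCommGroup F] [NormedSpace ℝ F] (B : ι → F) {φ : ι → E → ℝ} {A : ℝ}

lemma exists_sum_smul_lip (hA : 0 ≤ A) (h : ∀ a x y, |φ a x - φ a y| ≤ A * ‖x - y‖) :
    ∃ K : ℝ, 0 ≤ K ∧ (∀ x y, ‖∑ a, φ a x • B a - ∑ a, φ a y • B a‖ ≤ K * ‖x - y‖) ∧
      ∀ x, ‖∑ a, φ a x • B a‖ ≤ K * (1 + ‖x‖) := by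
  have h1 : ∀ x y, ‖∑ a, φ a x • B a - ∑ a, φ a y • B a‖ ≤ A * (∑ a, ‖B a‖) * ‖x - y‖ := by
    intro x y
    rw [← Finset.sum_sub_distrib]
    calc _ ≤ ∑ a, ‖φ a x • B a - φ a y • B a‖ := norm_sum_le _ _
      _ ≤ ∑ a, (A * ‖x - y‖) * ‖B a‖ := by
          refine Finset.sum_le_sum fun a _ => ?_
          rw [← sub_smul, norm_smul]
          gcongr
          exact h a x y
      _ = _ := by rw [← Finset.mul_sum]; ring
  have h2 : 0 ≤ A * ∑ a, ‖B a‖ := by positivity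
  have h3 := norm_nonneg (∑ a, φ a 0 • B a)
  refine ⟨‖∑ a, φ a 0 • B a‖ + A * ∑ a, ‖B a‖, by positivity, fun x y => ?_, fun x => ?_⟩
  · exact (h1 x y).trans (by gcongr; linarith)
  · have h4 := norm_le_norm_add_norm_sub' (∑ a, φ a x • B a) (∑ a, φ a 0 • B a)
    have h5 := h1 x 0
    rw [sub_zero] at h5
    nlinarith [norm_nonneg x]

lemma exists_sum_smul_taylor (hA : 0 ≤ A) {ℓ : ι → E → E →L[ℝ] ℝ}
    (h : ∀ a x y, |φ a y - φ a x - ℓ a x (y - x)| ≤ A * ‖y - x‖ ^ 2) (hℓ : ∀ a x, ‖ℓ a x‖ ≤ A) :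
    ∃ K : ℝ, 0 ≤ K ∧ (∀ x y, ‖∑ a, φ a y • B a - ∑ a, φ a x • B a
        - (∑ a, (ℓ a x).smulRight (B a)) (y - x)‖ ≤ K * ‖y - x‖ ^ 2) ∧
      ∀ x, ‖∑ a, (ℓ a x).smulRight (B a)‖ ≤ K := by
  refine ⟨A * ∑ a, ‖B a‖, by positivity, fun x y => ?_, fun x => ?_⟩
  · have e : ∑ a, φ a y • B a - ∑ a, φ a x • B a - (∑ a, (ℓ a x).smulRight (B a)) (y - x)
        = ∑ a, (φ a y - φ a x - ℓ a x (y - x)) • B a := by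
      rw [sum_apply, ← Finset.sum_sub_distrib, ← Finset.sum_sub_distrib]
      refine Finset.sum_congr rfl fun a _ => ?_
      rw [ContinuousLinearMap.smulRight_apply, sub_smul, sub_smul]
    rw [e]
    calc _ ≤ ∑ a, ‖(φ a y - φ a x - ℓ a x (y - x)) • B a‖ := norm_sum_le _ _
      _ ≤ ∑ a, (A * ‖y - x‖ ^ 2) * ‖B a‖ := by
          refine Finset.sum_le_sum fun a _ => ?_
          rw [norm_smul]
          gcongr
          exact h a x y
      _ = _ := by rw [← Finset.mul_sum]; ring
  · calc _ ≤ ∑ a, ‖(ℓ a x).smulRight (B a)‖ := norm_sum_le _ _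
      _ ≤ ∑ a, A * ‖B a‖ := by
          refine Finset.sum_le_sum fun a _ => ?_
          rw [ContinuousLinearMap.norm_smulRight_apply]
          gcongr
          exact hℓ a x
      _ = _ := by rw [← Finset.mul_sum]

end FiniteSums

section Instantiation

variable {d D : ℕ}

/-- The data `S` represents the coefficients `f`, `g` and the matrix `R`. -/
structure Represents (S : StepData (EuclideanSpace ℝ (Fin d)) (EuclideanSpace ℝ (Fin D)))
    (f : EuclideanSpace ℝ (Fin d) → EuclideanSpace ℝ (Fin d))
    (g : EuclideanSpace ℝ (Fin d) → Matrix (Fin d) (Fin D) ℝ) (R : Matrix (Fin D) (Fin D) ℝ) :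
    Prop where
  f_eq : ∀ x, S.f x = f x
  G_apply : ∀ x v i, S.G x v i = ∑ j, g x i j * v j
  H_apply : ∀ x v v' i, S.H x v v' i = ∑ j, ∑ k, hTensor g i j k x * (v j * v' k)
  c_apply : ∀ x i, S.c x i = ∑ j, ∑ k, hTensor g i j k x * R j k

/-- Coefficients satisfying the standing assumption have a coordinate-free representation, with a
constant as large as desired. -/
lemma CoeffAssumption.exists_represents {f : EuclideanSpace ℝ (Fin d) → EuclideanSpace ℝ (Fin d)}
    {g : EuclideanSpace ℝ (Fin d) → Matrix (Fin d) (Fin D) ℝ} {L : ℝ}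
    (h : CoeffAssumption f g L) (R : Matrix (Fin D) (Fin D) ℝ) (C₀ : ℝ) :
    ∃ S : StepData (EuclideanSpace ℝ (Fin d)) (EuclideanSpace ℝ (Fin D)),
      C₀ ≤ S.C ∧ Represents S f g R := by
  have dh : ∀ i j k, Differentiable ℝ (hTensor g i j k) := by
    intro i j k
    have : ContDiff ℝ 1 (hTensor g i j k) := by
      unfold hTensor
      refine contDiff_const.mul (ContDiff.sum fun l _ => ?_)
      exact ((h.contDiff_g l k).of_le (by norm_num)).mul (contDiff_partialDeriv (h.contDiff_g i j) l)
    exact this.differentiable (by norm_num)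
  -- One constant serves for the Lipschitz bounds (`d * |L|`) and the Taylor remainders
  -- (`d * (d * |L|)`), as one factor `d` is lost for each derivative.
  set A : ℝ := d * |L| + d * (d * |L|) with hA
  have hA0 : 0 ≤ A := by positivity
  have hA1 : d * |L| ≤ A := by rw [hA]; linarith [(by positivity : 0 ≤ d * (d * |L|))]
  have hA2 : d * (d * |L|) ≤ A := by rw [hA]; linarith [(by positivity : 0 ≤ d * |L|)]
  let e : Fin d → EuclideanSpace ℝ (Fin d) := fun i => EuclideanSpace.single i 1
  let π : Fin D → EuclideanSpace ℝ (Fin D) →L[ℝ] ℝ := fun j => EuclideanSpace.proj j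
  let BG : Fin d × Fin D → EuclideanSpace ℝ (Fin D) →L[ℝ] EuclideanSpace ℝ (Fin d) :=
    fun a => (π a.2).smulRight (e a.1)
  let BH : Fin d × Fin D × Fin D →
      EuclideanSpace ℝ (Fin D) →L[ℝ] EuclideanSpace ℝ (Fin D) →L[ℝ] EuclideanSpace ℝ (Fin d) :=
    fun a => (π a.2.1).smulRight ((π a.2.2).smulRight (e a.1))
  let Bc : Fin d × Fin D × Fin D → EuclideanSpace ℝ (Fin d) := fun a => R a.2.1 a.2.2 • e a.1
  obtain ⟨K₁, hK₁, f1, f2⟩ := exists_sum_smul_lip e (φ := fun i x => f x i) hA0 fun i x y =>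
    (abs_sub_le_of_partialDeriv ((h.contDiff_f i).differentiable (by norm_num))
      (fun x l => h.deriv_f x i l) x y).trans (by gcongr)
  obtain ⟨K₂, hK₂, f3, f4⟩ := exists_sum_smul_taylor e (φ := fun i x => f x i) hA0
    (ℓ := fun i => fderiv ℝ fun x => f x i)
    (fun i x y => (abs_taylor_le_of_partialDeriv (h.contDiff_f i)
      (fun x k l => h.deriv2_f x i k l) x y).trans (by gcongr))
    (fun i x => (norm_fderiv_le_of_partialDeriv (fun x l => h.deriv_f x i l) x).trans hA1)
  obtain ⟨K₃, hK₃, g1, g2⟩ := exists_sum_smul_lip BG (φ := fun a x => g x a.1 a.2) hA0 fun a x y =>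
    (abs_sub_le_of_partialDeriv ((h.contDiff_g a.1 a.2).differentiable (by norm_num))
      (fun x l => h.deriv_g x a.1 a.2 l) x y).trans (by gcongr)
  obtain ⟨K₄, hK₄, g3, g4⟩ := exists_sum_smul_taylor BG (φ := fun a x => g x a.1 a.2) hA0
    (ℓ := fun a => fderiv ℝ fun x => g x a.1 a.2)
    (fun a x y => (abs_taylor_le_of_partialDeriv (h.contDiff_g a.1 a.2)
      (fun x k l => h.deriv2_g x a.1 a.2 k l) x y).trans (by gcongr))
    (fun a x => (norm_fderiv_le_of_partialDeriv (fun x l => h.deriv_g x a.1 a.2 l) x).trans hA1)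
  have hh : ∀ (a : Fin d × Fin D × Fin D) x y,
      |hTensor g a.1 a.2.1 a.2.2 x - hTensor g a.1 a.2.1 a.2.2 y| ≤ A * ‖x - y‖ := fun a x y =>
    (abs_sub_le_of_partialDeriv (dh _ _ _) (fun x l => h.deriv_h x a.1 a.2.1 a.2.2 l) x y).trans
      (by gcongr)
  obtain ⟨K₅, hK₅, h1, h2⟩ := exists_sum_smul_lip BH
    (φ := fun a x => hTensor g a.1 a.2.1 a.2.2 x) hA0 hh
  obtain ⟨K₆, hK₆, c1, c2⟩ := exists_sum_smul_lip Bc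
    (φ := fun a x => hTensor g a.1 a.2.1 a.2.2 x) hA0 hh
  set C : ℝ := 1 + |C₀| + K₁ + K₂ + K₃ + K₄ + K₅ + K₆ with hC
  have hC₀ := abs_nonneg C₀
  have hC1 : 1 ≤ C := by rw [hC]; linarith
  have k1 : K₁ ≤ C := by rw [hC]; linarith
  have k2 : K₂ ≤ C := by rw [hC]; linarith
  have k3 : K₃ ≤ C := by rw [hC]; linarith
  have k4 : K₄ ≤ C := by rw [hC]; linarith
  have k5 : K₅ ≤ C := by rw [hC]; linarith
  have k6 : K₆ ≤ C := by rw [hC]; linarith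
  have hf : ∀ x, ∑ i, f x i • e i = f x := by
    intro x; ext i; simp [e, Finset.sum_apply, Pi.single_apply]
  have hG : ∀ x v i, (∑ a : Fin d × Fin D, g x a.1 a.2 • BG a) v i = ∑ j, g x i j * v j := by
    intro x v i
    simp [BG, e, π, Fintype.sum_prod_type, Pi.single_apply]
  have hH : ∀ x v v' i, (∑ a : Fin d × Fin D × Fin D, hTensor g a.1 a.2.1 a.2.2 x • BH a) v v' i
      = ∑ j, ∑ k, hTensor g i j k x * (v j * v' k) := by
    intro x v v' i
    simp [BH, e, π, Fintype.sum_prod_type, Pi.single_apply]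
  have hc : ∀ x i, (∑ a : Fin d × Fin D × Fin D, hTensor g a.1 a.2.1 a.2.2 x • Bc a) i
      = ∑ j, ∑ k, hTensor g i j k x * R j k := by
    intro x i
    simp [Bc, e, Fintype.sum_prod_type, Pi.single_apply]
  refine ⟨{ f := fun x => ∑ i, f x i • e i
            f' := fun x => ∑ i, (fderiv ℝ (fun x => f x i) x).smulRight (e i)
            G := fun x => ∑ a : Fin d × Fin D, g x a.1 a.2 • BG a
            G' := fun x => ∑ a : Fin d × Fin D, (fderiv ℝ (fun x => g x a.1 a.2) x).smulRight (BG a)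
            H := fun x => ∑ a : Fin d × Fin D × Fin D, hTensor g a.1 a.2.1 a.2.2 x • BH a
            c := fun x => ∑ a : Fin d × Fin D × Fin D, hTensor g a.1 a.2.1 a.2.2 x • Bc a
            C := C
            one_le_C := hC1
            f_growth := fun x => (f2 x).trans (by gcongr)
            G_growth := fun x => (g2 x).trans (by gcongr)
            H_growth := fun x => (h2 x).trans (by gcongr)
            c_growth := fun x => (c2 x).trans (by gcongr)
            f_lip := fun x y => (f1 x y).trans (by gcongr)
            G_lip := fun x y => (g1 x y).trans (by gcongr)
            H_lip := fun x y => (h1 x y).trans (by gcongr)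
            c_lip := fun x y => (c1 x y).trans (by gcongr)
            f_taylor := fun x y => (f3 x y).trans (by gcongr)
            G_taylor := fun x y => (g3 x y).trans (by gcongr)
            f'_le := fun x => (f4 x).trans k2
            G'_le := fun x => (g4 x).trans k4
            G'_apply_G := ?_ }, ?_, ⟨hf, hG, hH, hc⟩⟩
  · intro x v v'
    ext i
    have key : ∀ u, (∑ a : Fin d × Fin D, (fderiv ℝ (fun x => g x a.1 a.2) x).smulRight (BG a)) u v' i
        = ∑ j, fderiv ℝ (fun x => g x i j) x u * v' j := by
      intro u
      simp [BG, e, π, Fintype.sum_prod_type, Pi.single_apply]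
    rw [PiLp.smul_apply, hH, key, smul_eq_mul]
    simp only [fderiv_apply_eq_sum, hTensor]
    simp_rw [hG]
    rw [Finset.mul_sum]
    refine Finset.sum_congr rfl fun j _ => ?_
    simp only [Finset.sum_mul, Finset.mul_sum]
    rw [Finset.sum_comm]
    refine Finset.sum_congr rfl fun k _ => Finset.sum_congr rfl fun l _ => ?_
    ring
  · change C₀ ≤ C
    rw [hC]
    linarith [le_abs_self C₀]

variable {S : StepData (EuclideanSpace ℝ (Fin d)) (EuclideanSpace ℝ (Fin D))}
  {f : EuclideanSpace ℝ (Fin d) → EuclideanSpace ℝ (Fin d)}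
  {g : EuclideanSpace ℝ (Fin d) → Matrix (Fin d) (Fin D) ℝ} {R : Matrix (Fin D) (Fin D) ℝ}

lemma Represents.milsteinStep_fine (h : Represents S f g R) (s : ℝ) (x : EuclideanSpace ℝ (Fin d))
    (v : EuclideanSpace ℝ (Fin D)) : milsteinStep f g R (s ^ 2) x (s • v) = S.step s x v := by
  ext i
  simp only [milsteinStep, StepData.step, PiLp.add_apply, PiLp.smul_apply, PiLp.sub_apply,
    h.f_eq, h.G_apply, h.H_apply, h.c_apply, smul_eq_mul, Finset.mul_sum, mul_sub,
    Finset.sum_sub_distrib]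
  have e1 : ∀ j, g x i j * (s * v j) = s * (g x i j * v j) := fun j => by ring
  have e2 : ∀ j k, hTensor g i j k x * (s * v j * (s * v k))
      = s ^ 2 * (hTensor g i j k x * (v j * v k)) := fun j k => by ring
  have e3 : ∀ j k, hTensor g i j k x * (R j k * s ^ 2)
      = s ^ 2 * (hTensor g i j k x * R j k) := fun j k => by ring
  simp only [e1, e2, e3]
  ring

lemma Represents.milsteinStep_coarse (h : Represents S f g R) (s : ℝ)
    (x : EuclideanSpace ℝ (Fin d)) (v v' : EuclideanSpace ℝ (Fin D)) :
    milsteinStep f g R (2 * s ^ 2) x (s • (v + v')) = S.coarseStep s x v v' := by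
  ext i
  simp only [milsteinStep, StepData.coarseStep, PiLp.add_apply, PiLp.smul_apply, PiLp.sub_apply,
    h.f_eq, h.G_apply, h.H_apply, h.c_apply, smul_eq_mul, Finset.mul_sum, mul_sub,
    Finset.sum_sub_distrib]
  have e1 : ∀ j, g x i j * (s * (v j + v' j)) = s * (g x i j * (v j + v' j)) := fun j => by ring
  have e2 : ∀ j k, hTensor g i j k x * (s * (v j + v' j) * (s * (v k + v' k)))
      = s ^ 2 * (hTensor g i j k x * ((v j + v' j) * (v k + v' k))) := fun j k => by ring
  have e3 : ∀ j k, hTensor g i j k x * (R j k * (2 * s ^ 2))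
      = s ^ 2 * (2 * (hTensor g i j k x * R j k)) := fun j k => by ring
  simp only [e1, e2, e3]
  ring

/-- The centred Gaussian vector with covariance `R` fits the coefficients. -/
lemma Represents.isNoise (h : Represents S f g R) (hR : R.PosSemidef) :
    S.IsNoise (multivariateGaussian 0 R) := by
  have hL : ∀ n : ℕ, MemLp id n (multivariateGaussian (0 : EuclideanSpace ℝ (Fin D)) R) :=
    fun n => IsGaussian.memLp_id _ _ (ENNReal.natCast_ne_top n)
  refine ⟨hL, by simp, fun x => ?_⟩
  have hj : ∀ j, MemLp (fun v : EuclideanSpace ℝ (Fin D) => v j) 2 (multivariateGaussian 0 R) :=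
    fun j => (EuclideanSpace.proj (𝕜 := ℝ) j : EuclideanSpace ℝ (Fin D) →L[ℝ] ℝ).comp_memLp'
      (hL 2)
  have hmean : ∀ j, ∫ v : EuclideanSpace ℝ (Fin D), v j ∂(multivariateGaussian 0 R) = 0 := by
    intro j
    have := (EuclideanSpace.proj (𝕜 := ℝ) j : EuclideanSpace ℝ (Fin D) →L[ℝ] ℝ).integral_comp_comm
      (μ := multivariateGaussian 0 R) (φ := fun v => v) IsGaussian.integrable_fun_id
    simpa using this
  have hint : ∀ j k, Integrable (fun v : EuclideanSpace ℝ (Fin D) => v j * v k)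
      (multivariateGaussian 0 R) := fun j k => (hj j).integrable_mul (hj k)
  have hcov : ∀ j k, ∫ v : EuclideanSpace ℝ (Fin D), v j * v k ∂(multivariateGaussian 0 R)
      = R j k := by
    intro j k
    have := covariance_eval_multivariateGaussian (μ := 0) hR j k
    rw [covariance_eq_sub (hj j) (hj k), hmean, hmean] at this
    simpa using this
  have hq : Integrable (fun v => S.H x v v) (multivariateGaussian 0 R) := by
    have h2 : Integrable (fun v : EuclideanSpace ℝ (Fin D) => ‖v‖ ^ 2)
        (multivariateGaussian 0 R) := by
      have := (hL 2).integrable_norm_pow (by norm_num)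
      simpa using this
    refine (h2.const_mul ‖S.H x‖).mono'
      (by fun_prop : Continuous fun v => S.H x v v).aestronglyMeasurable
      (Filter.Eventually.of_forall fun v => ?_)
    calc ‖S.H x v v‖ ≤ ‖S.H x‖ * ‖v‖ * ‖v‖ := (S.H x).le_opNorm₂ v v
      _ = _ := by ring
  ext i
  have e1 := (EuclideanSpace.proj (𝕜 := ℝ) i :
    EuclideanSpace ℝ (Fin d) →L[ℝ] ℝ).integral_comp_comm hq
  simp only [PiLp.proj_apply, h.H_apply] at e1
  rw [← e1, h.c_apply, integral_finsetSum _ fun j _ => integrable_finsetSum _ fun k _ =>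
    (hint j k).const_mul _]
  refine Finset.sum_congr rfl fun j _ => ?_
  rw [integral_finsetSum _ fun k _ => (hint j k).const_mul _]
  refine Finset.sum_congr rfl fun k _ => ?_
  rw [integral_const_mul, hcov]

end Instantiation

/-! ### Piecewise linear interpolation as a convex combination of grid values -/

/-- The weight of the `k`-th grid value in the piecewise linear interpolant at time `t`. -/
def hat (δ : ℝ) (k : ℕ) (t : ℝ) : ℝ :=
  (if k = ⌊t / δ⌋₊ then 1 - (t - ⌊t / δ⌋₊ * δ) / δ else 0)
    + (if k = ⌊t / δ⌋₊ + 1 then (t - ⌊t / δ⌋₊ * δ) / δ else 0)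

lemma interp_weight_mem {δ t : ℝ} (hδ : 0 < δ) (ht : 0 ≤ t) :
    0 ≤ (t - ⌊t / δ⌋₊ * δ) / δ ∧ (t - ⌊t / δ⌋₊ * δ) / δ ≤ 1 := by
  have h1 := Nat.floor_le (div_nonneg ht hδ.le)
  have h2 := (Nat.lt_floor_add_one (t / δ)).le
  have e : (t - ⌊t / δ⌋₊ * δ) / δ = t / δ - ⌊t / δ⌋₊ := by field_simp
  rw [e]
  constructor <;> linarith

lemma hat_nonneg {δ t : ℝ} (hδ : 0 < δ) (ht : 0 ≤ t) (k : ℕ) : 0 ≤ hat δ k t := by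
  obtain ⟨h1, h2⟩ := interp_weight_mem hδ ht
  unfold hat
  refine add_nonneg ?_ ?_ <;> split_ifs <;> linarith

lemma floor_div_le {δ t : ℝ} {M : ℕ} (hδ : 0 < δ) (htM : t ≤ M * δ) : ⌊t / δ⌋₊ ≤ M :=
  Nat.floor_le_of_le ((div_le_iff₀ hδ).2 htM)

lemma sum_hat {δ t : ℝ} {M : ℕ} (hδ : 0 < δ) (htM : t ≤ M * δ) :
    ∑ k ∈ Finset.range (M + 2), hat δ k t = 1 := by
  have hM := floor_div_le hδ htM
  unfold hat
  rw [Finset.sum_add_distrib, Finset.sum_ite_eq', Finset.sum_ite_eq',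
    if_pos (Finset.mem_range.2 (by omega)), if_pos (Finset.mem_range.2 (by omega))]
  ring

lemma interp_eq_sum {d : ℕ} {δ t : ℝ} {M : ℕ} (hδ : 0 < δ) (htM : t ≤ M * δ)
    (X : ℕ → EuclideanSpace ℝ (Fin d)) :
    interp δ X t = ∑ k ∈ Finset.range (M + 2), hat δ k t • X k := by
  have hM := floor_div_le hδ htM
  unfold hat
  simp only [add_smul, ite_smul, zero_smul]
  rw [Finset.sum_add_distrib, Finset.sum_ite_eq', Finset.sum_ite_eq',
    if_pos (Finset.mem_range.2 (by omega)), if_pos (Finset.mem_range.2 (by omega))]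
  rfl

lemma measurable_hat (δ : ℝ) (k : ℕ) : Measurable (hat δ k) := by
  have h1 : Measurable fun t : ℝ => ⌊t / δ⌋₊ := Nat.measurable_floor.comp (by fun_prop)
  have h2 : Measurable fun t : ℝ => (⌊t / δ⌋₊ : ℝ) := measurable_from_top.comp h1
  unfold hat
  refine Measurable.add (Measurable.ite ?_ (by fun_prop) measurable_const)
    (Measurable.ite ?_ (by fun_prop) measurable_const)
  · exact measurableSet_eq_fun measurable_const h1
  · exact measurableSet_eq_fun measurable_const (h1.add_const 1)

lemma intervalIntegrable_hat {δ : ℝ} (hδ : 0 < δ) (k : ℕ) {T : ℝ} (hT : 0 ≤ T) :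
    IntervalIntegrable (hat δ k) volume 0 T := by
  rw [intervalIntegrable_iff_integrableOn_Ioc_of_le hT]
  refine Measure.integrableOn_of_bounded (M := 2) (by simp)
    (measurable_hat δ k).aestronglyMeasurable ?_
  refine (ae_restrict_iff' measurableSet_Ioc).2 (Filter.Eventually.of_forall fun t ht => ?_)
  obtain ⟨h1, h2⟩ := interp_weight_mem hδ ht.1.le
  rw [Real.norm_of_nonneg (hat_nonneg hδ ht.1.le k)]
  unfold hat
  split_ifs <;> linarith

/-- The values at the fine grid points of the linear interpolant of a sequence on the coarse
grid. -/
def midpoints {E : Type*} [AddCommGroup E] [Module ℝ E] (X : ℕ → E) (k : ℕ) : E :=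
  if Even k then X (k / 2) else (1 / 2 : ℝ) • (X (k / 2) + X (k / 2 + 1))

/-- The interpolant on the coarse grid is also an interpolant on the fine grid. -/
lemma interp_two_mul {d : ℕ} {δ t : ℝ} (hδ : 0 < δ) (ht : 0 ≤ t)
    (X : ℕ → EuclideanSpace ℝ (Fin d)) : interp (2 * δ) X t = interp δ (midpoints X) t := by
  have h0 : 0 ≤ t / (2 * δ) := by positivity
  set n := ⌊t / (2 * δ)⌋₊ with hn
  have h1 := Nat.floor_le h0
  have h2 := Nat.lt_floor_add_one (t / (2 * δ))
  rw [← hn] at h1 h2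
  set θ := t / (2 * δ) - n with hθ
  have e1 : (t - n * (2 * δ)) / (2 * δ) = θ := by rw [hθ]; field_simp
  have e2 : t / δ = 2 * (n + θ) := by rw [hθ]; field_simp; ring
  have lhs : interp (2 * δ) X t = (1 - θ) • X n + θ • X (n + 1) := by
    rw [interp, ← hn, e1]
  rw [lhs, interp]
  have e3 : ∀ k : ℕ, (t - k * δ) / δ = 2 * (n + θ) - k := fun k => by rw [← e2]; field_simp
  by_cases hhalf : θ < 1 / 2
  · have hfl : ⌊t / δ⌋₊ = 2 * n := by
      rw [e2, Nat.floor_eq_iff (by linarith)]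
      push_cast
      constructor <;> linarith
    have m1 : midpoints X (2 * n) = X n := by simp [midpoints]
    have m2 : midpoints X (2 * n + 1) = (1 / 2 : ℝ) • (X n + X (n + 1)) := by
      rw [midpoints, if_neg (Nat.not_even_bit1 n), show (2 * n + 1) / 2 = n by omega]
    rw [hfl, m1, m2, e3]
    push_cast
    module
  · have hfl : ⌊t / δ⌋₊ = 2 * n + 1 := by
      rw [e2, Nat.floor_eq_iff (by linarith)]
      push_cast
      constructor <;> linarith
    have m1 : midpoints X (2 * n + 1 + 1) = X (n + 1) := by
      rw [show 2 * n + 1 + 1 = 2 * (n + 1) by ring]; simp [midpoints]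
    have m2 : midpoints X (2 * n + 1) = (1 / 2 : ℝ) • (X n + X (n + 1)) := by
      rw [midpoints, if_neg (Nat.not_even_bit1 n), show (2 * n + 1) / 2 = n by omega]
    rw [hfl, m1, m2, e3]
    push_cast
    module

/-- The weight of the `k`-th grid value in the time average of the interpolant. -/
def avgWeight (δ T : ℝ) (k : ℕ) : ℝ := T⁻¹ * ∫ t in (0 : ℝ)..T, hat δ k t

lemma avgWeight_nonneg {δ T : ℝ} (hδ : 0 < δ) (hT : 0 ≤ T) (k : ℕ) : 0 ≤ avgWeight δ T k :=
  mul_nonneg (inv_nonneg.2 hT)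
    (intervalIntegral.integral_nonneg hT fun _ ht => hat_nonneg hδ ht.1 k)

lemma sum_avgWeight {δ T : ℝ} {M : ℕ} (hδ : 0 < δ) (hT : 0 < T) (hTM : T ≤ M * δ) :
    ∑ k ∈ Finset.range (M + 2), avgWeight δ T k = 1 := by
  unfold avgWeight
  rw [← Finset.mul_sum, ← intervalIntegral.integral_finsetSum
    fun k _ => intervalIntegrable_hat hδ k hT.le]
  have : ∫ t in (0 : ℝ)..T, ∑ k ∈ Finset.range (M + 2), hat δ k t = ∫ _t in (0 : ℝ)..T, (1 : ℝ) :=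
    intervalIntegral.integral_congr fun t ht => by
      rw [Set.uIcc_of_le hT.le] at ht
      exact sum_hat hδ (ht.2.trans hTM)
  rw [this]
  simp [hT.ne']

lemma average_interp_eq_sum {d : ℕ} {δ T : ℝ} {M : ℕ} (hδ : 0 < δ) (hT : 0 ≤ T)
    (hTM : T ≤ M * δ) (X : ℕ → EuclideanSpace ℝ (Fin d)) :
    T⁻¹ • ∫ t in (0 : ℝ)..T, interp δ X t
      = ∑ k ∈ Finset.range (M + 2), avgWeight δ T k • X k := by
  have : ∫ t in (0 : ℝ)..T, interp δ X t
      = ∫ t in (0 : ℝ)..T, ∑ k ∈ Finset.range (M + 2), hat δ k t • X k :=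
    intervalIntegral.integral_congr fun t ht => by
      rw [Set.uIcc_of_le hT] at ht
      exact interp_eq_sum hδ (ht.2.trans hTM) X
  rw [this, intervalIntegral.integral_finsetSum fun k _ =>
    ⟨(intervalIntegrable_hat hδ k hT).1.smul_const _, (intervalIntegrable_hat hδ k hT).2.smul_const _⟩,
    Finset.smul_sum]
  refine Finset.sum_congr rfl fun k _ => ?_
  rw [intervalIntegral.integral_smul_const, smul_smul, avgWeight]

/-! ### From grid moments to convex combinations and to real exponents -/

section Moments

variable {Ω : Type*} [MeasurableSpace Ω] {P : Measure Ω}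
  {E : Type*} [NormedAddCommGroup E] [NormedSpace ℝ E] [MeasurableSpace E] [BorelSpace E]

/-- Jensen's inequality for a convex combination. -/
lemma expLE_sum_smul {ι : Type*} {I : Finset ι} {c : ι → ℝ} (hc : ∀ k ∈ I, 0 ≤ c k)
    (hc1 : ∑ k ∈ I, c k = 1) {Y : ι → Ω → E} (hY : ∀ k ∈ I, Measurable (Y k)) {q : ℕ} {a : ℝ}
    (h : ∀ k ∈ I, ExpLE P (fun ω => ‖Y k ω‖ ^ q) a) :
    ExpLE P (fun ω => ‖∑ k ∈ I, c k • Y k ω‖ ^ q) a := by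
  have h1 : ∀ ω, ‖∑ k ∈ I, c k • Y k ω‖ ^ q ≤ ∑ k ∈ I, c k * ‖Y k ω‖ ^ q := by
    intro ω
    calc _ ≤ (∑ k ∈ I, c k * ‖Y k ω‖) ^ q := by
          gcongr
          refine (norm_sum_le _ _).trans (Finset.sum_le_sum fun k hk => ?_)
          rw [norm_smul, Real.norm_of_nonneg (hc k hk)]
      _ ≤ _ := Real.pow_arith_mean_le_arith_mean_pow I c _ hc hc1 (fun _ _ => norm_nonneg _) q
  refine ExpLE.mono (v := fun ω => ∑ k ∈ I, c k * ‖Y k ω‖ ^ q) ?_ h1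
  unfold ExpLE at *
  calc ∫⁻ ω, ENNReal.ofReal (∑ k ∈ I, c k * ‖Y k ω‖ ^ q) ∂P
      = ∫⁻ ω, ∑ k ∈ I, ENNReal.ofReal (c k) * ENNReal.ofReal (‖Y k ω‖ ^ q) ∂P := by
        refine lintegral_congr fun ω => ?_
        rw [ENNReal.ofReal_sum_of_nonneg fun k hk => mul_nonneg (hc k hk) (by positivity)]
        exact Finset.sum_congr rfl fun k hk => ENNReal.ofReal_mul (hc k hk)
    _ = ∑ k ∈ I, ∫⁻ ω, ENNReal.ofReal (c k) * ENNReal.ofReal (‖Y k ω‖ ^ q) ∂P :=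
        lintegral_finsetSum' _ fun k hk =>
          (((hY k hk).norm.pow_const q).ennreal_ofReal.const_mul _).aemeasurable
    _ ≤ ∑ k ∈ I, ENNReal.ofReal (c k) * ENNReal.ofReal a := by
        refine Finset.sum_le_sum fun k hk => ?_
        rw [lintegral_const_mul' _ _ ENNReal.ofReal_ne_top]
        gcongr
        exact h k hk
    _ = ENNReal.ofReal a := by
        rw [← Finset.sum_mul, ← ENNReal.ofReal_sum_of_nonneg hc, hc1, ENNReal.ofReal_one, one_mul]

/-- Lyapunov's inequality: a bound on the moment of integer order `q` bounds all lower real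
moments. -/
lemma lintegral_enorm_rpow_le [IsProbabilityMeasure P] {Y : Ω → E} (hY : AEStronglyMeasurable Y P)
    {q : ℕ} {p a : ℝ} (hp : 0 < p) (hpq : p ≤ q) (ha : 0 ≤ a)
    (h : ExpLE P (fun ω => ‖Y ω‖ ^ q) a) :
    ∫⁻ ω, ‖Y ω‖ₑ ^ p ∂P ≤ ENNReal.ofReal (a ^ (p / q)) := by
  have hq : (0 : ℝ) < q := hp.trans_le hpq
  have h1 := eLpNorm'_le_eLpNorm'_of_exponent_le hp hpq P hY
  unfold eLpNorm' at h1
  have h2 : ∫⁻ ω, ‖Y ω‖ₑ ^ (q : ℝ) ∂P ≤ ENNReal.ofReal a := by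
    refine le_of_eq_of_le (lintegral_congr fun ω => ?_) h
    rw [← ofReal_norm, ENNReal.rpow_natCast, ENNReal.ofReal_pow (norm_nonneg _)]
  calc ∫⁻ ω, ‖Y ω‖ₑ ^ p ∂P = ((∫⁻ ω, ‖Y ω‖ₑ ^ p ∂P) ^ (1 / p)) ^ p := by
        rw [← ENNReal.rpow_mul, one_div_mul_cancel hp.ne', ENNReal.rpow_one]
    _ ≤ ((∫⁻ ω, ‖Y ω‖ₑ ^ (q : ℝ) ∂P) ^ (1 / (q : ℝ))) ^ p := by gcongr
    _ ≤ (ENNReal.ofReal a ^ (1 / (q : ℝ))) ^ p := by gcongr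
    _ = ENNReal.ofReal (a ^ (p / q)) := by
        rw [← ENNReal.rpow_mul, ENNReal.ofReal_rpow_of_nonneg ha (by positivity)]
        congr 2
        ring

end Moments

/-! ### Normalised Brownian increments -/

section Brownian

variable {D : ℕ}

lemma multivariateGaussian_map_smul {R : Matrix (Fin D) (Fin D) ℝ} (hR : R.PosSemidef) {s : ℝ}
    (hs : 0 < s) :
    (multivariateGaussian (0 : EuclideanSpace ℝ (Fin D)) (s ^ 2 • R)).map (fun v => s⁻¹ • v)
      = multivariateGaussian 0 R := by
  have hR' : (s ^ 2 • R).PosSemidef := hR.smul (by positivity)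
  have : IsProbabilityMeasure ((multivariateGaussian (0 : EuclideanSpace ℝ (Fin D))
      (s ^ 2 • R)).map (fun v => s⁻¹ • v)) :=
    Measure.isProbabilityMeasure_map (by fun_prop)
  refine Measure.ext_of_charFun (funext fun x => ?_)
  rw [charFun_map_smul, charFun_multivariateGaussian hR', charFun_multivariateGaussian hR]
  congr 3
  · simp
  · simp [Matrix.smul_mulVec, Matrix.mulVec_smul]
    have hs' : (s : ℂ) ≠ 0 := by exact_mod_cast hs.ne'
    field_simp

variable {Ω : Type*} [MeasurableSpace Ω] {P : Measure Ω} [IsProbabilityMeasure P]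
  {w : ℝ≥0 → Ω → EuclideanSpace ℝ (Fin D)} {R : Matrix (Fin D) (Fin D) ℝ}

/-- The increments of a Brownian motion on a uniform grid are, up to a null set and a scaling,
an independent sequence of centred Gaussian vectors with covariance `R`. -/
lemma IsBrownianMotion.exists_isIID (hw : IsBrownianMotion w R P) (hR : R.PosSemidef) {δ : ℝ≥0}
    {s : ℝ} (hs : 0 < s) (hδ : (δ : ℝ) = s ^ 2) :
    ∃ ζ : ℕ → Ω → EuclideanSpace ℝ (Fin D), IsIID ζ (multivariateGaussian 0 R) P ∧
      ∀ᵐ ω ∂P, ∀ m, increment w δ ω m = s • ζ m ω := by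
  have hmono : Monotone fun m : ℕ => (m : ℝ≥0) * δ := fun a b hab => by
    dsimp only; gcongr
  have hlaw : ∀ m, HasLaw (fun ω => increment w δ ω m) (multivariateGaussian 0 (s ^ 2 • R)) P := by
    intro m
    have := hw.law _ _ (hmono (Nat.le_succ m))
    have e : (((((m.succ : ℕ) : ℝ≥0) * δ : ℝ≥0) : ℝ) - (((m : ℝ≥0) * δ : ℝ≥0) : ℝ)) = s ^ 2 := by
      rw [← hδ]; push_cast; ring
    rwa [e] at this
  have hind : iIndepFun (fun m ω => increment w δ ω m) P := hw.indep.nat hmono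
  have hind' : iIndepFun (fun m ω => s⁻¹ • increment w δ ω m) P :=
    hind.comp (fun _ v => s⁻¹ • v) fun _ => by fun_prop
  have hae : ∀ m, AEMeasurable (fun ω => s⁻¹ • increment w δ ω m) P :=
    fun m => (measurable_const_smul s⁻¹).comp_aemeasurable (hlaw m).aemeasurable
  -- The increments have a law, hence are only almost everywhere measurable: measurable versions.
  refine ⟨fun m => (hae m).mk _, ⟨fun m => (hae m).measurable_mk,
    (iIndepFun_congr fun m => (hae m).ae_eq_mk).1 hind', fun m => ?_⟩, ?_⟩
  · rw [← Measure.map_congr (hae m).ae_eq_mk, ← multivariateGaussian_map_smul hR hs,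
      ← (hlaw m).map_eq, AEMeasurable.map_map_of_aemeasurable (by fun_prop) (hlaw m).aemeasurable]
    rfl
  · rw [ae_all_iff]
    intro m
    filter_upwards [(hae m).ae_eq_mk] with ω hω
    rw [← hω, smul_smul, mul_inv_cancel₀ hs.ne', one_smul]

variable {d : ℕ} {S : StepData (EuclideanSpace ℝ (Fin d)) (EuclideanSpace ℝ (Fin D))}
  {f : EuclideanSpace ℝ (Fin d) → EuclideanSpace ℝ (Fin d)}
  {g : EuclideanSpace ℝ (Fin d) → Matrix (Fin d) (Fin D) ℝ}

lemma Represents.milsteinPath_eq_path (h : Represents S f g R) {δ s : ℝ} (hδ : δ = s ^ 2)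
    (x₀ : EuclideanSpace ℝ (Fin d)) {dw ξ : ℕ → EuclideanSpace ℝ (Fin D)}
    (hdw : ∀ m, dw m = s • ξ m) (n : ℕ) :
    milsteinPath f g R x₀ δ dw n = S.path s x₀ ξ n := by
  induction n with
  | zero => rfl
  | succ n ih => rw [milsteinPath, StepData.path, ih, hδ, hdw, h.milsteinStep_fine]

lemma Represents.milsteinPath_eq_coarse (h : Represents S f g R) {δ s : ℝ} (hδ : δ = 2 * s ^ 2)
    (x₀ : EuclideanSpace ℝ (Fin d)) {dw ξ : ℕ → EuclideanSpace ℝ (Fin D)}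
    (hdw : ∀ n, dw n = s • (ξ (2 * n) + ξ (2 * n + 1))) (n : ℕ) :
    milsteinPath f g R x₀ δ dw n = S.coarse s x₀ ξ n := by
  induction n with
  | zero => rfl
  | succ n ih => rw [milsteinPath, StepData.coarse, ih, hδ, hdw, h.milsteinStep_coarse]

omit [MeasurableSpace Ω] in
lemma increment_two_mul (w : ℝ≥0 → Ω → EuclideanSpace ℝ (Fin D)) (δ : ℝ≥0) (ω : Ω) (n : ℕ) :
    increment w (2 * δ) ω n = increment w δ ω (2 * n) + increment w δ ω (2 * n + 1) := by
  unfold increment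
  have e1 : ((n + 1 : ℕ) : ℝ≥0) * (2 * δ) = ((2 * n + 1 + 1 : ℕ) : ℝ≥0) * δ := by push_cast; ring
  have e2 : ((n : ℕ) : ℝ≥0) * (2 * δ) = ((2 * n : ℕ) : ℝ≥0) * δ := by push_cast; ring
  rw [e1, e2]
  abel

end Brownian

/-! ### Moments of the interpolated paths and of the payoff -/

section Interpolated

variable {d D : ℕ} {Ω : Type*} [MeasurableSpace Ω] {P : Measure Ω} [IsProbabilityMeasure P]
  {S : StepData (EuclideanSpace ℝ (Fin d)) (EuclideanSpace ℝ (Fin D))}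
  {f : EuclideanSpace ℝ (Fin d) → EuclideanSpace ℝ (Fin d)}
  {g : EuclideanSpace ℝ (Fin d) → Matrix (Fin d) (Fin D) ℝ} {R : Matrix (Fin D) (Fin D) ℝ}
  {w : ℝ≥0 → Ω → EuclideanSpace ℝ (Fin D)}

/-- Almost surely, the three interpolated paths are interpolants on the fine grid, of step
`s ^ 2`, of coordinate-free paths driven by one normalised noise sequence. -/
lemma Represents.exists_noise (h : Represents S f g R) (hR : R.PosSemidef)
    (hw : IsBrownianMotion w R P) (x₀ : EuclideanSpace ℝ (Fin d)) {T : ℝ≥0} (hT : 0 < T) {N : ℕ}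
    (hN : 0 < N) :
    ∃ (s : ℝ) (ζ : ℕ → Ω → EuclideanSpace ℝ (Fin D)), 0 < s ∧ 2 * s ^ 2 = (T : ℝ) / N ∧
      IsIID ζ (multivariateGaussian 0 R) P ∧ ∀ᵐ ω ∂P, ∀ t : ℝ, 0 ≤ t →
        finePath f g R x₀ w T N t ω = interp (s ^ 2) (S.path s x₀ fun m => ζ m ω) t ∧
        antitheticPath f g R x₀ w T N t ω = interp (s ^ 2) (S.antiPath s x₀ fun m => ζ m ω) t ∧
        coarsePath f g R x₀ w T N t ω
          = interp (s ^ 2) (midpoints (S.coarse s x₀ fun m => ζ m ω)) t := by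
  have hN' : (0 : ℝ) < N := by exact_mod_cast hN
  have hT' : (0 : ℝ) < T := hT
  set δ : ℝ≥0 := T / (2 * N) with hδ
  have hδr : (δ : ℝ) = T / (2 * N) := by rw [hδ]; push_cast; rfl
  have hδ0 : (0 : ℝ) < δ := by rw [hδr]; positivity
  set s := Real.sqrt δ with hs
  have hs0 : 0 < s := Real.sqrt_pos.2 hδ0
  have hs2 : (δ : ℝ) = s ^ 2 := (Real.sq_sqrt hδ0.le).symm
  obtain ⟨ζ, hζ, hae⟩ := hw.exists_isIID hR hs0 hs2
  have hcoarse : T / (N : ℝ≥0) = 2 * δ := by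
    rw [hδ]
    have : (N : ℝ≥0) ≠ 0 := by exact_mod_cast hN.ne'
    field_simp
  have hcoarse' : ((2 * δ : ℝ≥0) : ℝ) = 2 * s ^ 2 := by push_cast; rw [hs2]
  refine ⟨s, ζ, hs0, ?_, hζ, ?_⟩
  · rw [← hs2, hδr]; field_simp
  filter_upwards [hae] with ω hω t ht
  refine ⟨?_, ?_, ?_⟩
  · rw [finePath, ← hδ, funext fun n => h.milsteinPath_eq_path hs2 x₀ hω n, hs2]
  · rw [antitheticPath, ← hδ, funext fun n => h.milsteinPath_eq_path
      (ξ := fun m => ζ (swapHalves m) ω) hs2 x₀ (fun m => hω _) n, hs2]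
    rfl
  · have hd : ∀ n, increment w (2 * δ) ω n = s • (ζ (2 * n) ω + ζ (2 * n + 1) ω) := fun n => by
      rw [increment_two_mul, hω, hω, smul_add]
    rw [coarsePath, hcoarse, funext fun n => h.milsteinPath_eq_coarse
      (ξ := fun m => ζ m ω) hcoarse' x₀ hd n, hcoarse', interp_two_mul (by positivity) ht]

lemma mul_pow_rpow_div {K x p : ℝ} (hK : 0 ≤ K) (hx : 0 ≤ x) {q : ℕ} (hq : 0 < q) :
    (K * x ^ q) ^ (p / q) = K ^ (p / q) * x ^ p := by
  have hq' : (q : ℝ) ≠ 0 := by exact_mod_cast hq.ne'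
  rw [Real.mul_rpow hK (by positivity), ← Real.rpow_natCast, ← Real.rpow_mul hx,
    mul_div_cancel₀ _ hq']

lemma measurable_sum_smul {ι : Type*} (I : Finset ι) (c : ι → ℝ)
    {Y : ι → Ω → EuclideanSpace ℝ (Fin d)} (hY : ∀ k, Measurable (Y k)) :
    Measurable fun ω => ∑ k ∈ I, c k • Y k ω :=
  Finset.measurable_fun_sum I fun k _ => (measurable_const_smul (c k)).comp (hY k)

lemma lintegral_enorm_sum_smul_rpow_le {ι : Type*} {I : Finset ι} {c : ι → ℝ}
    (hc : ∀ k ∈ I, 0 ≤ c k) (hc1 : ∑ k ∈ I, c k = 1) {Y : ι → Ω → EuclideanSpace ℝ (Fin d)}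
    (hY : ∀ k, Measurable (Y k)) {q : ℕ} {p K x : ℝ} (hp : 0 < p) (hpq : p ≤ q) (hK : 0 ≤ K)
    (hx : 0 ≤ x) (h : ∀ k ∈ I, ExpLE P (fun ω => ‖Y k ω‖ ^ q) (K * x ^ q)) :
    ∫⁻ ω, ‖∑ k ∈ I, c k • Y k ω‖ₑ ^ p ∂P ≤ ENNReal.ofReal (K ^ (p / q) * x ^ p) := by
  have hq : 0 < q := by exact_mod_cast hp.trans_le hpq
  rw [← mul_pow_rpow_div hK hx hq]
  exact lintegral_enorm_rpow_le (measurable_sum_smul I c hY).aestronglyMeasurable hp hpq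
    (by positivity) (expLE_sum_smul hc hc1 (fun k _ => hY k) h)

lemma measurable_midpoints_coarse (S : StepData (EuclideanSpace ℝ (Fin d)) (EuclideanSpace ℝ (Fin D)))
    (s : ℝ) (x₀ : EuclideanSpace ℝ (Fin d)) {ζ : ℕ → Ω → EuclideanSpace ℝ (Fin D)}
    (hζ : ∀ i, Measurable (ζ i)) (k : ℕ) :
    Measurable fun ω => midpoints (S.coarse s x₀ fun m => ζ m ω) k := by
  have mc := fun k => S.measurable_coarse s x₀ k fun i _ => hζ i
  unfold midpoints
  split_ifs
  · exact mc _
  · exact ((mc _).add (mc _)).const_smul (1 / 2 : ℝ)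

/-- The step size bounds: the normalised step stays below the constant of the scheme, and the time
horizon is exactly `2 N` fine steps. -/
lemma step_size_bounds {T s : ℝ} {N : ℕ} (hT : 0 < T) (hN : 0 < N) (hs2 : 2 * s ^ 2 = T / N) :
    s ≤ Real.sqrt T ∧ 2 * N * s ^ 2 = T := by
  have hN' : (1 : ℝ) ≤ N := by exact_mod_cast hN
  have h1 : 2 * N * s ^ 2 = T := by
    calc 2 * N * s ^ 2 = N * (2 * s ^ 2) := by ring
      _ = T := by rw [hs2]; field_simp
  refine ⟨Real.le_sqrt_of_sq_le ?_, h1⟩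
  nlinarith [sq_nonneg s]

variable (x₀ : EuclideanSpace ℝ (Fin d)) {L : ℝ} {T : ℝ≥0}

/-- Real moments of the two differences of interpolated paths, uniformly in time. -/
lemma exists_iSup_lintegral_le (hfg : CoeffAssumption f g L) (hR : R.PosSemidef)
    (hw : IsBrownianMotion w R P) (hT : 0 < T) {p : ℝ} (hp : 0 < p) :
    ∃ K : ℝ, ∀ N : ℕ, 0 < N →
      (⨆ t ∈ Set.Icc (0 : ℝ) T,
          ∫⁻ ω, ‖finePath f g R x₀ w T N t ω - antitheticPath f g R x₀ w T N t ω‖ₑ ^ p ∂P)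
        ≤ ENNReal.ofReal (K * ((T : ℝ) / N) ^ (p / 2)) ∧
      (⨆ t ∈ Set.Icc (0 : ℝ) T,
          ∫⁻ ω, ‖(1 / 2 : ℝ) • (finePath f g R x₀ w T N t ω + antitheticPath f g R x₀ w T N t ω)
            - coarsePath f g R x₀ w T N t ω‖ₑ ^ p ∂P)
        ≤ ENNReal.ofReal (K * ((T : ℝ) / N) ^ p) := by
  have hT' : (0 : ℝ) < T := hT
  obtain ⟨S, hSC, hS⟩ := hfg.exists_represents R (Real.sqrt T)
  have hγ := hS.isNoise hR
  obtain ⟨m, hm⟩ : ∃ m : ℕ, p ≤ m := ⟨⌈p⌉₊, Nat.le_ceil p⟩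
  obtain ⟨q, hq⟩ : ∃ q, q = 2 * m + 2 := ⟨_, rfl⟩
  have hpq : p ≤ q := hm.trans (by exact_mod_cast (by omega : m ≤ q))
  obtain ⟨K₁, hK₁, h₁⟩ := hγ.exists_expLE_diff_fine P m hT'.le x₀
  obtain ⟨K₂, hK₂, h₂⟩ := hγ.exists_expLE_avg_fine P m hT'.le x₀
  rw [← hq] at h₁ h₂
  have c1 : 0 ≤ K₁ ^ (p / q) := Real.rpow_nonneg hK₁ _
  have c2 : 0 ≤ K₂ ^ (p / q) := Real.rpow_nonneg hK₂ _
  refine ⟨K₁ ^ (p / q) + K₂ ^ (p / q), fun N hN => ?_⟩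
  obtain ⟨s, ζ, hs, hs2, hζ, hae⟩ := hS.exists_noise hR hw x₀ hT hN
  obtain ⟨hsT, hNs⟩ := step_size_bounds hT' hN hs2
  have hM : (T : ℝ) ≤ (2 * N : ℕ) * s ^ 2 := by push_cast; exact hNs.ge
  have hs2' : 0 < s ^ 2 := by positivity
  have hle : s ^ 2 ≤ T / N := by rw [← hs2]; linarith
  have ma := fun k => S.measurable_path s x₀ k fun i _ => hζ.measurable i
  have mb := fun k => S.measurable_path s x₀ (ζ := fun m => ζ (swapHalves m)) k
    fun i _ => hζ.measurable _
  have mc := measurable_midpoints_coarse S s x₀ hζ.measurable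
  have md : ∀ k, Measurable fun ω => S.path s x₀ (fun m => ζ m ω) k
      - S.antiPath s x₀ (fun m => ζ m ω) k := fun k => (ma k).sub (mb k)
  have me : ∀ k, Measurable fun ω => (1 / 2 : ℝ) • (S.path s x₀ (fun m => ζ m ω) k
      + S.antiPath s x₀ (fun m => ζ m ω) k) - midpoints (S.coarse s x₀ fun m => ζ m ω) k :=
    fun k => (((ma k).add (mb k)).const_smul (1 / 2 : ℝ)).sub (mc k)
  constructor
  · refine iSup₂_le fun t ht => ?_
    -- The index `2 * N + 1` past the time horizon is included, since `interp` reads the next grid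
    -- value also at `t = T`, with weight zero.
    have htM := ht.2.trans hM
    have e : ∫⁻ ω, ‖finePath f g R x₀ w T N t ω - antitheticPath f g R x₀ w T N t ω‖ₑ ^ p ∂P
        = ∫⁻ ω, ‖∑ k ∈ Finset.range (2 * N + 2), hat (s ^ 2) k t •
          (S.path s x₀ (fun m => ζ m ω) k - S.antiPath s x₀ (fun m => ζ m ω) k)‖ₑ ^ p ∂P := by
      refine lintegral_congr_ae ?_
      filter_upwards [hae] with ω hω
      obtain ⟨e1, e2, -⟩ := hω t ht.1
      rw [e1, e2, interp_eq_sum hs2' htM, interp_eq_sum hs2' htM, ← Finset.sum_sub_distrib]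
      simp only [smul_sub]
    rw [e]
    refine (lintegral_enorm_sum_smul_rpow_le (fun k _ => hat_nonneg hs2' ht.1 k)
      (sum_hat hs2' htM) md hp hpq hK₁ hs.le fun k hk => h₁ s hs.le (hsT.trans hSC) N hNs.le ζ hζ k
        (by have := Finset.mem_range.1 hk; omega)).trans (ENNReal.ofReal_le_ofReal ?_)
    have e3 : s ^ p = (s ^ 2) ^ (p / 2) := by
      rw [← Real.rpow_natCast, ← Real.rpow_mul hs.le]; congr 1; push_cast; ring
    rw [e3]
    gcongr
    linarith
  · refine iSup₂_le fun t ht => ?_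
    have htM := ht.2.trans hM
    have e : ∫⁻ ω, ‖(1 / 2 : ℝ) • (finePath f g R x₀ w T N t ω
          + antitheticPath f g R x₀ w T N t ω) - coarsePath f g R x₀ w T N t ω‖ₑ ^ p ∂P
        = ∫⁻ ω, ‖∑ k ∈ Finset.range (2 * N + 2), hat (s ^ 2) k t •
          ((1 / 2 : ℝ) • (S.path s x₀ (fun m => ζ m ω) k + S.antiPath s x₀ (fun m => ζ m ω) k)
            - midpoints (S.coarse s x₀ fun m => ζ m ω) k)‖ₑ ^ p ∂P := by
      refine lintegral_congr_ae ?_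
      filter_upwards [hae] with ω hω
      obtain ⟨e1, e2, e3⟩ := hω t ht.1
      rw [e1, e2, e3, interp_eq_sum hs2' htM, interp_eq_sum hs2' htM, interp_eq_sum hs2' htM,
        ← Finset.sum_add_distrib, Finset.smul_sum, ← Finset.sum_sub_distrib]
      congr 2
      refine Finset.sum_congr rfl fun k _ => ?_
      module
    rw [e]
    refine (lintegral_enorm_sum_smul_rpow_le (fun k _ => hat_nonneg hs2' ht.1 k)
      (sum_hat hs2' htM) me hp hpq hK₂ hs2'.le fun k hk => h₂ s hs (hsT.trans hSC) N hNs.le ζ hζ k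
        (by have := Finset.mem_range.1 hk; omega)).trans (ENNReal.ofReal_le_ofReal ?_)
    gcongr
    linarith

/-- Second moment, hence variance, of the antithetic correction of a smooth payoff of the time
average. -/
lemma exists_variance_asianCorrection_le (hfg : CoeffAssumption f g L) (hR : R.PosSemidef)
    (hw : IsBrownianMotion w R P) (hT : 0 < T) {Φ : EuclideanSpace ℝ (Fin d) → ℝ}
    (hΦ : ContDiff ℝ 2 Φ) {L₁ L₂ : ℝ} (hL₁ : ∀ x, ‖fderiv ℝ Φ x‖ ≤ L₁)
    (hL₂ : ∀ x, ‖fderiv ℝ (fderiv ℝ Φ) x‖ ≤ L₂) :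
    ∃ K : ℝ, ∀ N : ℕ, 0 < N → MemLp (asianCorrection f g R x₀ w T N Φ) 2 P ∧
      variance (asianCorrection f g R x₀ w T N Φ) P ≤ K * ((T : ℝ) / N) ^ 2 := by
  have hT' : (0 : ℝ) < T := hT
  obtain ⟨S, hSC, hS⟩ := hfg.exists_represents R (Real.sqrt T)
  have hγ := hS.isNoise hR
  obtain ⟨K₁, hK₁, h₁⟩ := hγ.exists_expLE_diff_fine P 1 hT'.le x₀
  obtain ⟨K₂, hK₂, h₂⟩ := hγ.exists_expLE_avg_fine P 0 hT'.le x₀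
  set B := max L₁ L₂ with hB
  have hB0 : 0 ≤ B := ((norm_nonneg _).trans (hL₁ 0)).trans (le_max_left _ _)
  have hΦd : Differentiable ℝ Φ := hΦ.differentiable (by norm_num)
  have hlip : ∀ x y, ‖Φ x - Φ y‖ ≤ B * ‖x - y‖ := fun x y =>
    convex_univ.norm_image_sub_le_of_norm_fderiv_le (fun z _ => hΦd z)
      (fun z _ => (hL₁ z).trans (le_max_left _ _)) (Set.mem_univ y) (Set.mem_univ x)
  have hlip' : ∀ x y, ‖fderiv ℝ Φ x - fderiv ℝ Φ y‖ ≤ B * ‖x - y‖ := fun x y =>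
    convex_univ.norm_image_sub_le_of_norm_fderiv_le
      (fun z _ => ((hΦ.fderiv_right (m := 1) (by norm_num)).differentiable (by norm_num)) z)
      (fun z _ => (hL₂ z).trans (le_max_right _ _)) (Set.mem_univ y) (Set.mem_univ x)
  have htaylor := norm_taylor_le_of_fderiv_lip hΦd hB0 hlip'
  refine ⟨2 * B ^ 2 * (K₁ + K₂), fun N hN => ?_⟩
  obtain ⟨s, ζ, hs, hs2, hζ, hae⟩ := hS.exists_noise hR hw x₀ hT hN
  obtain ⟨hsT, hNs⟩ := step_size_bounds hT' hN hs2
  have hM : (T : ℝ) ≤ (2 * N : ℕ) * s ^ 2 := by push_cast; exact hNs.ge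
  have hs2' : 0 < s ^ 2 := by positivity
  have hle : s ^ 2 ≤ T / N := by rw [← hs2]; linarith
  have ma := fun k => S.measurable_path s x₀ k fun i _ => hζ.measurable i
  have mb := fun k => S.measurable_path s x₀ (ζ := fun m => ζ (swapHalves m)) k
    fun i _ => hζ.measurable _
  have mc := measurable_midpoints_coarse S s x₀ hζ.measurable
  have md : ∀ k, Measurable fun ω => S.path s x₀ (fun m => ζ m ω) k
      - S.antiPath s x₀ (fun m => ζ m ω) k := fun k => (ma k).sub (mb k)
  have me : ∀ k, Measurable fun ω => (1 / 2 : ℝ) • (S.path s x₀ (fun m => ζ m ω) k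
      + S.antiPath s x₀ (fun m => ζ m ω) k) - midpoints (S.coarse s x₀ fun m => ζ m ω) k :=
    fun k => (((ma k).add (mb k)).const_smul (1 / 2 : ℝ)).sub (mc k)
  set c := avgWeight (s ^ 2) T
  set I := Finset.range (2 * N + 2)
  have hc0 : ∀ k ∈ I, 0 ≤ c k := fun k _ => avgWeight_nonneg hs2' hT'.le k
  have hc1 : ∑ k ∈ I, c k = 1 := sum_avgWeight hs2' hT' hM
  set Xf : Ω → EuclideanSpace ℝ (Fin d) :=
    fun ω => ∑ k ∈ I, c k • S.path s x₀ (fun m => ζ m ω) k with hXf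
  set Xa : Ω → EuclideanSpace ℝ (Fin d) :=
    fun ω => ∑ k ∈ I, c k • S.antiPath s x₀ (fun m => ζ m ω) k with hXa
  set Xc : Ω → EuclideanSpace ℝ (Fin d) :=
    fun ω => ∑ k ∈ I, c k • midpoints (S.coarse s x₀ fun m => ζ m ω) k with hXc
  have mXf : Measurable Xf := measurable_sum_smul I c ma
  have mXa : Measurable Xa := measurable_sum_smul I c mb
  have mXc : Measurable Xc := measurable_sum_smul I c mc
  have b1 : ExpLE P (fun ω => ‖Xf ω - Xa ω‖ ^ 4) (K₁ * s ^ 4) := by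
    refine (expLE_sum_smul hc0 hc1 (fun k _ => md k) fun k hk =>
      h₁ s hs.le (hsT.trans hSC) N hNs.le ζ hζ k
        (by have := Finset.mem_range.1 hk; omega)).mono fun ω => le_of_eq ?_
    rw [hXf, hXa]
    dsimp only
    rw [← Finset.sum_sub_distrib]
    simp only [smul_sub]
  have b2 : ExpLE P (fun ω => ‖(1 / 2 : ℝ) • (Xf ω + Xa ω) - Xc ω‖ ^ 2) (K₂ * (s ^ 2) ^ 2) := by
    refine (expLE_sum_smul hc0 hc1 (fun k _ => me k) fun k hk =>
      h₂ s hs (hsT.trans hSC) N hNs.le ζ hζ k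
        (by have := Finset.mem_range.1 hk; omega)).mono fun ω => le_of_eq ?_
    rw [hXf, hXa, hXc]
    dsimp only
    rw [← Finset.sum_add_distrib, Finset.smul_sum, ← Finset.sum_sub_distrib]
    congr 2
    refine Finset.sum_congr rfl fun k _ => ?_
    module
  set Z : Ω → ℝ := fun ω => (1 / 2) * (Φ (Xf ω) + Φ (Xa ω)) - Φ (Xc ω) with hZ
  have hΦm : Measurable Φ := hΦd.continuous.measurable
  have mZ : Measurable Z := by fun_prop
  have hZae : asianCorrection f g R x₀ w T N Φ =ᵐ[P] Z := by
    filter_upwards [hae] with ω hω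
    have key : ∀ {X : ℝ → Ω → EuclideanSpace ℝ (Fin d)} {x : ℕ → EuclideanSpace ℝ (Fin d)},
        (∀ t, 0 ≤ t → X t ω = interp (s ^ 2) x t) →
        timeAverage T X ω = ∑ k ∈ I, c k • x k := by
      intro X x hX
      rw [timeAverage, ← average_interp_eq_sum hs2' hT'.le hM]
      congr 1
      refine intervalIntegral.integral_congr fun t ht => ?_
      rw [Set.uIcc_of_le hT'.le] at ht
      exact hX t ht.1
    rw [asianCorrection, key fun t ht => (hω t ht).1, key fun t ht => (hω t ht).2.1,
      key fun t ht => (hω t ht).2.2]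
  have hZle : ∀ ω, Z ω ^ 2 ≤ 2 * B ^ 2 * (‖Xf ω - Xa ω‖ ^ 4
      + ‖(1 / 2 : ℝ) • (Xf ω + Xa ω) - Xc ω‖ ^ 2) := by
    intro ω
    have h3 := StepData.norm_average_sub_le_of_taylor hlip htaylor (Xf ω) (Xa ω) (Xc ω)
    rw [smul_eq_mul] at h3
    set D := ‖Xf ω - Xa ω‖
    set e := ‖(1 / 2 : ℝ) • (Xf ω + Xa ω) - Xc ω‖
    calc Z ω ^ 2 = ‖Z ω‖ ^ 2 := by rw [Real.norm_eq_abs, sq_abs]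
      _ ≤ (B * (D ^ 2 + e)) ^ 2 := pow_le_pow_left₀ (norm_nonneg _) h3 2
      _ = B ^ 2 * (D ^ 2 + e) ^ 2 := by ring
      _ ≤ B ^ 2 * (2 * (D ^ 4 + e ^ 2)) := by
          gcongr
          nlinarith [sq_nonneg (D ^ 2 - e)]
      _ = _ := by ring
  have hs4 : K₂ * (s ^ 2) ^ 2 = K₂ * s ^ 4 := by ring
  have hZ2 : ExpLE P (fun ω => Z ω ^ 2) (2 * B ^ 2 * (K₁ + K₂) * ((T : ℝ) / N) ^ 2) := by
    refine (((b1.add b2 (by fun_prop) (by positivity) (by positivity)).const_mul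
      (by positivity : 0 ≤ 2 * B ^ 2)).mono hZle).mono_right ?_
    calc _ = 2 * B ^ 2 * (K₁ + K₂) * (s ^ 2) ^ 2 := by ring
      _ ≤ _ := by gcongr
  have hint : Integrable (fun ω => Z ω ^ 2) P := by
    refine ⟨(mZ.pow_const 2).aestronglyMeasurable, ?_⟩
    rw [hasFiniteIntegral_iff_ofReal (Filter.Eventually.of_forall fun ω => sq_nonneg _)]
    exact lt_of_le_of_lt hZ2 ENNReal.ofReal_lt_top
  have hmem : MemLp Z 2 P := (memLp_two_iff_integrable_sq mZ.aestronglyMeasurable).2 hint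
  refine ⟨hmem.ae_eq hZae.symm, ?_⟩
  rw [variance_congr hZae]
  calc variance Z P ≤ ∫ ω, Z ω ^ 2 ∂P := variance_le_expectation_sq mZ.aestronglyMeasurable
    _ = (∫⁻ ω, ENNReal.ofReal (Z ω ^ 2) ∂P).toReal :=
        integral_eq_lintegral_of_nonneg_ae (Filter.Eventually.of_forall fun ω => sq_nonneg _)
          (mZ.pow_const 2).aestronglyMeasurable
    _ ≤ _ := ENNReal.toReal_le_of_le_ofReal (by positivity) hZ2

end Interpolated

end AntitheticMilstein

end

theorem theorem4p13 {d D : ℕ} {Ω : Type*} [MeasurableSpace Ω] (P : Measure Ω)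
    [IsProbabilityMeasure P]
    (f : EuclideanSpace ℝ (Fin d) → EuclideanSpace ℝ (Fin d))
    (g : EuclideanSpace ℝ (Fin d) → Matrix (Fin d) (Fin D) ℝ)
    (L : ℝ) (hfg : AntitheticMilstein.CoeffAssumption f g L)
    (x₀ : EuclideanSpace ℝ (Fin d)) (T : ℝ≥0) (hT : 0 < T)
    (R : Matrix (Fin D) (Fin D) ℝ) (hR : AntitheticMilstein.IsCorrelationMatrix R)
    (w : ℝ≥0 → Ω → EuclideanSpace ℝ (Fin D))
    (hw : AntitheticMilstein.IsBrownianMotion w R P) :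
    (∀ p : ℝ, 2 ≤ p → ∃ K : ℝ, ∀ N : ℕ, 0 < N →
      (⨆ t ∈ Set.Icc (0 : ℝ) T,
          ∫⁻ ω, ‖AntitheticMilstein.finePath f g R x₀ w T N t ω
            - AntitheticMilstein.antitheticPath f g R x₀ w T N t ω‖ₑ ^ p ∂P)
        ≤ ENNReal.ofReal (K * ((T : ℝ) / N) ^ (p / 2)) ∧
      (⨆ t ∈ Set.Icc (0 : ℝ) T,
          ∫⁻ ω, ‖(1 / 2 : ℝ) • (AntitheticMilstein.finePath f g R x₀ w T N t ω
              + AntitheticMilstein.antitheticPath f g R x₀ w T N t ω)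
            - AntitheticMilstein.coarsePath f g R x₀ w T N t ω‖ₑ ^ p ∂P)
        ≤ ENNReal.ofReal (K * ((T : ℝ) / N) ^ p)) ∧
    (∀ Φ : EuclideanSpace ℝ (Fin d) → ℝ, ContDiff ℝ 2 Φ →
      (∃ L₁ : ℝ, ∀ x, ‖fderiv ℝ Φ x‖ ≤ L₁) →
      (∃ L₂ : ℝ, ∀ x, ‖fderiv ℝ (fderiv ℝ Φ) x‖ ≤ L₂) →
      ∃ K : ℝ, ∀ N : ℕ, 0 < N →
        MemLp (AntitheticMilstein.asianCorrection f g R x₀ w T N Φ) 2 P ∧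
        variance (AntitheticMilstein.asianCorrection f g R x₀ w T N Φ) P
          ≤ K * ((T : ℝ) / N) ^ 2) := by
  refine ⟨fun p hp => AntitheticMilstein.exists_iSup_lintegral_le x₀ hfg hR.posSemidef hw hT
    (by linarith), ?_⟩
  rintro Φ hΦ ⟨L₁, h₁⟩ ⟨L₂, h₂⟩
  exact AntitheticMilstein.exists_variance_asianCorrection_le x₀ hfg hR.posSemidef hw hT hΦ h₁ h₂
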